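/- Fix a field $\mathbf{k}$. Let $\Delta$ be a finite simplicial complex of dimension $d-1$ (a finite collection of finite sets, closed under inclusion and containing $\emptyset$) that is balanced: it comes with a coloring $\kappa$ of its vertices by $[d]=\{1,\dots,d\}$ such that the two vertices of every edge have different colors. For $S\subseteq[d]$ let $\Delta_S=\{\tau\in\Delta:\kappa(\tau)\subseteq S\}$ be the rank-selected subcomplex. A complex $\Gamma$ is Cohen–Macaulay over $\mathbf{k}$ if $\widetilde H_i(\mathrm{lk}_\Gamma\tau;\mathbf{k})=0$ for every face $\tau\in\Gamma$ (including $\emptyset$) and every $i<\dim \mathrm{lk}_\Gamma\tau$. It is Buchsbaum over $\mathbf{k}$ if it is pure and the link of each of its vertices is Cohen–Macaulay over $\mathbf{k}$. It is doubly-Buchsbaum over $\mathbf{k}$ if it is Buchsbaum and, for every vertex $v$, the complex $\Gamma-v$ of all faces not containing $v$ is Buchsbaum of the same dimension as $\Gamma$. It is Buchsbaum* over $\mathbf{k}$ if it is Buchsbaum and, for every point $p$ of the geometric realization $|\Gamma|$, the canonical map $$\widetilde H_{e}(|\Gamma|;\mathbf{k})\to \widetilde H_{e}(|\Gamma|,|\Gamma|-p;\mathbf{k}),\qquad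 e=\dim\Gamma,$$ in singular homology is surjective. **Theorem.** 1. If $\Delta$ is doubly-Buchsbaum over $\mathbf{k}$, then $\Delta_S$ is Buchsbaum* over $\mathbf{k}$ for every proper subset $S\subsetneq[d]$. 2. If $\Delta$ is Buchsbaum* over $\mathbf{k}$, then $\Delta_S$ is Buchsbaum* over $\mathbf{k}$ for every $S\subseteq[d]$. -/

import Mathlib

open CategoryTheory

universe u v

/-- A finite simplicial complex with vertices in `V`: a finite collection of finite subsets of `V`
that contains the empty face and is closed under inclusion. An element of `V` need not be a vertex
of the complex. -/
structure SimplicialCpx (V : Type v) where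
  faces : Finset (Finset V)
  empty_mem : ∅ ∈ faces
  down_closed : ∀ {s t : Finset V}, s ∈ faces → t ⊆ s → t ∈ faces

namespace SimplicialCpx

section Combinatorics

variable {V : Type v} [DecidableEq V]

/-- `Δ.rank` is the largest number of vertices of a face, that is, `dim Δ + 1`. -/
def rank (Δ : SimplicialCpx V) : ℕ := Δ.faces.sup Finset.card

/-- The dimension of a complex; the complex `{∅}` has dimension `-1`. -/
def dim (Δ : SimplicialCpx V) : ℤ := (Δ.rank : ℤ) - 1

def IsVertex (Δ : SimplicialCpx V) (v : V) : Prop := {v} ∈ Δ.faces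

def IsFacet (Δ : SimplicialCpx V) (σ : Finset V) : Prop :=
  σ ∈ Δ.faces ∧ ∀ τ ∈ Δ.faces, σ ⊆ τ → σ = τ

/-- All facets have the same dimension. -/
def IsPure (Δ : SimplicialCpx V) : Prop :=
  ∀ σ τ : Finset V, Δ.IsFacet σ → Δ.IsFacet τ → σ.card = τ.card

/-- The link of a face `τ`: all faces `σ` disjoint from `τ` with `σ ∪ τ` a face. -/
def link (Δ : SimplicialCpx V) (τ : Finset V) (hτ : τ ∈ Δ.faces) : SimplicialCpx V where
  faces := Δ.faces.filter fun σ => Disjoint σ τ ∧ σ ∪ τ ∈ Δ.faces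
  empty_mem := by simp [Δ.empty_mem, hτ]
  down_closed := by
    intro s t hs hts
    rw [Finset.mem_filter] at hs ⊢
    exact ⟨Δ.down_closed hs.1 hts, Finset.disjoint_of_subset_left hts hs.2.1,
      Δ.down_closed hs.2.2 (Finset.union_subset_union_left hts)⟩

/-- The restriction `Δ - v` of `Δ` to the vertices different from `v`. -/
def deleteVertex (Δ : SimplicialCpx V) (v : V) : SimplicialCpx V where
  faces := Δ.faces.filter fun σ => v ∉ σ
  empty_mem := by simp [Δ.empty_mem]
  down_closed := by
    intro s t hs hts
    rw [Finset.mem_filter] at hs ⊢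
    exact ⟨Δ.down_closed hs.1 hts, fun h => hs.2 (hts h)⟩

/-- `κ` colors the vertices of `Δ` by `1, …, d`, where `dim Δ = d - 1`, so that the two vertices of
every edge have different colors. (Values of `κ` off the vertex set are irrelevant.) -/
structure IsBalancedColoring (Δ : SimplicialCpx V) (d : ℕ) (κ : V → ℕ) : Prop where
  dim_eq : Δ.dim = (d : ℤ) - 1
  color_mem : ∀ v, Δ.IsVertex v → κ v ∈ Finset.Icc 1 d
  color_ne : ∀ u v, u ≠ v → {u, v} ∈ Δ.faces → κ u ≠ κ v

/-- The rank-selected subcomplex `Δ_S`: all faces whose vertices have their colors in `S`. -/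
def rankSelected (Δ : SimplicialCpx V) (κ : V → ℕ) (S : Finset ℕ) : SimplicialCpx V where
  faces := Δ.faces.filter fun σ => σ.image κ ⊆ S
  empty_mem := by simp [Δ.empty_mem]
  down_closed := by
    intro s t hs hts
    rw [Finset.mem_filter] at hs ⊢
    exact ⟨Δ.down_closed hs.1 hts, (Finset.image_subset_image hts).trans hs.2⟩

end Combinatorics

/-! Reduced simplicial homology, by means of a total order on the vertices. -/

section SimplicialHomology

variable (k : Type u) [Field k] {V : Type v} [LinearOrder V]

/-- The simplicial boundary on formal combinations of finite sets,
`∂ {v₀ < ⋯ < vₘ} = ∑ j, (-1) ^ j • {v₀, …, v̂ⱼ, …, vₘ}`; it sends a one-point set to the empty set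
(augmentation) and the empty set to `0`. -/
noncomputable def boundary : (Finset V →₀ k) →ₗ[k] (Finset V →₀ k) :=
  Finsupp.linearCombination k fun σ : Finset V =>
    ∑ v ∈ σ, Finsupp.single (σ.erase v) ((-1 : k) ^ (σ.filter (· < v)).card)

/-- Chains of the augmented complex spanned by the faces with `n` vertices, i.e. of
dimension `n - 1`. -/
noncomputable def chains (Δ : SimplicialCpx V) (n : ℕ) : Submodule k (Finset V →₀ k) :=
  Finsupp.supported k k {σ : Finset V | σ ∈ Δ.faces ∧ σ.card = n}

noncomputable def cycles (Δ : SimplicialCpx V) (n : ℕ) : Submodule k (Finset V →₀ k) :=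
  chains k Δ n ⊓ LinearMap.ker (boundary k)

noncomputable def boundaries (Δ : SimplicialCpx V) (n : ℕ) : Submodule k (Finset V →₀ k) :=
  (chains k Δ (n + 1)).map (boundary k)

/-- `reducedHomology k Δ n` is the reduced simplicial homology of `Δ` over `k` in degree `n - 1`:
the space of all classes `z + boundaries` with `z` a cycle. -/
noncomputable def reducedHomology (Δ : SimplicialCpx V) (n : ℕ) :
    Submodule k ((Finset V →₀ k) ⧸ boundaries k Δ n) :=
  (cycles k Δ n).map (boundaries k Δ n).mkQ

/-- `Δ` is Cohen–Macaulay over `k`: the reduced homology of the link of every face (the empty face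
included) vanishes in all degrees `n - 1` below the dimension of the link. -/
def IsCohenMacaulay (Δ : SimplicialCpx V) : Prop :=
  ∀ (τ : Finset V) (hτ : τ ∈ Δ.faces) (n : ℕ), ((n : ℤ) - 1) < (Δ.link τ hτ).dim →
    reducedHomology k (Δ.link τ hτ) n = ⊥

/-- `Δ` is Buchsbaum over `k`: it is pure and all its vertex links are Cohen–Macaulay. -/
def IsBuchsbaum (Δ : SimplicialCpx V) : Prop :=
  Δ.IsPure ∧ ∀ (v : V) (hv : Δ.IsVertex v), IsCohenMacaulay k (Δ.link {v} hv)

/-- `Δ` is doubly Buchsbaum over `k`: it is Buchsbaum, and deleting any vertex leaves a Buchsbaum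
complex of the same dimension. -/
def IsDoublyBuchsbaum (Δ : SimplicialCpx V) : Prop :=
  IsBuchsbaum k Δ ∧
    ∀ v, Δ.IsVertex v → IsBuchsbaum k (Δ.deleteVertex v) ∧ (Δ.deleteVertex v).dim = Δ.dim

end SimplicialHomology

/-- The geometric realization of `Δ`: the points of `V → ℝ` with nonnegative (barycentric)
coordinates of sum `1` that vanish off a face. -/
def realization {V : Type v} (Δ : SimplicialCpx V) : Set (V → ℝ) :=
  {x | (∀ v, 0 ≤ x v) ∧ ∃ σ ∈ Δ.faces, (∀ v, v ∉ σ → x v = 0) ∧ ∑ v ∈ σ, x v = 1}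

/-! Singular homology with coefficients in `k`. -/

section SingularHomology

variable (k : Type u) [Field k]

/-- The singular chain complex with coefficients in `k`. -/
noncomputable abbrev singularChains :
    TopCat.{v} ⥤ ChainComplex (ModuleCat.{max u v} k) ℕ :=
  (AlgebraicTopology.singularChainComplexFunctor (ModuleCat.{max u v} k)).obj
    (ModuleCat.of k (ULift.{v} k))

noncomputable abbrev singularHomology (n : ℕ) (X : TopCat.{v}) : ModuleCat.{max u v} k :=
  ((singularChains k).obj X).homology n

/-- Reduced singular homology: the kernel of `Hₙ(X) → Hₙ(point)`. -/
noncomputable def reducedSingularHomology (n : ℕ) (X : TopCat.{v}) :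
    Submodule k (singularHomology k n X) :=
  LinearMap.ker (HomologicalComplex.homologyMap ((singularChains k).map
    (TopCat.ofHom (ContinuousMap.const X PUnit.unit) : X ⟶ TopCat.of PUnit.{v + 1})) n).hom

/-- The inclusion of a subset `A` into `X`. -/
def subspaceInclusion (X : TopCat.{v}) (A : Set X) : TopCat.of A ⟶ X :=
  TopCat.ofHom ⟨Subtype.val, continuous_subtype_val⟩

/-- The relative singular chain complex `C(X) / C(A)`. -/
noncomputable abbrev relativeSingularChains (X : TopCat.{v}) (A : Set X) :
    ChainComplex (ModuleCat.{max u v} k) ℕ :=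
  Limits.cokernel ((singularChains k).map (subspaceInclusion X A))

noncomputable abbrev relativeSingularHomology (n : ℕ) (X : TopCat.{v}) (A : Set X) :
    ModuleCat.{max u v} k :=
  (relativeSingularChains k X A).homology n

/-- The canonical map from the reduced homology of `X` to the homology of the pair `(X, A)`.
(In degrees `n ≥ 0` the reduced homology of a pair is its homology.) -/
noncomputable def canonicalMap (n : ℕ) (X : TopCat.{v}) (A : Set X) :
    reducedSingularHomology k n X →ₗ[k] relativeSingularHomology k n X A :=
  (HomologicalComplex.homologyMap
    (Limits.cokernel.π ((singularChains k).map (subspaceInclusion X A))) n).hom.domRestrict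
      (reducedSingularHomology k n X)

/-- `Δ` is Buchsbaum* over `k`: it is Buchsbaum, and with `dim Δ = d - 1`, for every point `p` of
`|Δ|` the canonical map from `H̃_{d-1}(|Δ|)` to `H̃_{d-1}(|Δ|, |Δ| - p)` is surjective.
(If `d = 0` there is no such point.) -/
def IsBuchsbaumStar {V : Type v} [LinearOrder V] (Δ : SimplicialCpx V) : Prop :=
  IsBuchsbaum k Δ ∧ ∀ p : Δ.realization,
    Function.Surjective (canonicalMap k (Δ.rank - 1) (TopCat.of Δ.realization) {p}ᶜ)

end SingularHomology

end SimplicialCpx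

set_option linter.unusedSectionVars false

/-! A point p of |Γ| lies in the relative interior of a unique nonempty face σ, and the pair (|Γ|,
|Γ| − p) has the homology of Γ relative to the faces not containing σ. In top degree the Buchsbaum*
condition therefore says: a chain of facets whose boundary has no face containing σ agrees, on the
faces containing σ, with a cycle of Γ. This is `LiftsCycles`, and `isBuchsbaumStar_iff` is the
translation.

Two combinatorial facts then suffice. First, deleting a colour class from a doubly Buchsbaum complex
leaves a Buchsbaum complex with this lifting property (`CoIndependent.liftsCycles_induce`). A
relative cycle c of the smaller complex lies below the top degree of Γ, where the link of σ is
acyclic, so c is some ∂x modulo chains avoiding σ. Every face of x contains exactly one deleted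
vertex v, and the part of x in the link of v is a relative cycle there. The link of v is doubly
Cohen–Macaulay, and in such complexes relative cycles lift: a cycle in the link of a vertex u bounds
in the deletion of u, and the cone over it minus that filling is a cycle of the whole complex. The
lifts for all v add up to a lift of c. Second, a Buchsbaum complex with liftable cycles is doubly
Buchsbaum (`IsBuchsbaumOfRank.isDoublyBuchsbaum_of_liftsCycles`). So colours can be removed one at a
time, which gives part 1; part 2 follows because Buchsbaum* implies doubly Buchsbaum.

The translation is made on chains. A singular relative cycle is pushed away from p until its
boundary misses the open star of σ, subdivided until it is small, and approximated simplicially;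
prism operators record the homotopies (`InteriorPoint.singLifts`). Since the approximation depends
on a singular simplex and not only on its points, the prism operators take a compatible family of
homotopies, one per simplex. Conversely, push, subdivision and approximation form a chain map that
fixes simplicial chains (`InteriorPoint.liftsCycles`).

Chains are indexed by numbers of vertices, so that index 0 is the augmentation term and reduced
homology needs no separate treatment. -/

namespace SimplicialCpx

/-! ### Contraction and cone operators on oriented chains -/

section SignedOperators

variable (k : Type u) [Field k] {V : Type v} [LinearOrder V]

/-- The sign `(-1) ^ #{w ∈ s | w < v}`. -/
def faceSign (v : V) (s : Finset V) : k := (-1 : k) ^ (s.filter (· < v)).card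

lemma faceSign_mul_self (v : V) (s : Finset V) : faceSign k v s * faceSign k v s = 1 := by
  rw [faceSign, ← pow_add, ← two_mul]
  simp

lemma faceSign_ne_zero (v : V) (s : Finset V) : faceSign k v s ≠ 0 := fun h => by
  simpa [h] using faceSign_mul_self k v s

lemma faceSign_insert_self (v : V) (s : Finset V) :
    faceSign k v (insert v s) = faceSign k v s := by
  simp [faceSign, Finset.filter_insert]

lemma faceSign_erase_self (v : V) (s : Finset V) :
    faceSign k v (s.erase v) = faceSign k v s := by
  rw [← faceSign_insert_self k v (s.erase v)]
  by_cases h : v ∈ s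
  · rw [Finset.insert_erase h]
  · rw [Finset.erase_eq_of_notMem h, faceSign_insert_self]

lemma faceSign_insert {v w : V} {s : Finset V} (hw : w ∉ s) :
    faceSign k v (insert w s) = (if w < v then -1 else 1) * faceSign k v s := by
  unfold faceSign
  rw [Finset.filter_insert]
  split_ifs with h
  · rw [Finset.card_insert_of_notMem (by simp [hw]), pow_succ]; ring
  · simp

lemma faceSign_erase {v w : V} {s : Finset V} (hw : w ∈ s) :
    faceSign k v (s.erase w) = (if w < v then -1 else 1) * faceSign k v s := by
  conv_rhs => rw [← Finset.insert_erase hw, faceSign_insert k (Finset.notMem_erase w s)]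
  split_ifs <;> ring

/-- Contraction with a vertex: `s ↦ ± (s \ {v})` if `v ∈ s`, and `0` otherwise. -/
noncomputable def contract (v : V) : (Finset V →₀ k) →ₗ[k] (Finset V →₀ k) :=
  Finsupp.linearCombination k fun s : Finset V =>
    if v ∈ s then Finsupp.single (s.erase v) (faceSign k v s) else 0

/-- The signed cone over a vertex: `s ↦ ± (s ∪ {v})` if `v ∉ s`, and `0` otherwise. -/
noncomputable def coneOver (v : V) : (Finset V →₀ k) →ₗ[k] (Finset V →₀ k) :=
  Finsupp.linearCombination k fun s : Finset V =>
    if v ∈ s then 0 else Finsupp.single (insert v s) (faceSign k v s)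

variable {k}

lemma contract_single (v : V) (s : Finset V) (a : k) : contract k v (Finsupp.single s a) =
    if v ∈ s then Finsupp.single (s.erase v) (a * faceSign k v s) else 0 := by
  simp only [contract, Finsupp.linearCombination_single]
  split_ifs <;> simp

lemma coneOver_single (v : V) (s : Finset V) (a : k) : coneOver k v (Finsupp.single s a) =
    if v ∈ s then 0 else Finsupp.single (insert v s) (a * faceSign k v s) := by
  simp only [coneOver, Finsupp.linearCombination_single]
  split_ifs <;> simp

lemma boundary_single (s : Finset V) (a : k) :
    boundary k (Finsupp.single s a) = ∑ v ∈ s, contract k v (Finsupp.single s a) := by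
  simp only [boundary, Finsupp.linearCombination_single, Finset.smul_sum]
  refine Finset.sum_congr rfl fun v hv => ?_
  simp [contract_single, hv, faceSign]

/-- Lets two boundaries be summed over one vertex set, so that operator identities can be compared
term by term. -/
lemma boundary_single_of_subset {s F : Finset V} (h : s ⊆ F) (a : k) :
    boundary k (Finsupp.single s a) = ∑ v ∈ F, contract k v (Finsupp.single s a) := by
  rw [boundary_single]
  refine Finset.sum_subset h fun v _ hv => ?_
  simp [contract_single, hv]

lemma contract_apply (v : V) (x : Finset V →₀ k) (s : Finset V) :
    contract k v x s = if v ∈ s then 0 else faceSign k v s * x (insert v s) := by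
  induction x using Finsupp.induction_linear with
  | zero => simp
  | add f g hf hg => rw [map_add, Finsupp.add_apply, hf, hg]; split_ifs <;> simp [mul_add]
  | single t a =>
    rw [contract_single]
    by_cases hs : v ∈ s
    · rw [if_pos hs]
      split_ifs with ht
      · rw [Finsupp.single_apply, if_neg]
        rintro rfl
        simp at hs
      · rfl
    · rw [if_neg hs, Finsupp.single_apply]
      by_cases hts : t = insert v s
      · subst hts
        simp [hs, faceSign_insert_self, mul_comm]
      · rw [if_neg hts]
        split_ifs with ht
        · rw [Finsupp.single_apply, if_neg, mul_zero]
          rintro rfl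
          exact hts (Finset.insert_erase ht).symm
        · simp

lemma coneOver_apply (v : V) (x : Finset V →₀ k) (s : Finset V) :
    coneOver k v x s = if v ∈ s then faceSign k v s * x (s.erase v) else 0 := by
  induction x using Finsupp.induction_linear with
  | zero => simp
  | add f g hf hg => rw [map_add, Finsupp.add_apply, hf, hg]; split_ifs <;> simp [mul_add]
  | single t a =>
    rw [coneOver_single]
    by_cases hs : v ∈ s
    · rw [if_pos hs, Finsupp.single_apply]
      by_cases hts : t = s.erase v
      · subst hts
        simp [hs, faceSign_erase_self, mul_comm]
      · rw [if_neg hts]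
        split_ifs with ht
        · simp
        · rw [Finsupp.single_apply, if_neg, mul_zero]
          rintro rfl
          exact hts (Finset.erase_insert ht).symm
    · rw [if_neg hs]
      split_ifs with ht
      · rfl
      · rw [Finsupp.single_apply, if_neg]
        rintro rfl
        simp at hs

/-- The smaller of the two vertices is counted in the sign of the larger one, but only if it has not
been removed before. -/
lemma contract_contract_of_ne {v w : V} (h : v ≠ w) (x : Finset V →₀ k) :
    contract k v (contract k w x) = -contract k w (contract k v x) := by
  ext s
  simp only [contract_apply, Finsupp.neg_apply, Finset.mem_insert, h, h.symm, false_or]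
  by_cases hv : v ∈ s
  · simp [hv]
  by_cases hw : w ∈ s
  · simp [hw]
  simp only [hv, hw, if_false, faceSign_insert k hv, faceSign_insert k hw, Finset.insert_comm v w]
  rcases h.lt_or_gt with h' | h' <;> simp [h', not_lt.2 h'.le] <;> ring

lemma contract_contract_self (v : V) (x : Finset V →₀ k) : contract k v (contract k v x) = 0 := by
  ext s
  simp [contract_apply]

/-- The relation between annihilation and creation operators. It holds for every chain because
`coneOver` kills simplices that already contain the apex. -/
lemma contract_coneOver_self (v : V) (x : Finset V →₀ k) :
    contract k v (coneOver k v x) = x - coneOver k v (contract k v x) := by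
  ext s
  simp only [contract_apply, coneOver_apply, Finsupp.sub_apply, Finset.mem_insert, true_or,
    if_true, Finset.notMem_erase, if_false, faceSign_insert_self, faceSign_erase_self]
  by_cases hv : v ∈ s
  · rw [if_pos hv, if_pos hv, ← mul_assoc, faceSign_mul_self, Finset.insert_erase hv]; simp
  · rw [if_neg hv, if_neg hv, ← mul_assoc, faceSign_mul_self, Finset.erase_insert hv]; simp

lemma contract_coneOver_of_ne {v w : V} (h : w ≠ v) (x : Finset V →₀ k) :
    contract k w (coneOver k v x) = -coneOver k v (contract k w x) := by
  ext s
  simp only [contract_apply, coneOver_apply, Finsupp.neg_apply, Finset.mem_insert, h.symm,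
    false_or, Finset.mem_erase, ne_eq, h, not_false_eq_true, true_and]
  by_cases hv : v ∈ s
  · by_cases hw : w ∈ s
    · simp [hw]
    · simp only [hv, hw, if_true, if_false, faceSign_insert k hw, faceSign_erase k hv,
        Finset.erase_insert_of_ne h]
      rcases h.lt_or_gt with h' | h' <;> simp [h', not_lt.2 h'.le] <;> ring
  · simp [hv]

/-- The boundary is a sum of contractions, which anticommute and square to zero. Hence contraction
carries cycles, and relative cycles, to links. -/
lemma boundary_contract (v : V) (x : Finset V →₀ k) :
    boundary k (contract k v x) = -contract k v (boundary k x) := by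
  induction x using Finsupp.induction_linear with
  | zero => simp
  | add f g hf hg => simp only [map_add, hf, hg]; abel
  | single s a =>
    have h1 : boundary k (contract k v (Finsupp.single s a)) =
        ∑ w ∈ s, contract k w (contract k v (Finsupp.single s a)) := by
      rw [contract_single]
      split_ifs
      · exact boundary_single_of_subset (Finset.erase_subset _ _) _
      · simp
    rw [h1, boundary_single, map_sum, ← Finset.sum_neg_distrib]
    refine Finset.sum_congr rfl fun w _ => ?_
    rcases eq_or_ne w v with rfl | hw
    · simp [contract_contract_self]
    · exact contract_contract_of_ne hw _

/-- Among the contractions that make up the boundary, only the one at the apex fails to anticommute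
with the cone, and it contributes `x`. -/
lemma boundary_coneOver (v : V) (x : Finset V →₀ k) :
    boundary k (coneOver k v x) = x - coneOver k v (boundary k x) := by
  induction x using Finsupp.induction_linear with
  | zero => simp
  | add f g hf hg => simp only [map_add, hf, hg]; abel
  | single s a =>
    have h1 : boundary k (coneOver k v (Finsupp.single s a)) =
        ∑ w ∈ insert v s, contract k w (coneOver k v (Finsupp.single s a)) := by
      rw [coneOver_single]
      split_ifs
      · simp
      · exact boundary_single_of_subset (subset_refl _) _
    rw [h1, boundary_single_of_subset (Finset.subset_insert v s), map_sum,
      ← Finset.add_sum_erase _ _ (Finset.mem_insert_self v s),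
      ← Finset.add_sum_erase _ _ (Finset.mem_insert_self v s), contract_coneOver_self,
      sub_add_eq_sub_sub, sub_eq_add_neg (Finsupp.single s a - _), ← Finset.sum_neg_distrib]
    refine congrArg₂ _ rfl (Finset.sum_congr rfl fun w hw => ?_)
    exact contract_coneOver_of_ne (Finset.ne_of_mem_erase hw) _

/-- A nonempty simplex is up to sign a cone over a smaller one, and two uses of the cone formula
reduce the claim to that one. -/
lemma boundary_boundary (x : Finset V →₀ k) : boundary k (boundary k x) = 0 := by
  induction x using Finsupp.induction_linear with
  | zero => simp
  | add f g hf hg => simp only [map_add, hf, hg, add_zero]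
  | single s a =>
    induction s using Finset.induction_on generalizing a with
    | empty => simp [boundary_single]
    | insert v s hv ih =>
      have h : Finsupp.single (insert v s) a =
          coneOver k v (Finsupp.single s (a * faceSign k v s)) := by
        rw [coneOver_single, if_neg hv, mul_assoc, faceSign_mul_self, mul_one]
      rw [h, boundary_coneOver, map_sub, boundary_coneOver, ih]
      simp

end SignedOperators

/-! ### Links, induced subcomplexes and purity -/

section LinksAndRestrictions

variable {V : Type v} [LinearOrder V]

@[ext]
lemma ext_faces {Γ Λ : SimplicialCpx V} (h : ∀ s, s ∈ Γ.faces ↔ s ∈ Λ.faces) : Γ = Λ := by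
  cases Γ; cases Λ
  simp only [mk.injEq]
  exact Finset.ext h

lemma mem_link {Γ : SimplicialCpx V} {τ : Finset V} (hτ : τ ∈ Γ.faces) {s : Finset V} :
    s ∈ (Γ.link τ hτ).faces ↔ Disjoint s τ ∧ s ∪ τ ∈ Γ.faces := by
  simp only [link, Finset.mem_filter, and_iff_right_iff_imp, and_imp]
  exact fun _ h => Γ.down_closed h Finset.subset_union_left

lemma mem_link_singleton {Γ : SimplicialCpx V} {v : V} (hv : {v} ∈ Γ.faces) {s : Finset V} :
    s ∈ (Γ.link {v} hv).faces ↔ v ∉ s ∧ insert v s ∈ Γ.faces := by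
  rw [mem_link, Finset.disjoint_singleton_right, Finset.union_comm, ← Finset.insert_eq]

lemma link_empty (Γ : SimplicialCpx V) : Γ.link ∅ Γ.empty_mem = Γ := by
  ext s
  simp [mem_link]

/-- The subcomplex of all faces whose vertices satisfy `p`. -/
def induce (Γ : SimplicialCpx V) (p : V → Prop) [DecidablePred p] : SimplicialCpx V where
  faces := Γ.faces.filter fun σ => ∀ v ∈ σ, p v
  empty_mem := by simp [Γ.empty_mem]
  down_closed := by
    intro s t hs hts
    rw [Finset.mem_filter] at hs ⊢
    exact ⟨Γ.down_closed hs.1 hts, fun v hv => hs.2 v (hts hv)⟩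

lemma mem_induce {Γ : SimplicialCpx V} {p : V → Prop} [DecidablePred p] {s : Finset V} :
    s ∈ (Γ.induce p).faces ↔ s ∈ Γ.faces ∧ ∀ v ∈ s, p v := by
  simp [induce]

lemma deleteVertex_eq_induce (Γ : SimplicialCpx V) (v : V) :
    Γ.deleteVertex v = Γ.induce (· ≠ v) := by
  ext s
  simp only [deleteVertex, Finset.mem_filter, mem_induce]
  refine and_congr_right fun _ => ⟨?_, fun h hv => h v hv rfl⟩
  rintro h w hw rfl
  exact h hw

lemma rankSelected_eq_induce (Γ : SimplicialCpx V) (κ : V → ℕ) (S : Finset ℕ) :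
    Γ.rankSelected κ S = Γ.induce (κ · ∈ S) := by
  ext s
  simp [rankSelected, mem_induce, Finset.image_subset_iff]

lemma link_induce {Γ : SimplicialCpx V} {p : V → Prop} [DecidablePred p] {τ : Finset V}
    (hτ : τ ∈ (Γ.induce p).faces) (hτ' : τ ∈ Γ.faces) :
    (Γ.induce p).link τ hτ = (Γ.link τ hτ').induce p := by
  have h := (mem_induce.1 hτ).2
  ext s
  simp only [mem_link, mem_induce, Finset.mem_union, or_imp, forall_and]
  tauto

lemma link_link {Γ : SimplicialCpx V} {τ σ : Finset V} (hτ : τ ∈ Γ.faces)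
    (hσ : σ ∈ (Γ.link τ hτ).faces) (h : σ ∪ τ ∈ Γ.faces) :
    (Γ.link τ hτ).link σ hσ = Γ.link (σ ∪ τ) h := by
  have hd := ((mem_link hτ).1 hσ).1
  ext s
  simp only [mem_link, Finset.disjoint_union_left, Finset.disjoint_union_right,
    Finset.union_assoc]
  tauto

/-- Every face lies in a face with exactly `r` vertices. -/
def IsPureOfRank (Γ : SimplicialCpx V) (r : ℕ) : Prop :=
  ∀ s ∈ Γ.faces, ∃ t ∈ Γ.faces, s ⊆ t ∧ t.card = r

lemma IsPureOfRank.card_le {Γ : SimplicialCpx V} {r : ℕ} (h : Γ.IsPureOfRank r) {s : Finset V}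
    (hs : s ∈ Γ.faces) : s.card ≤ r := by
  obtain ⟨t, -, hst, rfl⟩ := h s hs
  exact Finset.card_le_card hst

lemma IsPureOfRank.rank_eq {Γ : SimplicialCpx V} {r : ℕ} (h : Γ.IsPureOfRank r) : Γ.rank = r := by
  obtain ⟨t, ht, -, hr⟩ := h ∅ Γ.empty_mem
  exact le_antisymm (Finset.sup_le fun s hs => h.card_le hs) (hr ▸ Finset.le_sup (f := Finset.card) ht)

lemma exists_facet (Γ : SimplicialCpx V) {s : Finset V} (hs : s ∈ Γ.faces) :
    ∃ t, Γ.IsFacet t ∧ s ⊆ t := by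
  obtain ⟨t, ht, hmax⟩ := (Γ.faces.filter (s ⊆ ·)).exists_max_image Finset.card
    ⟨s, by simp [hs]⟩
  rw [Finset.mem_filter] at ht
  refine ⟨t, ⟨ht.1, fun τ hτ htτ => Finset.eq_of_subset_of_card_le htτ ?_⟩, ht.2⟩
  exact hmax τ (Finset.mem_filter.2 ⟨hτ, ht.2.trans htτ⟩)

/-- Trades the comparison of facets for a statement with the rank as a parameter, which passes
easily to links. -/
lemma isPure_iff {Γ : SimplicialCpx V} : Γ.IsPure ↔ Γ.IsPureOfRank Γ.rank := by
  constructor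
  · intro h s hs
    obtain ⟨t, ht, hst⟩ := Γ.exists_facet hs
    obtain ⟨m, hm, hmr⟩ := Finset.exists_mem_eq_sup Γ.faces ⟨∅, Γ.empty_mem⟩ Finset.card
    obtain ⟨m', hm', hmm'⟩ := Γ.exists_facet hm
    refine ⟨t, ht.1, hst, ?_⟩
    rw [h t m' ht hm']
    refine le_antisymm (Finset.le_sup (f := Finset.card) hm'.1) ?_
    rw [rank, hmr]
    exact Finset.card_le_card hmm'
  · intro h σ τ hσ hτ
    obtain ⟨t, ht, h1, h2⟩ := h σ hσ.1
    obtain ⟨t', ht', h1', h2'⟩ := h τ hτ.1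
    rw [hσ.2 t ht h1, hτ.2 t' ht' h1', h2, h2']

lemma IsPureOfRank.link {Γ : SimplicialCpx V} {r : ℕ} (h : Γ.IsPureOfRank r) {τ : Finset V}
    (hτ : τ ∈ Γ.faces) : (Γ.link τ hτ).IsPureOfRank (r - τ.card) := by
  intro s hs
  rw [mem_link] at hs
  obtain ⟨t, ht, hst, rfl⟩ := h _ hs.2
  have hτt : τ ⊆ t := Finset.subset_union_right.trans hst
  refine ⟨t \ τ, (mem_link hτ).2 ⟨Finset.sdiff_disjoint, ?_⟩, ?_, Finset.card_sdiff_of_subset hτt⟩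
  · rwa [Finset.sdiff_union_of_subset hτt]
  · exact Finset.subset_sdiff.2 ⟨Finset.subset_union_left.trans hst, hs.1⟩

end LinksAndRestrictions

/-! ### Chains of links and restrictions; deleting an independent set of vertices -/

section Chains

variable {k : Type u} [Field k] {V : Type v} [LinearOrder V]

lemma mem_chains {Γ : SimplicialCpx V} {n : ℕ} {x : Finset V →₀ k} :
    x ∈ chains k Γ n ↔ ∀ s, x s ≠ 0 → s ∈ Γ.faces ∧ s.card = n := by
  rw [chains, Finsupp.mem_supported]
  exact forall_congr' fun s => by rw [Finset.mem_coe, Finsupp.mem_support_iff]; rfl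

lemma mem_cycles {Γ : SimplicialCpx V} {n : ℕ} {x : Finset V →₀ k} :
    x ∈ cycles k Γ n ↔ x ∈ chains k Γ n ∧ boundary k x = 0 := Iff.rfl

lemma mem_boundaries {Γ : SimplicialCpx V} {n : ℕ} {x : Finset V →₀ k} :
    x ∈ boundaries k Γ n ↔ ∃ y ∈ chains k Γ (n + 1), boundary k y = x := Iff.rfl

lemma chains_mono {Γ Λ : SimplicialCpx V} (h : Γ.faces ⊆ Λ.faces) (n : ℕ) :
    chains k Γ n ≤ chains k Λ n := fun x hx => by
  rw [mem_chains] at hx ⊢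
  exact fun s hs => ⟨h (hx s hs).1, (hx s hs).2⟩

lemma single_mem_chains {Γ : SimplicialCpx V} {s : Finset V} (hs : s ∈ Γ.faces) (a : k) :
    Finsupp.single s a ∈ chains k Γ s.card :=
  Finsupp.single_mem_supported k a ⟨hs, rfl⟩

lemma chains_eq_bot {Γ : SimplicialCpx V} {n r : ℕ} (h : Γ.IsPureOfRank r) (hn : r < n)
    {x : Finset V →₀ k} (hx : x ∈ chains k Γ n) : x = 0 := by
  ext s
  by_contra hs
  obtain ⟨h1, h2⟩ := mem_chains.1 hx s hs
  have := h.card_le h1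
  omega

lemma reducedHomology_eq_bot_iff {Γ : SimplicialCpx V} {n : ℕ} :
    reducedHomology k Γ n = ⊥ ↔ cycles k Γ n ≤ boundaries k Γ n := by
  rw [reducedHomology, ← le_bot_iff, Submodule.map_le_iff_le_comap, Submodule.comap_bot,
    Submodule.ker_mkQ]

lemma contract_mem_chains {Γ : SimplicialCpx V} {v : V} (hv : {v} ∈ Γ.faces) {n : ℕ}
    {x : Finset V →₀ k} (hx : x ∈ chains k Γ (n + 1)) :
    contract k v x ∈ chains k (Γ.link {v} hv) n := by
  rw [mem_chains] at hx ⊢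
  intro s hs
  rw [contract_apply] at hs
  split_ifs at hs with h
  · simp at hs
  · obtain ⟨h1, h2⟩ := hx _ (right_ne_zero_of_mul hs)
    rw [Finset.card_insert_of_notMem h] at h2
    exact ⟨(mem_link_singleton hv).2 ⟨h, h1⟩, by omega⟩

lemma coneOver_mem_chains {Γ : SimplicialCpx V} {v : V} (hv : {v} ∈ Γ.faces) {n : ℕ}
    {x : Finset V →₀ k} (hx : x ∈ chains k (Γ.link {v} hv) n) :
    coneOver k v x ∈ chains k Γ (n + 1) := by
  rw [mem_chains] at hx ⊢
  intro s hs
  rw [coneOver_apply] at hs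
  split_ifs at hs with h
  · obtain ⟨h1, h2⟩ := hx _ (right_ne_zero_of_mul hs)
    rw [mem_link_singleton, Finset.insert_erase h] at h1
    rw [Finset.card_erase_of_mem h] at h2
    have := Finset.card_pos.2 ⟨v, h⟩
    exact ⟨h1.2, by omega⟩
  · simp at hs

lemma boundary_mem_chains {Γ : SimplicialCpx V} {n : ℕ} {x : Finset V →₀ k}
    (hx : x ∈ chains k Γ (n + 1)) : boundary k x ∈ chains k Γ n := by
  revert x
  change chains k Γ (n + 1) ≤ (chains k Γ n).comap (boundary k)
  rw [chains, Finsupp.supported_eq_span_single, Submodule.span_le]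
  rintro _ ⟨s, ⟨hs, hn⟩, rfl⟩
  refine Submodule.mem_comap.2 ?_
  rw [boundary_single]
  refine Submodule.sum_mem _ fun v hv => ?_
  rw [contract_single, if_pos hv]
  have h := single_mem_chains (k := k) (Γ.down_closed hs (Finset.erase_subset v s))
    (1 * faceSign k v s)
  rwa [Finset.card_erase_of_mem hv, hn] at h

lemma contract_eq_zero {v : V} {x : Finset V →₀ k} (h : ∀ s, x s ≠ 0 → v ∉ s) :
    contract k v x = 0 := by
  ext s
  rw [contract_apply]
  split_ifs
  · rfl
  · rw [not_imp_comm.1 (h _) (by simp), mul_zero, Finsupp.zero_apply]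

lemma contract_eq_zero_of_not_vertex {Γ : SimplicialCpx V} {v : V} (hv : {v} ∉ Γ.faces) {n : ℕ}
    {x : Finset V →₀ k} (hx : x ∈ chains k Γ n) : contract k v x = 0 :=
  contract_eq_zero fun s hs hvs =>
    hv (Γ.down_closed (mem_chains.1 hx s hs).1 (Finset.singleton_subset_iff.2 hvs))

lemma contract_eq_zero_of_link {Γ : SimplicialCpx V} {v : V} (hv : {v} ∈ Γ.faces) {n : ℕ}
    {x : Finset V →₀ k} (hx : x ∈ chains k (Γ.link {v} hv) n) : contract k v x = 0 :=
  contract_eq_zero fun s hs => ((mem_link_singleton hv).1 (mem_chains.1 hx s hs).1).1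

lemma contract_coneOver_of_link {Γ : SimplicialCpx V} {v : V} (hv : {v} ∈ Γ.faces) {n : ℕ}
    {x : Finset V →₀ k} (hx : x ∈ chains k (Γ.link {v} hv) n) :
    contract k v (coneOver k v x) = x := by
  rw [contract_coneOver_self, contract_eq_zero_of_link hv hx, map_zero, sub_zero]

lemma notMem_of_contract_eq_zero {v : V} {x : Finset V →₀ k} (h : contract k v x = 0)
    {s : Finset V} (hs : x s ≠ 0) : v ∉ s := fun hv => by
  have := DFunLike.congr_fun h (s.erase v)
  rw [contract_apply, if_neg (Finset.notMem_erase v s), Finset.insert_erase hv] at this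
  exact mul_ne_zero (faceSign_ne_zero k _ _) hs this

/-- Vanishing of contractions is the working test for avoiding vertices, being linear and compatible
with the boundary. -/
lemma mem_chains_induce {Γ : SimplicialCpx V} {p : V → Prop} [DecidablePred p] {n : ℕ}
    {x : Finset V →₀ k} (hx : x ∈ chains k Γ n) (h : ∀ v, ¬ p v → contract k v x = 0) :
    x ∈ chains k (Γ.induce p) n := by
  rw [mem_chains] at hx ⊢
  refine fun s hs => ⟨mem_induce.2 ⟨(hx s hs).1, fun v hv => ?_⟩, (hx s hs).2⟩
  by_contra hp
  exact notMem_of_contract_eq_zero (h v hp) hs hv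

lemma induce_faces_subset (Γ : SimplicialCpx V) (p : V → Prop) [DecidablePred p] :
    (Γ.induce p).faces ⊆ Γ.faces := fun _ hs => (mem_induce.1 hs).1

lemma contract_eq_zero_of_induce {Γ : SimplicialCpx V} {p : V → Prop} [DecidablePred p] {n : ℕ}
    {x : Finset V →₀ k} (hx : x ∈ chains k (Γ.induce p) n) {v : V} (hv : ¬ p v) :
    contract k v x = 0 :=
  contract_eq_zero fun s hs hvs => hv ((mem_induce.1 (mem_chains.1 hx s hs).1).2 v hvs)

/-- No face contains two vertices outside `p`. -/
def CoIndependent (Γ : SimplicialCpx V) (p : V → Prop) : Prop :=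
  ∀ s ∈ Γ.faces, ∀ v ∈ s, ∀ w ∈ s, ¬ p v → ¬ p w → v = w

lemma CoIndependent.link {Γ : SimplicialCpx V} {p : V → Prop} (h : Γ.CoIndependent p)
    {τ : Finset V} (hτ : τ ∈ Γ.faces) : (Γ.link τ hτ).CoIndependent p := fun s hs v hv w hw =>
  h (s ∪ τ) ((mem_link hτ).1 hs).2 v (Finset.mem_union_left _ hv) w (Finset.mem_union_left _ hw)

/-- Makes vertex deletion a special case of deleting an independent set. -/
lemma coIndependent_ne (Γ : SimplicialCpx V) (v : V) : Γ.CoIndependent (· ≠ v) := by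
  intro s _ u _ w _ hu hw
  rw [not_not.1 hu, not_not.1 hw]

lemma CoIndependent.contract_contract {Γ : SimplicialCpx V} {p : V → Prop}
    (h : Γ.CoIndependent p) {n : ℕ} {x : Finset V →₀ k} (hx : x ∈ chains k Γ n) {v w : V}
    (hv : ¬ p v) (hw : ¬ p w) : contract k v (contract k w x) = 0 := by
  refine contract_eq_zero fun s hs hvs => ?_
  rw [contract_apply] at hs
  split_ifs at hs with h1
  · simp at hs
  · refine h1 (h _ (mem_chains.1 hx _ (right_ne_zero_of_mul hs)).1 v (by simp [hvs]) w (by simp)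
      hv hw ▸ hvs)

/-- The vertices of `Γ` outside `p`. -/
def coVertices (Γ : SimplicialCpx V) (p : V → Prop) [DecidablePred p] : Finset V :=
  (Γ.faces.sup id).filter fun v => ¬ p v

lemma mem_coVertices {Γ : SimplicialCpx V} {p : V → Prop} [DecidablePred p] {v : V} :
    v ∈ Γ.coVertices p ↔ {v} ∈ Γ.faces ∧ ¬ p v := by
  simp only [coVertices, Finset.mem_filter, Finset.mem_sup, id]
  refine and_congr_left fun _ => ⟨?_, fun h => ⟨_, h, Finset.mem_singleton_self v⟩⟩
  rintro ⟨s, hs, hv⟩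
  exact Γ.down_closed hs (Finset.singleton_subset_iff.2 hv)

/-- Removing from a chain all its faces with a vertex outside `p`. -/
lemma CoIndependent.sub_sum_cone_mem {Γ : SimplicialCpx V} {p : V → Prop} [DecidablePred p]
    (h : Γ.CoIndependent p) {n : ℕ} {x : Finset V →₀ k} (hx : x ∈ chains k Γ (n + 1)) :
    x - ∑ v ∈ Γ.coVertices p, coneOver k v (contract k v x) ∈ chains k (Γ.induce p) (n + 1) := by
  refine mem_chains_induce (Submodule.sub_mem _ hx (Submodule.sum_mem _ fun v hv => ?_)) ?_
  · have hv := (mem_coVertices.1 hv).1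
    exact coneOver_mem_chains hv (contract_mem_chains hv hx)
  intro v hv
  rw [map_sub, map_sum]
  -- No face contains two removed vertices, so contraction at `v` sees only the cone with apex `v`.
  have key : ∀ w ∈ Γ.coVertices p, contract k v (coneOver k w (contract k w x)) =
      if w = v then contract k v x else 0 := by
    intro w hw
    have hw' := mem_coVertices.1 hw
    split_ifs with hwv
    · subst hwv
      exact contract_coneOver_of_link hw'.1 (contract_mem_chains hw'.1 hx)
    · rw [contract_coneOver_of_ne (Ne.symm hwv), h.contract_contract hx hv hw'.2, map_zero,
        neg_zero]
  rw [Finset.sum_congr rfl key, Finset.sum_ite_eq']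
  split_ifs with hvW
  · exact sub_self _
  · rw [contract_eq_zero_of_not_vertex (fun hv' => hvW (mem_coVertices.2 ⟨hv', hv⟩)) hx, sub_zero]

/-- If `Γ` and the links of the vertices outside `p` are acyclic, so is the subcomplex induced
on `p`. -/
lemma CoIndependent.acyclic_induce {Γ : SimplicialCpx V} {p : V → Prop} [DecidablePred p]
    (h : Γ.CoIndependent p) {n : ℕ} (hΓ : cycles k Γ n ≤ boundaries k Γ n)
    (hlk : ∀ v (hv : {v} ∈ Γ.faces), ¬ p v →
      cycles k (Γ.link {v} hv) n ≤ boundaries k (Γ.link {v} hv) n) :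
    cycles k (Γ.induce p) n ≤ boundaries k (Γ.induce p) n := by
  intro z hz
  obtain ⟨hz1, hz2⟩ := mem_cycles.1 hz
  obtain ⟨c, hc, rfl⟩ := mem_boundaries.1
    (hΓ (mem_cycles.2 ⟨chains_mono (induce_faces_subset Γ p) n hz1, hz2⟩))
  -- The cycle `boundary k c` has no face through `v`, so contracting `c` at `v` gives a cycle of
  -- the link, which bounds there. The value 0 elsewhere only makes the choice total.
  have hex : ∀ v : V, ∃ b : Finset V →₀ k, ∀ hv : v ∈ Γ.coVertices p,
      b ∈ chains k (Γ.link {v} (mem_coVertices.1 hv).1) (n + 1) ∧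
        boundary k b = contract k v c := by
    intro v
    by_cases hv : v ∈ Γ.coVertices p
    · have hv' := mem_coVertices.1 hv
      obtain ⟨b, hb, hbc⟩ := hlk v hv'.1 hv'.2 (mem_cycles.2 ⟨contract_mem_chains hv'.1 hc, by
        rw [boundary_contract, contract_eq_zero_of_induce hz1 hv'.2, neg_zero]⟩)
      exact ⟨b, fun _ => ⟨hb, hbc⟩⟩
    · exact ⟨0, fun h => absurd h hv⟩
  choose b hb using hex
  -- Adding boundaries leaves the boundary of `c` unchanged. By the cone formula this addition
  -- replaces the part of `c` through `v` by `b v`, which lies in the link of `v` and so in the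
  -- restriction.
  refine mem_boundaries.2 ⟨c + ∑ v ∈ Γ.coVertices p, boundary k (coneOver k v (b v)), ?_, ?_⟩
  · have hsum : ∑ v ∈ Γ.coVertices p, boundary k (coneOver k v (b v)) =
        ∑ v ∈ Γ.coVertices p, b v - ∑ v ∈ Γ.coVertices p, coneOver k v (contract k v c) := by
      rw [← Finset.sum_sub_distrib]
      exact Finset.sum_congr rfl fun v hv => by rw [boundary_coneOver, (hb v hv).2]
    rw [hsum, add_sub_left_comm, add_comm (∑ v ∈ Γ.coVertices p, b v)]
    refine Submodule.add_mem _ (h.sub_sum_cone_mem hc) (Submodule.sum_mem _ fun v hv => ?_)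
    have hv' := mem_coVertices.1 hv
    refine chains_mono ?_ _ (hb v hv).1
    intro s hs
    rw [mem_link_singleton] at hs
    refine mem_induce.2 ⟨Γ.down_closed hs.2 (Finset.subset_insert v s), fun w hw => ?_⟩
    by_contra hpw
    exact hs.1 (h _ hs.2 w (by simp [hw]) v (by simp) hpw hv'.2 ▸ hw)
  · rw [map_add, map_sum, Finset.sum_eq_zero fun v _ => boundary_boundary _, add_zero]

/-- The chains without faces containing `σ`. -/
def avoiding (k : Type u) [Field k] {V : Type v} (σ : Finset V) :
    Submodule k (Finset V →₀ k) where
  carrier := {x | ∀ s, σ ⊆ s → x s = 0}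
  zero_mem' := by simp
  add_mem' := by
    intro x y hx hy s hs
    simp [hx s hs, hy s hs]
  smul_mem' := by
    intro a x hx s hs
    simp [hx s hs]

lemma mem_avoiding {σ : Finset V} {x : Finset V →₀ k} :
    x ∈ avoiding k σ ↔ ∀ s, σ ⊆ s → x s = 0 := Iff.rfl

lemma avoiding_empty {x : Finset V →₀ k} : x ∈ avoiding k (∅ : Finset V) ↔ x = 0 :=
  ⟨fun h => Finsupp.ext fun s => h s (Finset.empty_subset s), fun h => h ▸ Submodule.zero_mem _⟩

/-- Peels a vertex off σ, so that relative statements for `insert v σ` in a complex become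
statements for σ in the link of `v`. -/
lemma mem_avoiding_insert {v : V} {σ : Finset V} (hv : v ∉ σ) {x : Finset V →₀ k} :
    x ∈ avoiding k (insert v σ) ↔ contract k v x ∈ avoiding k σ := by
  simp only [mem_avoiding, contract_apply]
  constructor
  · intro h s hs
    split_ifs
    · rfl
    · rw [h _ (Finset.insert_subset_insert v hs), mul_zero]
  · intro h s hs
    have h1 := h (s.erase v) (Finset.subset_erase.2 ⟨(Finset.subset_insert v σ).trans hs, hv⟩)
    rw [if_neg (Finset.notMem_erase v s), Finset.insert_erase (hs (Finset.mem_insert_self v σ))]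
      at h1
    exact (mul_eq_zero.1 h1).resolve_left (faceSign_ne_zero k _ _)

lemma contract_mem_avoiding {v : V} {σ : Finset V} {x : Finset V →₀ k}
    (hx : x ∈ avoiding k σ) : contract k v x ∈ avoiding k σ := by
  intro s hs
  rw [contract_apply]
  split_ifs
  · rfl
  · rw [hx _ (hs.trans (Finset.subset_insert v s)), mul_zero]

end Chains

/-! ### Lifting of relative cycles in doubly Cohen–Macaulay and doubly Buchsbaum complexes -/

section CohenMacaulay

variable (k : Type u) [Field k] {V : Type v} [LinearOrder V]

/-- The Cohen–Macaulay condition of a pure complex whose facets have `r` vertices. -/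
def IsCMOfRank (Γ : SimplicialCpx V) (r : ℕ) : Prop :=
  ∀ (τ : Finset V) (hτ : τ ∈ Γ.faces) (n : ℕ), n + τ.card < r →
    cycles k (Γ.link τ hτ) n ≤ boundaries k (Γ.link τ hτ) n

/-- The Buchsbaum condition, with the number `r` of vertices of the facets made explicit. -/
def IsBuchsbaumOfRank (Γ : SimplicialCpx V) (r : ℕ) : Prop :=
  Γ.IsPureOfRank r ∧ ∀ (v : V) (hv : {v} ∈ Γ.faces), IsCMOfRank k (Γ.link {v} hv) (r - 1)

/-- Doubly Cohen–Macaulay complexes. -/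
def IsDoublyCMOfRank (Γ : SimplicialCpx V) (r : ℕ) : Prop :=
  (Γ.IsPureOfRank r ∧ IsCMOfRank k Γ r) ∧ ∀ v, {v} ∈ Γ.faces →
    (Γ.induce (· ≠ v)).IsPureOfRank r ∧ IsCMOfRank k (Γ.induce (· ≠ v)) r

/-- The doubly Buchsbaum condition, with the number `r` of vertices of the facets made explicit. -/
def IsDoublyBuchsbaumOfRank (Γ : SimplicialCpx V) (r : ℕ) : Prop :=
  IsBuchsbaumOfRank k Γ r ∧ ∀ v, {v} ∈ Γ.faces → IsBuchsbaumOfRank k (Γ.induce (· ≠ v)) r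

/-- Top-dimensional relative cycles modulo the faces not containing `σ` lift to cycles. -/
def LiftsCycles (Γ : SimplicialCpx V) (r : ℕ) (σ : Finset V) : Prop :=
  ∀ c ∈ chains k Γ r, boundary k c ∈ avoiding k σ → ∃ z ∈ cycles k Γ r, c - z ∈ avoiding k σ

variable {k}

/-- By purity the link of τ has rank `r - τ.card`; the additive form of the inequality avoids
truncated subtraction. -/
lemma isCohenMacaulay_iff {Γ : SimplicialCpx V} {r : ℕ} (h : Γ.IsPureOfRank r) :
    IsCohenMacaulay k Γ ↔ IsCMOfRank k Γ r := by
  refine forall₂_congr fun τ hτ => forall_congr' fun n => ?_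
  have := h.card_le hτ
  rw [dim, (h.link hτ).rank_eq, reducedHomology_eq_bot_iff]
  refine imp_congr ?_ Iff.rfl
  omega

lemma isBuchsbaum_iff {Γ : SimplicialCpx V} {r : ℕ} (hr : Γ.rank = r) :
    IsBuchsbaum k Γ ↔ IsBuchsbaumOfRank k Γ r := by
  rw [IsBuchsbaum, IsBuchsbaumOfRank, isPure_iff, hr]
  refine and_congr_right fun h => forall₂_congr fun v hv => isCohenMacaulay_iff ?_
  simpa using h.link hv

/-- The clause on the dimension of the deletion is absorbed by using one rank `r` for both
complexes. -/
lemma isDoublyBuchsbaum_iff {Γ : SimplicialCpx V} {r : ℕ} (hr : Γ.rank = r) :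
    IsDoublyBuchsbaum k Γ ↔ IsDoublyBuchsbaumOfRank k Γ r := by
  rw [IsDoublyBuchsbaum, IsDoublyBuchsbaumOfRank, isBuchsbaum_iff hr]
  refine and_congr_right fun _ => forall₂_congr fun v _ => ?_
  rw [deleteVertex_eq_induce, dim, dim, hr]
  constructor
  · rintro ⟨h1, h2⟩
    exact (isBuchsbaum_iff (by omega)).1 h1
  · intro h
    have h' := h.1.rank_eq
    exact ⟨(isBuchsbaum_iff h').2 h, by rw [h']⟩

lemma IsCMOfRank.link {Γ : SimplicialCpx V} {r : ℕ} (h : IsCMOfRank k Γ r) {τ : Finset V}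
    (hτ : τ ∈ Γ.faces) : IsCMOfRank k (Γ.link τ hτ) (r - τ.card) := by
  intro σ hσ n hn
  have hσ' := (mem_link hτ).1 hσ
  rw [link_link hτ hσ hσ'.2]
  refine h _ _ n ?_
  rw [Finset.card_union_of_disjoint hσ'.1]
  omega

lemma IsCMOfRank.acyclic {Γ : SimplicialCpx V} {r n : ℕ} (h : IsCMOfRank k Γ r) (hn : n < r) :
    cycles k Γ n ≤ boundaries k Γ n := by
  have := h ∅ Γ.empty_mem n (by simpa using hn)
  rwa [link_empty] at this

/-- Links of the restriction are restrictions of links, to which `CoIndependent.acyclic_induce`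
applies. A degree is lost because it needs links of removed vertices, whose dimension is smaller by
one. -/
lemma CoIndependent.isCM_induce {Γ : SimplicialCpx V} {p : V → Prop} [DecidablePred p]
    (h : Γ.CoIndependent p) {r : ℕ} (hΓ : IsCMOfRank k Γ r) :
    IsCMOfRank k (Γ.induce p) (r - 1) := by
  intro τ hτ n hn
  have hτ' := (mem_induce.1 hτ).1
  rw [link_induce hτ hτ']
  refine (h.link hτ').acyclic_induce ((hΓ.link hτ').acyclic (by omega)) fun v hv _ => ?_
  refine ((hΓ.link hτ').link hv).acyclic ?_
  rw [Finset.card_singleton]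
  omega

/-- Taking the link of `u` commutes with deleting a vertex `v ≠ u`. -/
lemma IsDoublyCMOfRank.link_singleton {Γ : SimplicialCpx V} {r : ℕ} (h : IsDoublyCMOfRank k Γ r)
    {u : V} (hu : {u} ∈ Γ.faces) : IsDoublyCMOfRank k (Γ.link {u} hu) (r - 1) := by
  refine ⟨⟨by simpa using h.1.1.link hu, by simpa using h.1.2.link hu⟩, fun v hv => ?_⟩
  rw [mem_link_singleton, Finset.mem_singleton] at hv
  have hu' : {u} ∈ (Γ.induce (· ≠ v)).faces := by
    refine mem_induce.2 ⟨hu, fun w hw => ?_⟩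
    rw [Finset.mem_singleton.1 hw]
    exact hv.1
  rw [← link_induce hu' hu]
  have h2 := h.2 v (Γ.down_closed hv.2 (by simp))
  exact ⟨by simpa using h2.1.link hu', by simpa using h2.2.link hu'⟩

lemma IsPureOfRank.pos_of_vertex {Γ : SimplicialCpx V} {r : ℕ} (h : Γ.IsPureOfRank r) {u : V}
    (hu : {u} ∈ Γ.faces) : 1 ≤ r := by simpa using h.card_le hu

/-- The deletion of `u` is Cohen–Macaulay of the same rank, so `y` bounds a chain `x` there. The
cone over `y` and `x` have the same boundary, and `x` does not meet `u`; their difference is the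
cycle. -/
lemma IsDoublyCMOfRank.exists_cycle_contract_eq {Γ : SimplicialCpx V} {r : ℕ}
    (h : IsDoublyCMOfRank k Γ (r + 1)) {u : V} (hu : {u} ∈ Γ.faces) {y : Finset V →₀ k}
    (hy : y ∈ cycles k (Γ.link {u} hu) r) :
    ∃ z ∈ cycles k Γ (r + 1), contract k u z = y := by
  obtain ⟨hy1, hy2⟩ := mem_cycles.1 hy
  have hyd : y ∈ cycles k (Γ.induce (· ≠ u)) r := by
    refine mem_cycles.2 ⟨chains_mono ?_ r hy1, hy2⟩
    intro s hs
    rw [mem_link_singleton] at hs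
    refine mem_induce.2 ⟨Γ.down_closed hs.2 (Finset.subset_insert u s), ?_⟩
    rintro w hw rfl
    exact hs.1 hw
  obtain ⟨x, hx, rfl⟩ := mem_boundaries.1 ((h.2 u hu).2.acyclic (Nat.lt_succ_self r) hyd)
  refine ⟨coneOver k u (boundary k x) - x, mem_cycles.2 ⟨?_, ?_⟩, ?_⟩
  · exact Submodule.sub_mem _ (coneOver_mem_chains hu hy1)
      (chains_mono (induce_faces_subset _ _) _ hx)
  · rw [map_sub, boundary_coneOver, boundary_boundary, map_zero, sub_zero, sub_self]
  · rw [map_sub, contract_coneOver_of_link hu hy1, contract_eq_zero_of_induce hx (not_not.2 rfl),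
      sub_zero]

lemma mem_link_of_insert_mem {Γ : SimplicialCpx V} {u : V} {σ : Finset V} (hu : u ∉ σ)
    (h : insert u σ ∈ Γ.faces) (hu' : {u} ∈ Γ.faces) : σ ∈ (Γ.link {u} hu').faces :=
  (mem_link_singleton hu').2 ⟨hu, h⟩

/-- Induction on σ: contract a relative cycle at `u ∈ σ`, lift the result in the link of `u`, and
extend that cycle of the link to a cycle of Γ. -/
lemma IsDoublyCMOfRank.liftsCycles {Γ : SimplicialCpx V} {r : ℕ} (h : IsDoublyCMOfRank k Γ r)
    {σ : Finset V} (hσ : σ ∈ Γ.faces) : LiftsCycles k Γ r σ := by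
  induction σ using Finset.induction_on generalizing Γ r with
  | empty =>
    exact fun c hc hbd => ⟨c, mem_cycles.2 ⟨hc, avoiding_empty.1 hbd⟩, by simp⟩
  | insert u σ hu ih =>
    intro c hc hbd
    have hu' : {u} ∈ Γ.faces := Γ.down_closed hσ (by simp)
    obtain ⟨r, rfl⟩ := Nat.exists_eq_add_of_le' (h.1.1.pos_of_vertex hu')
    obtain ⟨z, hz, hzσ⟩ := ih (h.link_singleton hu') (mem_link_of_insert_mem hu hσ hu') _
      (contract_mem_chains hu' hc) (by
        rw [boundary_contract]
        exact Submodule.neg_mem _ ((mem_avoiding_insert hu).1 hbd))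
    obtain ⟨y, hy, rfl⟩ := h.exists_cycle_contract_eq hu' hz
    exact ⟨y, hy, by rwa [mem_avoiding_insert hu, map_sub]⟩

/-- Relative cycles modulo the faces not containing `σ` are relative boundaries if the homology of
the link of `σ` vanishes. -/
lemma exists_boundary_of_link_acyclic {Γ : SimplicialCpx V} {σ : Finset V} (hσ : σ ∈ Γ.faces)
    {n : ℕ} (h : cycles k (Γ.link σ hσ) n ≤ boundaries k (Γ.link σ hσ) n)
    {c : Finset V →₀ k} (hc : c ∈ chains k Γ (n + σ.card)) (hbd : boundary k c ∈ avoiding k σ) :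
    ∃ x ∈ chains k Γ (n + σ.card + 1), c - boundary k x ∈ avoiding k σ := by
  induction σ using Finset.induction_on generalizing Γ c with
  | empty =>
    rw [link_empty] at h
    obtain ⟨x, hx, rfl⟩ := mem_boundaries.1 (h (mem_cycles.2 ⟨hc, avoiding_empty.1 hbd⟩))
    exact ⟨x, hx, by simp⟩
  | insert u σ hu ih =>
    have hu' : {u} ∈ Γ.faces := Γ.down_closed hσ (by simp)
    have hlk := mem_link_of_insert_mem hu hσ hu'
    rw [Finset.card_insert_of_notMem hu, ← add_assoc] at hc ⊢
    obtain ⟨x, hx, hxσ⟩ := ih hlk (c := contract k u c) (by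
        have he : σ ∪ {u} = insert u σ := by rw [Finset.union_comm, ← Finset.insert_eq]
        rw [link_link hu' hlk (by rwa [he])]
        simp only [he]
        exact h) (contract_mem_chains hu' hc) (by
        rw [boundary_contract]
        exact Submodule.neg_mem _ ((mem_avoiding_insert hu).1 hbd))
    -- The sign cancels the one in `boundary_contract`.
    refine ⟨-coneOver k u x, Submodule.neg_mem _ (coneOver_mem_chains hu' hx), ?_⟩
    rw [mem_avoiding_insert hu, map_neg, sub_neg_eq_add, map_add,
      ← neg_neg (contract k u (boundary k _)), ← boundary_contract,
      contract_coneOver_of_link hu' hx, ← sub_eq_add_neg]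
    exact hxσ

lemma IsDoublyBuchsbaumOfRank.link_singleton {Γ : SimplicialCpx V} {r : ℕ}
    (h : IsDoublyBuchsbaumOfRank k Γ r) {u : V} (hu : {u} ∈ Γ.faces) :
    IsDoublyCMOfRank k (Γ.link {u} hu) (r - 1) := by
  refine ⟨⟨by simpa using h.1.1.link hu, h.1.2 u hu⟩, fun v hv => ?_⟩
  rw [mem_link_singleton, Finset.mem_singleton] at hv
  have hu' : {u} ∈ (Γ.induce (· ≠ v)).faces := by
    refine mem_induce.2 ⟨hu, fun w hw => ?_⟩
    rw [Finset.mem_singleton.1 hw]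
    exact hv.1
  rw [← link_induce hu' hu]
  have h2 := h.2 v (Γ.down_closed hv.2 (by simp))
  exact ⟨by simpa using h2.1.link hu', h2.2 u hu'⟩

lemma CoIndependent.isBuchsbaum_induce {Γ : SimplicialCpx V} {p : V → Prop} [DecidablePred p]
    (h : Γ.CoIndependent p) {r : ℕ} (hΓ : IsBuchsbaumOfRank k Γ (r + 1))
    (hp : (Γ.induce p).IsPureOfRank r) : IsBuchsbaumOfRank k (Γ.induce p) r := by
  refine ⟨hp, fun v hv => ?_⟩
  have hv' := (mem_induce.1 hv).1
  rw [link_induce hv hv']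
  simpa using (h.link hv').isCM_induce (hΓ.2 v hv')

/-- Removing a colour class from a doubly Buchsbaum complex leaves a complex with liftable
cycles. -/
lemma CoIndependent.liftsCycles_induce {Γ : SimplicialCpx V} {p : V → Prop} [DecidablePred p]
    (h : Γ.CoIndependent p) {r : ℕ} (hΓ : IsDoublyBuchsbaumOfRank k Γ (r + 1))
    (hp : (Γ.induce p).IsPureOfRank r) {σ : Finset V} (hσ : σ ∈ (Γ.induce p).faces)
    (hne : σ.Nonempty) : LiftsCycles k (Γ.induce p) r σ := by
  intro c hc hbd
  have hσ' := mem_induce.1 hσ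
  have hσr := hp.card_le hσ
  obtain ⟨u, hu⟩ := hne
  have hu' : {u} ∈ Γ.faces := Γ.down_closed hσ'.1 (Finset.singleton_subset_iff.2 hu)
  obtain ⟨n, rfl⟩ := Nat.exists_eq_add_of_le' hσr
  -- The Buchsbaum condition concerns links of vertices only, so the link of σ is formed inside the
  -- link of some `u ∈ σ`. This is why σ must be nonempty.
  have hlk : cycles k (Γ.link σ hσ'.1) n ≤ boundaries k (Γ.link σ hσ'.1) n := by
    have he : σ.erase u ∪ {u} = σ := by
      rw [Finset.union_comm, ← Finset.insert_eq, Finset.insert_erase hu]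
    have hmem : σ.erase u ∈ (Γ.link {u} hu').faces :=
      mem_link_of_insert_mem (Finset.notMem_erase u σ) (by rw [Finset.insert_erase hu]; exact hσ'.1)
        hu'
    have := (hΓ.1.2 u hu') (σ.erase u) hmem n (by
      rw [Finset.card_erase_of_mem hu]
      have := Finset.card_pos.2 ⟨u, hu⟩
      omega)
    rw [link_link hu' hmem (by rw [he]; exact hσ'.1)] at this
    simpa only [he] using this
  have hcΓ := chains_mono (induce_faces_subset Γ p) _ hc
  -- The facets of Γ have one vertex more than the faces of `c`, so `c` lies below the top degree of
  -- Γ and is a relative boundary there.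
  obtain ⟨x, hx, hxσ⟩ := exists_boundary_of_link_acyclic hσ'.1 hlk hcΓ hbd
  -- The faces of `x` have too many vertices to lie in the restriction, so each contains a removed
  -- vertex.
  have hxsum : x = ∑ v ∈ Γ.coVertices p, coneOver k v (contract k v x) :=
    sub_eq_zero.1 (chains_eq_bot hp (Nat.lt_succ_self _) (h.sub_sum_cone_mem hx))
  -- Modulo chains avoiding σ, the boundary of `x` is `c`, which has no face through `v`; so
  -- contracting `x` at `v` gives a relative cycle of the link of `v`, a doubly Cohen–Macaulay
  -- complex. If σ is not in that link, the contraction already avoids σ and 0 is a lift.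
  have hex : ∀ v : V, ∃ z : Finset V →₀ k, ∀ hv : v ∈ Γ.coVertices p,
      z ∈ cycles k (Γ.link {v} (mem_coVertices.1 hv).1) (n + σ.card) ∧
        contract k v x - z ∈ avoiding k σ := by
    intro v
    by_cases hv : v ∈ Γ.coVertices p
    · obtain ⟨hv1, hv2⟩ := mem_coVertices.1 hv
      have hxv := contract_mem_chains hv1 hx
      by_cases hσv : σ ∈ (Γ.link {v} hv1).faces
      · obtain ⟨z, hz, hzσ⟩ := (hΓ.link_singleton hv1).liftsCycles hσv _ hxv (by
          have h1 : contract k v (c - boundary k x) ∈ avoiding k σ := contract_mem_avoiding hxσ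
          rwa [map_sub, contract_eq_zero_of_induce hc hv2, zero_sub, ← boundary_contract] at h1)
        exact ⟨z, fun _ => ⟨hz, hzσ⟩⟩
      · refine ⟨0, fun _ => ⟨Submodule.zero_mem _, fun s hs => ?_⟩⟩
        rw [sub_zero]
        by_contra hne
        exact hσv ((Γ.link {v} hv1).down_closed (mem_chains.1 hxv s hne).1 hs)
    · exact ⟨0, fun h => absurd h hv⟩
  choose z hz using hex
  have hzmem : ∀ v ∈ Γ.coVertices p, z v ∈ cycles k (Γ.induce p) (n + σ.card) := by
    intro v hv
    obtain ⟨hv1, hv2⟩ := mem_coVertices.1 hv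
    obtain ⟨hz1, hz2⟩ := mem_cycles.1 (hz v hv).1
    refine mem_cycles.2 ⟨chains_mono ?_ _ hz1, hz2⟩
    intro s hs
    rw [mem_link_singleton] at hs
    refine mem_induce.2 ⟨Γ.down_closed hs.2 (Finset.subset_insert v s), fun w hw => ?_⟩
    by_contra hpw
    exact hs.1 (h _ hs.2 w (by simp [hw]) v (by simp) hpw hv2 ▸ hw)
  have hzsum := Submodule.sum_mem _ hzmem
  refine ⟨_, hzsum, fun s hs => ?_⟩
  -- On faces of the restriction the cones have no coefficients, so there the boundary of `x` is the
  -- sum of its contractions, hence the sum of the `z v` modulo chains avoiding σ. On other faces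
  -- both `c` and the lift vanish.
  by_cases hsp : ∀ v ∈ s, p v
  · have hbx : boundary k x = ∑ v ∈ Γ.coVertices p, contract k v x -
        ∑ v ∈ Γ.coVertices p, coneOver k v (boundary k (contract k v x)) := by
      conv_lhs => rw [hxsum]
      rw [map_sum, ← Finset.sum_sub_distrib]
      exact Finset.sum_congr rfl fun v _ => boundary_coneOver _ _
    have h0 : (∑ v ∈ Γ.coVertices p, coneOver k v (boundary k (contract k v x))) s = 0 := by
      rw [Finsupp.finsetSum_apply]
      refine Finset.sum_eq_zero fun v hv => ?_
      rw [coneOver_apply, if_neg fun hvs => (mem_coVertices.1 hv).2 (hsp v hvs)]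
    have h1 : (∑ v ∈ Γ.coVertices p, (contract k v x - z v)) s = 0 :=
      Submodule.sum_mem _ (fun v hv => (hz v hv).2) s hs
    have h2 : (c - boundary k x) s = 0 := hxσ s hs
    rw [Finset.sum_sub_distrib, Finsupp.sub_apply] at h1
    rw [hbx, Finsupp.sub_apply, Finsupp.sub_apply, h0] at h2
    rw [Finsupp.sub_apply]
    linear_combination h1 + h2
  · by_contra hne
    exact hsp (mem_induce.1
      (mem_chains.1 (Submodule.sub_mem _ hc (mem_cycles.1 hzsum).1) s hne).1).2

end CohenMacaulay

/-! ### Liftable cycles make a Buchsbaum complex doubly Buchsbaum -/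

section LiftingImpliesDoublyBuchsbaum

variable {k : Type u} [Field k] {V : Type v} [LinearOrder V]

/-- Cone a relative cycle of the link, lift the cone in Γ, and contract the lift at `u`. -/
lemma LiftsCycles.link {Γ : SimplicialCpx V} {r : ℕ} {u : V} {σ : Finset V} (hu : u ∉ σ)
    (hu' : {u} ∈ Γ.faces) (h : LiftsCycles k Γ (r + 1) (insert u σ)) :
    LiftsCycles k (Γ.link {u} hu') r σ := by
  intro c hc hbd
  have hc0 := contract_coneOver_of_link hu' hc
  obtain ⟨z, hz, hzσ⟩ := h _ (coneOver_mem_chains hu' hc) (by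
    rw [mem_avoiding_insert hu, ← neg_neg (contract k u _), ← boundary_contract, hc0]
    exact Submodule.neg_mem _ hbd)
  obtain ⟨hz1, hz2⟩ := mem_cycles.1 hz
  refine ⟨contract k u z, mem_cycles.2 ⟨contract_mem_chains hu' hz1, ?_⟩, ?_⟩
  · rw [boundary_contract, hz2, map_zero, neg_zero]
  · rwa [mem_avoiding_insert hu, map_sub, hc0] at hzσ

lemma liftsCycles_link {Γ : SimplicialCpx V} {r : ℕ} {τ σ : Finset V} (hd : Disjoint τ σ)
    (hτ : τ ∈ Γ.faces) (h : LiftsCycles k Γ (r + τ.card) (τ ∪ σ)) :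
    LiftsCycles k (Γ.link τ hτ) r σ := by
  induction τ using Finset.induction_on generalizing Γ with
  | empty => rw [link_empty]; simpa using h
  | insert u τ hu ih =>
    have hu' : {u} ∈ Γ.faces := Γ.down_closed hτ (by simp)
    have hlk := mem_link_of_insert_mem hu hτ hu'
    have he : τ ∪ {u} = insert u τ := by rw [Finset.union_comm, ← Finset.insert_eq]
    rw [Finset.disjoint_insert_left] at hd
    have := ih hd.2 hlk (LiftsCycles.link (by simp [hu, hd.1]) hu' (by
      rwa [Finset.card_insert_of_notMem hu, Finset.insert_union, ← add_assoc] at h))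
    rw [link_link hu' hlk (by rwa [he])] at this
    simpa only [he] using this

/-- Below degree `g - 1` this is the deletion of an independent set. For `n + 1 = g` a filling `x`
of the cycle in Γ may pass through `v`; the part of `x` through `v` is a relative cycle, and
subtracting a cycle that lifts it frees the filling from `v`. -/
lemma acyclic_delete_of_liftsCycles {Γ : SimplicialCpx V} {g : ℕ} (hcm : IsCMOfRank k Γ g) {v : V}
    (h : {v} ∈ Γ.faces → LiftsCycles k Γ g {v}) {n : ℕ} (hn : n < g) :
    cycles k (Γ.induce (· ≠ v)) n ≤ boundaries k (Γ.induce (· ≠ v)) n := by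
  rcases Nat.lt_or_ge (n + 1) g with hn' | hn'
  · refine (coIndependent_ne Γ v).acyclic_induce (hcm.acyclic hn) fun w hw _ => ?_
    refine (hcm.link hw).acyclic ?_
    rw [Finset.card_singleton]
    omega
  obtain rfl : n + 1 = g := by omega
  intro y hy
  obtain ⟨hy1, hy2⟩ := mem_cycles.1 hy
  obtain ⟨x, hx, rfl⟩ := mem_boundaries.1 (hcm.acyclic hn
    (mem_cycles.2 ⟨chains_mono (induce_faces_subset _ _) n hy1, hy2⟩))
  by_cases hv : {v} ∈ Γ.faces
  · have hxv := contract_mem_chains hv hx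
    have hbxv : boundary k (contract k v x) = 0 := by
      rw [boundary_contract, contract_eq_zero_of_induce hy1 (not_not.2 rfl), neg_zero]
    have hins : ({v} : Finset V) = insert v ∅ := rfl
    obtain ⟨z, hz, hzv⟩ := h hv _ (coneOver_mem_chains hv hxv) (by
      rw [hins, mem_avoiding_insert (Finset.notMem_empty v), boundary_coneOver, hbxv, map_zero,
        sub_zero, contract_contract_self]
      exact Submodule.zero_mem _)
    obtain ⟨hz1, hz2⟩ := mem_cycles.1 hz
    rw [hins, mem_avoiding_insert (Finset.notMem_empty v), avoiding_empty, map_sub,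
      contract_coneOver_of_link hv hxv] at hzv
    refine mem_boundaries.2 ⟨x - z, ?_, by rw [map_sub, hz2, sub_zero]⟩
    refine mem_chains_induce (Submodule.sub_mem _ hx hz1) fun w hw => ?_
    rw [not_not.1 hw, map_sub, hzv]
  · refine mem_boundaries.2 ⟨x, mem_chains_induce hx fun w hw => ?_, rfl⟩
    rw [not_not.1 hw]
    exact contract_eq_zero_of_not_vertex hv hx

/-- If a facet `t` of the deletion were too small, `insert v t` would be the only face with `r`
vertices over `t`. The single face `insert v t` lifts to a cycle with coefficient 1 there, but
nothing can cancel its contribution at `t` to the boundary. -/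
lemma isPureOfRank_delete_of_liftsCycles {Γ : SimplicialCpx V} {r : ℕ} (hp : Γ.IsPureOfRank r)
    (h : ∀ σ ∈ Γ.faces, σ.Nonempty → LiftsCycles k Γ r σ) (v : V) :
    (Γ.induce (· ≠ v)).IsPureOfRank r := by
  intro s hs
  obtain ⟨t, ht, hst⟩ := (Γ.induce (· ≠ v)).exists_facet hs
  refine ⟨t, ht.1, hst, ?_⟩
  obtain ⟨htΓ, htv⟩ := mem_induce.1 ht.1
  by_contra hcard
  have hlt : t.card < r := lt_of_le_of_ne (hp.card_le htΓ) hcard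
  have hvt : v ∉ t := fun h => htv v h rfl
  have huniq : ∀ σ ∈ Γ.faces, t ⊆ σ → σ.card = r → σ = insert v t := by
    intro σ hσ htσ hσr
    have h1 : σ.erase v ∈ (Γ.induce (· ≠ v)).faces :=
      mem_induce.2 ⟨Γ.down_closed hσ (Finset.erase_subset v σ), fun w hw =>
        Finset.ne_of_mem_erase hw⟩
    have h2 := ht.2 _ h1 (Finset.subset_erase.2 ⟨htσ, hvt⟩)
    by_cases hvσ : v ∈ σ
    · rw [h2, Finset.insert_erase hvσ]
    · rw [Finset.erase_eq_of_notMem hvσ] at h2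
      rw [h2] at hlt
      omega
  obtain ⟨σ, hσ, htσ, hσr⟩ := hp t htΓ
  obtain rfl := huniq σ hσ htσ hσr
  have hbd : boundary k (Finsupp.single (insert v t) (1 : k)) ∈ avoiding k (insert v t) := by
    rw [boundary_single]
    refine Submodule.sum_mem _ fun w hw s hs => ?_
    rw [contract_single, if_pos hw, Finsupp.single_apply, if_neg]
    rintro rfl
    exact Finset.notMem_erase w _ (hs hw)
  obtain ⟨z, hz, hzσ⟩ := h _ hσ (Finset.insert_nonempty v t) _
    (hσr ▸ single_mem_chains hσ (1 : k)) hbd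
  obtain ⟨hz1, hz2⟩ := mem_cycles.1 hz
  have hz3 : z (insert v t) = 1 := by
    have := hzσ _ (subset_refl _)
    rw [Finsupp.sub_apply, Finsupp.single_eq_same] at this
    exact (sub_eq_zero.1 this).symm
  have key : (boundary k z) t = faceSign k v t := by
    -- Summing over one vertex set for all faces of `z`, enlarged by `v`, allows the summand of `v`
    -- to be isolated.
    have hF : boundary k z = ∑ w ∈ insert v (z.support.sup id), contract k w z := by
      have hz' := z.sum_single
      conv_lhs => rw [← hz']
      conv_rhs => enter [2, w]; rw [← hz']
      simp only [Finsupp.sum, map_sum]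
      rw [Finset.sum_comm]
      refine Finset.sum_congr rfl fun s hs => boundary_single_of_subset ?_ _
      exact (Finset.le_sup (f := id) hs).trans (Finset.subset_insert _ _)
    rw [hF, Finsupp.finsetSum_apply, Finset.sum_eq_single v]
    · rw [contract_apply, if_neg hvt, hz3, mul_one]
    · intro w _ hwv
      rw [contract_apply]
      split_ifs with hwt
      · rfl
      · by_contra hne
        obtain ⟨h1, h2⟩ := mem_chains.1 hz1 _ (right_ne_zero_of_mul hne)
        have := huniq _ h1 (Finset.subset_insert _ _) h2
        have hw : w ∈ insert v t := this ▸ Finset.mem_insert_self w t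
        exact (Finset.mem_insert.1 hw).elim hwv hwt
    · intro h
      exact absurd (Finset.mem_insert_self _ _) h
  rw [hz2] at key
  exact faceSign_ne_zero k v t key.symm

/-- Links in the deletion of `v` are deletions of `v` in links of Γ, and the lifting property is
inherited by links (`liftsCycles_link`), so `acyclic_delete_of_liftsCycles` applies to each of them.
-/
lemma IsBuchsbaumOfRank.isDoublyBuchsbaum_of_liftsCycles {Γ : SimplicialCpx V} {r : ℕ}
    (hΓ : IsBuchsbaumOfRank k Γ r) (h : ∀ σ ∈ Γ.faces, σ.Nonempty → LiftsCycles k Γ r σ) :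
    IsDoublyBuchsbaumOfRank k Γ r := by
  refine ⟨hΓ, fun v _ => ⟨isPureOfRank_delete_of_liftsCycles hΓ.1 h v, fun w hw τ hτ n hn => ?_⟩⟩
  have hw' := (mem_induce.1 hw).1
  have hwτ := (mem_link hw).1 hτ
  have hwτ' := mem_induce.1 hwτ.2
  rw [link_link hw hτ hwτ.2, link_induce hwτ.2 hwτ'.1]
  have hτ' : τ ∈ (Γ.link {w} hw').faces := (mem_link hw').2 ⟨hwτ.1, hwτ'.1⟩
  have hcard : (τ ∪ {w}).card = τ.card + 1 := by
    rw [Finset.card_union_of_disjoint hwτ.1, Finset.card_singleton]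
  have hle := hΓ.1.card_le hwτ'.1
  refine acyclic_delete_of_liftsCycles (g := r - (τ ∪ {w}).card) ?_ ?_ (by omega)
  · have := (hΓ.2 w hw').link hτ'
    rw [link_link hw' hτ' hwτ'.1] at this
    rwa [hcard, add_comm, ← Nat.sub_sub]
  · intro hv
    obtain ⟨hd, hm⟩ := (mem_link hwτ'.1).1 hv
    refine liftsCycles_link hd.symm hwτ'.1 ?_
    rw [Nat.sub_add_cancel hle, Finset.union_comm]
    exact h _ hm ⟨v, by simp⟩

end LiftingImpliesDoublyBuchsbaum

/-! ### Removing colours one at a time -/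

section RankSelection

variable {k : Type u} [Field k] {V : Type v} [LinearOrder V]

/-- The colors of the vertices of `Γ` lie in `T`, and `κ` is injective on faces. -/
structure IsColoredBy (Γ : SimplicialCpx V) (κ : V → ℕ) (T : Finset ℕ) : Prop where
  color_mem : ∀ s ∈ Γ.faces, ∀ v ∈ s, κ v ∈ T
  injOn : ∀ s ∈ Γ.faces, Set.InjOn κ s

lemma IsColoredBy.rankSelected {Γ : SimplicialCpx V} {κ : V → ℕ} {T : Finset ℕ}
    (h : Γ.IsColoredBy κ T) (S : Finset ℕ) : (Γ.rankSelected κ S).IsColoredBy κ S := by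
  rw [rankSelected_eq_induce]
  exact ⟨fun s hs => (mem_induce.1 hs).2, fun s hs => h.injOn s (mem_induce.1 hs).1⟩

lemma rankSelected_rankSelected (Γ : SimplicialCpx V) (κ : V → ℕ) {S T : Finset ℕ} (h : S ⊆ T) :
    (Γ.rankSelected κ T).rankSelected κ S = Γ.rankSelected κ S := by
  ext s
  simp only [rankSelected_eq_induce, mem_induce]
  exact ⟨fun hs => ⟨hs.1.1, hs.2⟩, fun hs => ⟨⟨hs.1, fun v hv => h (hs.2 v hv)⟩, hs.2⟩⟩

lemma IsColoredBy.rankSelected_eq {Γ : SimplicialCpx V} {κ : V → ℕ} {T : Finset ℕ}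
    (h : Γ.IsColoredBy κ T) : Γ.rankSelected κ T = Γ := by
  ext s
  rw [rankSelected_eq_induce, mem_induce]
  exact ⟨And.left, fun hs => ⟨hs, h.color_mem s hs⟩⟩

/-- A facet has as many vertices as there are colours, all of different colours, so it uses every
colour once and loses at most one vertex with colour `i`. -/
lemma IsColoredBy.isPure_erase {Γ : SimplicialCpx V} {κ : V → ℕ} {T : Finset ℕ}
    (h : Γ.IsColoredBy κ T) (hp : Γ.IsPureOfRank T.card) (i : ℕ) :
    (Γ.induce (κ · ∈ T.erase i)).IsPureOfRank (T.erase i).card := by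
  intro s hs
  obtain ⟨hs, hsi⟩ := mem_induce.1 hs
  obtain ⟨t, ht, hst, hcard⟩ := hp s hs
  have himg : t.image κ = T := by
    refine Finset.eq_of_subset_of_card_le ?_ ?_
    · exact Finset.image_subset_iff.2 (h.color_mem t ht)
    · rw [Finset.card_image_of_injOn (h.injOn t ht), hcard]
  have hsub : t.filter (κ · ∈ T.erase i) ⊆ t := Finset.filter_subset _ _
  refine ⟨t.filter (κ · ∈ T.erase i), mem_induce.2 ⟨Γ.down_closed ht hsub, fun v hv =>
    (Finset.mem_filter.1 hv).2⟩, fun v hv => Finset.mem_filter.2 ⟨hst hv, hsi v hv⟩, ?_⟩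
  rw [← Finset.card_image_of_injOn ((h.injOn t ht).mono (Finset.coe_subset.2 hsub))]
  congr 1
  ext j
  simp only [Finset.mem_image, Finset.mem_filter]
  constructor
  · rintro ⟨v, hv, rfl⟩
    exact hv.2
  · intro hj
    obtain ⟨v, hv, rfl⟩ := Finset.mem_image.1 (himg ▸ Finset.mem_of_mem_erase hj)
    exact ⟨v, ⟨hv, hj⟩, rfl⟩

lemma IsColoredBy.coIndependent_erase {Γ : SimplicialCpx V} {κ : V → ℕ} {T : Finset ℕ}
    (h : Γ.IsColoredBy κ T) (i : ℕ) : Γ.CoIndependent (κ · ∈ T.erase i) := by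
  intro s hs v hv w hw hv' hw'
  have hv1 := h.color_mem s hs v hv
  have hw1 := h.color_mem s hs w hw
  simp only [Finset.mem_erase, not_and_or, not_not, hv1, hw1, not_true, or_false] at hv' hw'
  exact h.injOn s hs hv hw (hv'.trans hw'.symm)

/-- Proper rank selections of a doubly Buchsbaum complex are Buchsbaum with liftable cycles. -/
theorem IsColoredBy.liftsCycles_rankSelected {Γ : SimplicialCpx V} {κ : V → ℕ} {S T : Finset ℕ}
    (h : Γ.IsColoredBy κ T) (hΓ : IsDoublyBuchsbaumOfRank k Γ T.card) (hST : S ⊂ T) :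
    IsBuchsbaumOfRank k (Γ.rankSelected κ S) S.card ∧ ∀ σ ∈ (Γ.rankSelected κ S).faces,
      σ.Nonempty → LiftsCycles k (Γ.rankSelected κ S) S.card σ := by
  induction hn : T.card - S.card generalizing Γ T with
  | zero =>
    have := Finset.card_lt_card hST
    omega
  | succ n ih =>
    obtain ⟨i, hiT, hiS⟩ := Finset.exists_of_ssubset hST
    have hcard := Finset.card_erase_add_one hiT
    have hp := h.isPure_erase hΓ.1.1 i
    have hind := h.coIndependent_erase i
    rw [← hcard] at hΓ
    have h1 := hind.isBuchsbaum_induce hΓ.1 hp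
    have h2 := fun σ hσ hne => hind.liftsCycles_induce hΓ hp (σ := σ) hσ hne
    rw [← rankSelected_eq_induce] at h1 h2
    have hSe : S ⊆ T.erase i := Finset.subset_erase.2 ⟨hST.subset, hiS⟩
    rcases hSe.eq_or_ssubset with rfl | hSe'
    · exact ⟨h1, h2⟩
    · rw [← rankSelected_rankSelected Γ κ hSe]
      -- The lifting property makes the smaller complex doubly Buchsbaum again, with one colour less
      -- to remove.
      exact ih (h.rankSelected _) (h1.isDoublyBuchsbaum_of_liftsCycles h2) hSe' (by omega)

end RankSelection

/-! ### Ordered chains: cones, homotopies and subdivision -/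

section OrderedChains

variable {k : Type u} [Field k]

lemma finsupp_hom_ext {α M : Type*} [AddCommGroup M] [Module k M] {f g : (α →₀ k) →ₗ[k] M}
    (h : ∀ a, f (Finsupp.single a 1) = g (Finsupp.single a 1)) (x : α →₀ k) : f x = g x := by
  have : f = g := Finsupp.lhom_ext' fun a => LinearMap.ext_ring (h a)
  rw [this]

lemma map_mem_of_supported {α M : Type*} [AddCommGroup M] [Module k M] {s : Set α}
    {f : (α →₀ k) →ₗ[k] M} {N : Submodule k M} (h : ∀ a ∈ s, f (Finsupp.single a 1) ∈ N)
    {x : α →₀ k} (hx : x ∈ Finsupp.supported k k s) : f x ∈ N := by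
  revert x
  change Finsupp.supported k k s ≤ N.comap f
  rw [Finsupp.supported_eq_span_single, Submodule.span_le]
  rintro _ ⟨a, ha, rfl⟩
  exact h a ha

/-- Formal combinations of `n`-tuples of points of `P`. -/
abbrev OrdChain (k : Type u) [Field k] (P : Type*) (n : ℕ) := (Fin n → P) →₀ k

variable {P Q R : Type*} {n : ℕ}

/-- The alternating sum of the omissions of one entry. -/
noncomputable def ordBoundary : OrdChain k P (n + 1) →ₗ[k] OrdChain k P n :=
  ∑ i : Fin (n + 1), (-1 : k) ^ (i : ℕ) •
    Finsupp.lmapDomain k k fun (w : Fin (n + 1) → P) j => w (i.succAbove j)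

/-- Prepending a point to all tuples. -/
noncomputable def ordCone (p : P) : OrdChain k P n →ₗ[k] OrdChain k P (n + 1) :=
  Finsupp.lmapDomain k k fun w : Fin n → P => (Fin.cons p w : Fin (n + 1) → P)

/-- The map of ordered chains induced by a map of points. -/
noncomputable def ordMap (f : P → Q) : OrdChain k P n →ₗ[k] OrdChain k Q n :=
  Finsupp.lmapDomain k k fun w : Fin n → P => f ∘ w

lemma ordBoundary_single (w : Fin (n + 1) → P) (a : k) :
    ordBoundary (Finsupp.single w a) =
      ∑ i : Fin (n + 1), (-1 : k) ^ (i : ℕ) •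
        Finsupp.single (fun j => w (i.succAbove j)) a := by
  simp [ordBoundary, LinearMap.sum_apply]

@[simp] lemma ordCone_single (p : P) (w : Fin n → P) (a : k) :
    ordCone p (Finsupp.single w a) = Finsupp.single (Fin.cons p w : Fin (n + 1) → P) a := by
  simp [ordCone]

@[simp] lemma ordMap_single (f : P → Q) (w : Fin n → P) (a : k) :
    ordMap f (Finsupp.single w a) = Finsupp.single (f ∘ w) a := by
  simp [ordMap]

lemma ordMap_cone (f : P → Q) (p : P) (x : OrdChain k P n) :
    ordMap f (ordCone p x) = ordCone (f p) (ordMap f x) := by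
  refine finsupp_hom_ext (f := ordMap f ∘ₗ ordCone p) (g := ordCone (f p) ∘ₗ ordMap f) ?_ x
  intro w
  simp [Fin.comp_cons]

lemma ordMap_ordMap (g : Q → R) (f : P → Q) (x : OrdChain k P n) :
    ordMap g (ordMap f x) = ordMap (g ∘ f) x := by
  refine finsupp_hom_ext (f := ordMap g ∘ₗ ordMap f) (g := ordMap (g ∘ f)) ?_ x
  intro w
  simp [Function.comp_assoc]

lemma ordMap_boundary (f : P → Q) (x : OrdChain k P (n + 1)) :
    ordBoundary (ordMap f x) = ordMap f (ordBoundary x) := by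
  refine finsupp_hom_ext (f := ordBoundary ∘ₗ ordMap f) (g := ordMap f ∘ₗ ordBoundary) ?_ x
  intro w
  simp only [LinearMap.comp_apply, ordMap_single, ordBoundary_single, map_sum, map_smul]
  rfl

lemma ordBoundary_cone_zero (p : P) (x : OrdChain k P 0) : ordBoundary (ordCone p x) = x := by
  refine finsupp_hom_ext (f := ordBoundary ∘ₗ ordCone p) (g := LinearMap.id) ?_ x
  intro w
  simp only [LinearMap.comp_apply, ordCone_single, ordBoundary_single, LinearMap.id_apply,
    Fin.sum_univ_succ, Finset.univ_eq_empty, Finset.sum_empty, add_zero, Fin.val_zero, pow_zero,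
    one_smul]
  congr 1

lemma ordBoundary_cone (p : P) (x : OrdChain k P (n + 1)) :
    ordBoundary (ordCone p x) = x - ordCone p (ordBoundary x) := by
  refine finsupp_hom_ext (f := ordBoundary ∘ₗ ordCone p)
    (g := LinearMap.id - ordCone p ∘ₗ ordBoundary) ?_ x
  intro w
  simp only [LinearMap.comp_apply, ordCone_single, ordBoundary_single, LinearMap.id_apply,
    LinearMap.sub_apply, map_sum, map_smul]
  rw [Fin.sum_univ_succ, sub_eq_add_neg, ← Finset.sum_neg_distrib]
  congr 1
  · simp
  · refine Finset.sum_congr rfl fun i _ => ?_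
    rw [Fin.val_succ, pow_succ, mul_neg_one, neg_smul]
    congr 3
    funext j
    refine Fin.cases ?_ (fun j => ?_) j <;> simp

lemma exists_eq_cons_single (w : Fin (n + 1) → P) (a : k) :
    Finsupp.single w a = ordCone (w 0) (Finsupp.single (Fin.tail w) a) := by
  rw [ordCone_single, Fin.cons_self_tail]

lemma ordBoundary_boundary (x : OrdChain k P (n + 2)) : ordBoundary (ordBoundary x) = 0 := by
  induction n with
  | zero =>
    refine finsupp_hom_ext (f := ordBoundary ∘ₗ ordBoundary) (g := 0) (fun w => ?_) x
    rw [LinearMap.comp_apply, exists_eq_cons_single, ordBoundary_cone, map_sub,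
      ordBoundary_cone_zero, sub_self, LinearMap.zero_apply]
  | succ n ih =>
    refine finsupp_hom_ext (f := ordBoundary ∘ₗ ordBoundary) (g := 0) (fun w => ?_) x
    rw [LinearMap.comp_apply, exists_eq_cons_single, ordBoundary_cone, map_sub,
      ordBoundary_cone, ih, map_zero, sub_zero, sub_self, LinearMap.zero_apply]

/-- Families of linear maps of ordered chains that commute with the boundary. -/
def IsOrdChainMap (f : ∀ n, OrdChain k P n →ₗ[k] OrdChain k Q n) : Prop :=
  ∀ n x, ordBoundary (f (n + 1) x) = f n (ordBoundary x)

/-- The homotopy between two chain maps obtained by coning off with apices `b`. -/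
noncomputable def ordHomotopy (f g : ∀ n, OrdChain k P n →ₗ[k] OrdChain k Q n)
    (b : ∀ n, (Fin (n + 1) → P) → Q) : ∀ n, OrdChain k P n →ₗ[k] OrdChain k Q (n + 1)
  | 0 => 0
  | n + 1 => Finsupp.linearCombination k fun w : Fin (n + 1) → P =>
      ordCone (b n w) (g (n + 1) (Finsupp.single w 1) - f (n + 1) (Finsupp.single w 1) -
        ordHomotopy f g b n (ordBoundary (Finsupp.single w 1)))

lemma ordHomotopy_succ_single (f g : ∀ n, OrdChain k P n →ₗ[k] OrdChain k Q n)
    (b : ∀ n, (Fin (n + 1) → P) → Q) (w : Fin (n + 1) → P) :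
    ordHomotopy f g b (n + 1) (Finsupp.single w 1) =
      ordCone (b n w) (g (n + 1) (Finsupp.single w 1) - f (n + 1) (Finsupp.single w 1) -
        ordHomotopy f g b n (ordBoundary (Finsupp.single w 1))) := by
  rw [ordHomotopy, Finsupp.linearCombination_single, one_smul]

/-- By induction, the chain that is coned off to define the homotopy on a tuple is a cycle, so the
boundary of its cone is the chain itself. In degree 0 the homotopy is 0, whence the hypothesis `h0`.
-/
lemma ordBoundary_homotopy {f g : ∀ n, OrdChain k P n →ₗ[k] OrdChain k Q n}
    (hf : IsOrdChainMap f) (hg : IsOrdChainMap g) (h0 : f 0 = g 0)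
    (b : ∀ n, (Fin (n + 1) → P) → Q) (x : OrdChain k P (n + 1)) :
    ordBoundary (ordHomotopy f g b (n + 1) x) + ordHomotopy f g b n (ordBoundary x) =
      g (n + 1) x - f (n + 1) x := by
  induction n with
  | zero =>
    refine finsupp_hom_ext (f := ordBoundary ∘ₗ ordHomotopy f g b 1 +
      ordHomotopy f g b 0 ∘ₗ ordBoundary) (g := g 1 - f 1) (fun w => ?_) x
    rw [LinearMap.add_apply, LinearMap.comp_apply, ordHomotopy_succ_single, ordBoundary_cone]
    simp only [ordHomotopy, LinearMap.comp_apply, LinearMap.zero_apply, sub_zero, add_zero,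
      map_sub, hf 0, hg 0, h0, sub_self, map_zero, LinearMap.sub_apply]
  | succ n ih =>
    refine finsupp_hom_ext (f := ordBoundary ∘ₗ ordHomotopy f g b (n + 2) +
      ordHomotopy f g b (n + 1) ∘ₗ ordBoundary) (g := g (n + 2) - f (n + 2)) (fun w => ?_) x
    have key := ih (ordBoundary (Finsupp.single w 1))
    rw [ordBoundary_boundary, map_zero, add_zero] at key
    have hz : ordBoundary (g (n + 2) (Finsupp.single w 1) - f (n + 2) (Finsupp.single w 1) -
        ordHomotopy f g b (n + 1) (ordBoundary (Finsupp.single w 1))) = 0 := by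
      rw [map_sub, map_sub, hf, hg, key, sub_self]
    rw [LinearMap.add_apply, LinearMap.comp_apply, ordHomotopy_succ_single, ordBoundary_cone,
      hz, map_zero, sub_zero, LinearMap.comp_apply, LinearMap.sub_apply, sub_add_cancel]

/-- Naturality, needed to match the homotopies on the faces of a cylinder with the one on the whole.
-/
lemma ordHomotopy_map {P' Q' : Type*} {f g : ∀ n, OrdChain k P n →ₗ[k] OrdChain k Q n}
    {f' g' : ∀ n, OrdChain k P' n →ₗ[k] OrdChain k Q' n}
    {b : ∀ n, (Fin (n + 1) → P) → Q} {b' : ∀ n, (Fin (n + 1) → P') → Q'}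
    {α : P → P'} {β : Q → Q'} (hf : ∀ n x, ordMap β (f n x) = f' n (ordMap α x))
    (hg : ∀ n x, ordMap β (g n x) = g' n (ordMap α x)) (hb : ∀ n w, β (b n w) = b' n (α ∘ w))
    (x : OrdChain k P n) :
    ordMap β (ordHomotopy f g b n x) = ordHomotopy f' g' b' n (ordMap α x) := by
  induction n with
  | zero => simp [ordHomotopy]
  | succ n ih =>
    refine finsupp_hom_ext (f := ordMap β ∘ₗ ordHomotopy f g b (n + 1))
      (g := ordHomotopy f' g' b' (n + 1) ∘ₗ ordMap α) (fun w => ?_) x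
    have h1 : ordMap β (g (n + 1) (Finsupp.single w 1) - f (n + 1) (Finsupp.single w 1) -
        ordHomotopy f g b n (ordBoundary (Finsupp.single w 1))) =
        g' (n + 1) (Finsupp.single (α ∘ w) 1) - f' (n + 1) (Finsupp.single (α ∘ w) 1) -
        ordHomotopy f' g' b' n (ordBoundary (Finsupp.single (α ∘ w) 1)) := by
      rw [map_sub, map_sub, hf, hg, ih, ← ordMap_boundary, ordMap_single]
    rw [LinearMap.comp_apply, LinearMap.comp_apply, ordMap_single, ordHomotopy_succ_single,
      ordHomotopy_succ_single, ordMap_cone, h1, hb]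

/-- Subdivision of ordered chains by successive cones with apices `b`. -/
noncomputable def ordSubdiv (b : ∀ n, (Fin (n + 1) → P) → P) :
    ∀ n, OrdChain k P n →ₗ[k] OrdChain k P n
  | 0 => LinearMap.id
  | n + 1 => Finsupp.linearCombination k fun w : Fin (n + 1) → P =>
      ordCone (b n w) (ordSubdiv b n (ordBoundary (Finsupp.single w 1)))

lemma ordSubdiv_succ_single (b : ∀ n, (Fin (n + 1) → P) → P) (w : Fin (n + 1) → P) :
    ordSubdiv (k := k) b (n + 1) (Finsupp.single w 1) =
      ordCone (b n w) (ordSubdiv b n (ordBoundary (Finsupp.single w 1))) := by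
  rw [ordSubdiv, Finsupp.linearCombination_single, one_smul]

lemma isOrdChainMap_subdiv (b : ∀ n, (Fin (n + 1) → P) → P) :
    IsOrdChainMap (ordSubdiv (k := k) b) := by
  intro n x
  induction n with
  | zero =>
    refine finsupp_hom_ext (f := ordBoundary ∘ₗ ordSubdiv b 1)
      (g := ordSubdiv b 0 ∘ₗ ordBoundary) (fun w => ?_) x
    rw [LinearMap.comp_apply, ordSubdiv_succ_single, ordBoundary_cone_zero, LinearMap.comp_apply]
  | succ n ih =>
    refine finsupp_hom_ext (f := ordBoundary ∘ₗ ordSubdiv b (n + 2))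
      (g := ordSubdiv b (n + 1) ∘ₗ ordBoundary) (fun w => ?_) x
    rw [LinearMap.comp_apply, ordSubdiv_succ_single, ordBoundary_cone, ih, ordBoundary_boundary,
      map_zero, map_zero, sub_zero, LinearMap.comp_apply]

lemma ordSubdiv_map {b : ∀ n, (Fin (n + 1) → P) → P} {b' : ∀ n, (Fin (n + 1) → Q) → Q}
    {α : P → Q} (hb : ∀ n w, α (b n w) = b' n (α ∘ w)) (x : OrdChain k P n) :
    ordMap α (ordSubdiv b n x) = ordSubdiv b' n (ordMap α x) := by
  induction n with
  | zero => simp [ordSubdiv]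
  | succ n ih =>
    refine finsupp_hom_ext (f := ordMap α ∘ₗ ordSubdiv b (n + 1))
      (g := ordSubdiv b' (n + 1) ∘ₗ ordMap α) (fun w => ?_) x
    rw [LinearMap.comp_apply, LinearMap.comp_apply, ordMap_single, ordSubdiv_succ_single,
      ordSubdiv_succ_single, ordMap_cone, ih, hb, ← ordMap_boundary, ordMap_single]

/-- Iterated subdivision. -/
noncomputable def ordSubdivIter (b : ∀ n, (Fin (n + 1) → P) → P) (m n : ℕ) :
    OrdChain k P n →ₗ[k] OrdChain k P n := (ordSubdiv b n : Module.End k (OrdChain k P n)) ^ m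

@[simp] lemma ordSubdivIter_zero (b : ∀ n, (Fin (n + 1) → P) → P) (x : OrdChain k P n) :
    ordSubdivIter b 0 n x = x := by simp [ordSubdivIter]

lemma ordSubdivIter_succ (b : ∀ n, (Fin (n + 1) → P) → P) (m : ℕ) (x : OrdChain k P n) :
    ordSubdivIter b (m + 1) n x = ordSubdiv b n (ordSubdivIter b m n x) := by
  rw [ordSubdivIter, pow_succ', Module.End.mul_apply, ordSubdivIter]

lemma ordSubdivIter_deg_zero (b : ∀ n, (Fin (n + 1) → P) → P) (m : ℕ) :
    ordSubdivIter (k := k) b m 0 = LinearMap.id := by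
  induction m with
  | zero => ext; simp
  | succ m ih => ext x : 1; ext; simp [ordSubdivIter_succ, ih, ordSubdiv]

lemma isOrdChainMap_subdivIter (b : ∀ n, (Fin (n + 1) → P) → P) (m : ℕ) :
    IsOrdChainMap (ordSubdivIter (k := k) b m) := by
  intro n x
  induction m with
  | zero => simp
  | succ m ih => rw [ordSubdivIter_succ, ordSubdivIter_succ, isOrdChainMap_subdiv, ih]

lemma ordSubdivIter_map {b : ∀ n, (Fin (n + 1) → P) → P} {b' : ∀ n, (Fin (n + 1) → Q) → Q}
    {α : P → Q} (hb : ∀ n w, α (b n w) = b' n (α ∘ w)) (m : ℕ) (x : OrdChain k P n) :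
    ordMap α (ordSubdivIter b m n x) = ordSubdivIter b' m n (ordMap α x) := by
  induction m with
  | zero => simp
  | succ m ih => rw [ordSubdivIter_succ, ordSubdivIter_succ, ordSubdiv_map hb, ih]

/-- Ordered chains of tuples that satisfy `A`. -/
abbrev ordOn (k : Type u) [Field k] {P : Type*} {n : ℕ} (A : (Fin n → P) → Prop) :
    Submodule k (OrdChain k P n) := Finsupp.supported k k {w | A w}

lemma ordCone_mem {p : P} {A : (Fin n → P) → Prop} {B : (Fin (n + 1) → P) → Prop}
    (h : ∀ w, A w → B (Fin.cons p w)) {x : OrdChain k P n} (hx : x ∈ ordOn k A) :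
    ordCone p x ∈ ordOn k B :=
  map_mem_of_supported (fun w hw => by
    rw [ordCone_single]; exact Finsupp.single_mem_supported k 1 (h w hw)) hx

lemma ordBoundary_single_mem {A : (Fin n → P) → Prop} {w : Fin (n + 1) → P}
    (h : ∀ i : Fin (n + 1), A fun j => w (i.succAbove j)) (a : k) :
    ordBoundary (Finsupp.single w a) ∈ ordOn k A := by
  rw [ordBoundary_single]
  exact Submodule.sum_mem _ fun i _ => Submodule.smul_mem _ _ (Finsupp.single_mem_supported k a (h i))

/-- If the values of all `w` lie in a set closed under the apices, so does its subdivision. -/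
lemma ordSubdiv_mem {b : ∀ n, (Fin (n + 1) → P) → P} {s : Set P}
    (hb : ∀ n w, (∀ i, w i ∈ s) → b n w ∈ s) {w : Fin n → P} (hw : ∀ i, w i ∈ s) :
    ordSubdiv (k := k) b n (Finsupp.single w 1) ∈ ordOn k fun w => ∀ i, w i ∈ s := by
  induction n with
  | zero => exact Finsupp.single_mem_supported k _ hw
  | succ n ih =>
    rw [ordSubdiv_succ_single]
    refine ordCone_mem (A := fun w => ∀ i, w i ∈ s) (fun w' hw' i => ?_)
      (map_mem_of_supported (fun w' hw' => ih hw') (ordBoundary_single_mem (fun i j => hw _) 1))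
    refine Fin.cases ?_ (fun j => ?_) i
    · exact hb n w hw
    · exact hw' j

end OrderedChains

/-! ### Affine simplices in convex sets -/

section AffineSimplices

variable {F G : Type*} [AddCommGroup F] [Module ℝ F] [TopologicalSpace F] [ContinuousAdd F]
  [ContinuousSMul ℝ F] [AddCommGroup G] [Module ℝ G] [TopologicalSpace G] [ContinuousAdd G]
  [ContinuousSMul ℝ G]

/-- The affine simplex in a convex set with given vertices. -/
def affSimplex {K : Set F} (hK : Convex ℝ K) {n : ℕ} (w : Fin n → K) :
    C(stdSimplex ℝ (Fin n), K) where
  toFun t := ⟨∑ i, t.1 i • (w i : F),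
    hK.sum_mem (fun i _ => t.2.1 i) t.2.2 fun i _ => (w i).2⟩
  continuous_toFun := by
    refine Continuous.subtype_mk (continuous_finsetSum _ fun i _ => ?_) _
    exact ((continuous_apply i).comp continuous_subtype_val).smul continuous_const

lemma affSimplex_coe {K : Set F} (hK : Convex ℝ K) {n : ℕ} (w : Fin n → K)
    (t : stdSimplex ℝ (Fin n)) : (affSimplex hK w t : F) = ∑ i, t.1 i • (w i : F) := rfl

/-- The inclusion of the face of the standard simplex opposite to vertex `i`. -/
noncomputable def faceMap {n : ℕ} (i : Fin (n + 1)) :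
    C(stdSimplex ℝ (Fin n), stdSimplex ℝ (Fin (n + 1))) :=
  ⟨stdSimplex.map i.succAbove, stdSimplex.continuous_map _⟩

lemma sum_stdSimplex_map {n m : ℕ} (f : Fin n → Fin m) (t : stdSimplex ℝ (Fin n)) (w : Fin m → F) :
    ∑ j, (stdSimplex.map f t).1 j • w j = ∑ i, t.1 i • w (f i) := by
  have h : ∀ j, (stdSimplex.map f t).1 j = ∑ i with f i = j, t.1 i := fun j =>
    FunOnFinite.linearMap_apply_apply ℝ ℝ f t.1 j
  simp only [h, Finset.sum_smul]
  rw [← Finset.sum_fiberwise Finset.univ f fun i => t.1 i • w (f i)]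
  refine Finset.sum_congr rfl fun j _ => Finset.sum_congr rfl fun i hi => ?_
  rw [(Finset.mem_filter.1 hi).2]

lemma affSimplex_comp_faceMap {K : Set F} (hK : Convex ℝ K) {n : ℕ} (w : Fin (n + 1) → K)
    (i : Fin (n + 1)) :
    (affSimplex hK w).comp (faceMap i) = affSimplex hK fun j => w (i.succAbove j) := by
  ext t
  exact sum_stdSimplex_map i.succAbove t fun j => (w j : F)

/-- Maps of convex sets that preserve affine simplices. -/
def IsAffineOn {K : Set F} {L : Set G} (hK : Convex ℝ K) (hL : Convex ℝ L) (f : C(K, L)) : Prop :=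
  ∀ (n : ℕ) (w : Fin n → K), f.comp (affSimplex hK w) = affSimplex hL (f ∘ w)

/-- The vertices of the standard simplex. -/
def stdVertices (n : ℕ) : Fin n → stdSimplex ℝ (Fin n) := stdSimplex.vertex

/-- Every singular simplex is thus the image of one universal affine simplex, on which operators on
singular chains can be defined and checked. -/
lemma affSimplex_stdVertices (n : ℕ) :
    affSimplex (convex_stdSimplex ℝ (Fin n)) (stdVertices n) = ContinuousMap.id _ := by
  ext t j
  change (∑ i, t.1 i • (Pi.single i 1 : Fin n → ℝ)) j = t.1 j
  rw [Finset.sum_apply]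
  simp [Pi.single_apply]

lemma faceMap_comp_stdVertices {n : ℕ} (i : Fin (n + 1)) :
    faceMap i ∘ stdVertices n = fun j => stdVertices (n + 1) (i.succAbove j) := by
  funext j
  exact stdSimplex.map_vertex _ _

lemma isAffineOn_faceMap {n : ℕ} (i : Fin (n + 1)) :
    IsAffineOn (convex_stdSimplex ℝ (Fin n)) (convex_stdSimplex ℝ (Fin (n + 1))) (faceMap i) := by
  intro m w
  ext t j
  have h : ∀ s : stdSimplex ℝ (Fin n), (faceMap i s).1 =
      FunOnFinite.linearMap ℝ ℝ i.succAbove s.1 := fun s => rfl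
  change (faceMap i _).1 j = (∑ l, t.1 l • (faceMap i (w l)).1) j
  rw [h, affSimplex_coe, map_sum]
  simp only [h, map_smul]

/-- The barycentre of the vertices of an affine simplex. -/
noncomputable def affBarycenter {K : Set F} (hK : Convex ℝ K) (n : ℕ) (w : Fin (n + 1) → K) : K :=
  affSimplex hK w stdSimplex.barycenter

lemma IsAffineOn.map_barycenter {K : Set F} {L : Set G} {hK : Convex ℝ K} {hL : Convex ℝ L}
    {f : C(K, L)} (hf : IsAffineOn hK hL f) (n : ℕ) (w : Fin (n + 1) → K) :
    f (affBarycenter hK n w) = affBarycenter hL n (f ∘ w) :=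
  DFunLike.congr_fun (hf (n + 1) w) stdSimplex.barycenter

lemma convex_cylinder (n : ℕ) : Convex ℝ (stdSimplex ℝ (Fin n) ×ˢ Set.Icc (0 : ℝ) 1) :=
  (convex_stdSimplex ℝ (Fin n)).prod (convex_Icc 0 1)

/-- The cylinder over the standard simplex with `n` vertices. -/
abbrev Cylinder (n : ℕ) : Set ((Fin n → ℝ) × ℝ) := stdSimplex ℝ (Fin n) ×ˢ Set.Icc (0 : ℝ) 1

/-- The inclusion of a face of a cylinder. -/
noncomputable def cylinderFace {n : ℕ} (i : Fin (n + 1)) : C(Cylinder n, Cylinder (n + 1)) where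
  toFun x := ⟨((faceMap i ⟨x.1.1, x.2.1⟩).1, x.1.2), (faceMap i ⟨x.1.1, x.2.1⟩).2, x.2.2⟩
  continuous_toFun := by fun_prop

/-- The inclusion of the simplex at height `s` of the cylinder. -/
def cylinderIncl (s : Set.Icc (0 : ℝ) 1) (n : ℕ) : C(stdSimplex ℝ (Fin n), Cylinder n) where
  toFun x := ⟨(x.1, s.1), x.2, s.2⟩
  continuous_toFun := by fun_prop

lemma isAffineOn_cylinderIncl (s : Set.Icc (0 : ℝ) 1) (n : ℕ) :
    IsAffineOn (convex_stdSimplex ℝ (Fin n)) (convex_cylinder n) (cylinderIncl s n) := by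
  intro m w
  ext t : 1
  apply Subtype.ext
  refine Prod.ext ?_ ?_
  · change (∑ l, t.1 l • (w l).1) = (∑ l, t.1 l • ((w l).1, s.1)).1
    rw [Prod.fst_sum]
    rfl
  · change s.1 = (∑ l, t.1 l • ((w l).1, s.1)).2
    rw [Prod.snd_sum]
    simp only [Prod.smul_snd, ← Finset.sum_smul, t.2.2, one_smul]

lemma isAffineOn_cylinderFace {n : ℕ} (i : Fin (n + 1)) :
    IsAffineOn (convex_cylinder n) (convex_cylinder (n + 1)) (cylinderFace i) := by
  intro m w
  ext t : 1
  apply Subtype.ext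
  have h : ∀ s : Cylinder n, (cylinderFace i s).1 =
      (FunOnFinite.linearMap ℝ ℝ i.succAbove s.1.1, s.1.2) := fun s => rfl
  change (cylinderFace i _).1 = ∑ l, t.1 l • (cylinderFace i (w l)).1
  rw [h, affSimplex_coe]
  simp only [h]
  refine Prod.ext ?_ ?_
  · simp only [Prod.fst_sum, Prod.smul_fst, map_sum, map_smul]
  · simp only [Prod.snd_sum, Prod.smul_snd]

end AffineSimplices

/-! ### Augmented singular chains, subdivision and prism operators -/

section SingularChains

variable {k : Type u} [Field k]

/-- Formal combinations of singular simplices with `n` vertices; for `n = 0` this is the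
augmentation term of the singular chain complex. -/
abbrev SingChain (k : Type u) [Field k] (Z : Type*) [TopologicalSpace Z] (n : ℕ) :=
  C(stdSimplex ℝ (Fin n), Z) →₀ k

variable {Z Z' Z'' : Type*} [TopologicalSpace Z] [TopologicalSpace Z'] [TopologicalSpace Z'']
  {n : ℕ}

/-- The singular boundary, augmentation included. -/
noncomputable def singBoundary : SingChain k Z (n + 1) →ₗ[k] SingChain k Z n :=
  ∑ i : Fin (n + 1), (-1 : k) ^ (i : ℕ) •
    Finsupp.lmapDomain k k fun τ : C(stdSimplex ℝ (Fin (n + 1)), Z) => τ.comp (faceMap i)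

/-- The map of singular chains induced by a continuous map. -/
noncomputable def singMap (f : C(Z, Z')) : SingChain k Z n →ₗ[k] SingChain k Z' n :=
  Finsupp.lmapDomain k k fun τ => f.comp τ

lemma singBoundary_single (τ : C(stdSimplex ℝ (Fin (n + 1)), Z)) (a : k) :
    singBoundary (Finsupp.single τ a) =
      ∑ i : Fin (n + 1), (-1 : k) ^ (i : ℕ) • Finsupp.single (τ.comp (faceMap i)) a := by
  simp [singBoundary, LinearMap.sum_apply]

@[simp] lemma singMap_single (f : C(Z, Z')) (τ : C(stdSimplex ℝ (Fin n), Z)) (a : k) :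
    singMap f (Finsupp.single τ a) = Finsupp.single (f.comp τ) a := by
  simp [singMap]

lemma singMap_singMap (g : C(Z', Z'')) (f : C(Z, Z')) (x : SingChain k Z n) :
    singMap g (singMap f x) = singMap (g.comp f) x := by
  refine finsupp_hom_ext (f := singMap g ∘ₗ singMap f) (g := singMap (g.comp f)) ?_ x
  intro w
  simp [ContinuousMap.comp_assoc]

lemma singBoundary_singMap (f : C(Z, Z')) (x : SingChain k Z (n + 1)) :
    singBoundary (singMap f x) = singMap f (singBoundary x) := by
  refine finsupp_hom_ext (f := singBoundary ∘ₗ singMap f) (g := singMap f ∘ₗ singBoundary) ?_ x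
  intro w
  simp only [LinearMap.comp_apply, singMap_single, singBoundary_single, map_sum, map_smul]
  rfl

section Realization

variable {F G : Type*} [AddCommGroup F] [Module ℝ F] [TopologicalSpace F] [ContinuousAdd F]
  [ContinuousSMul ℝ F] [AddCommGroup G] [Module ℝ G] [TopologicalSpace G] [ContinuousAdd G]
  [ContinuousSMul ℝ G] {K : Set F} {L : Set G}

/-- Affine simplices as singular chains. -/
noncomputable def affChain (hK : Convex ℝ K) : OrdChain k K n →ₗ[k] SingChain k K n :=
  Finsupp.lmapDomain k k (affSimplex hK)

@[simp] lemma affChain_single (hK : Convex ℝ K) (w : Fin n → K) (a : k) :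
    affChain hK (Finsupp.single w a) = Finsupp.single (affSimplex hK w) a := by
  simp [affChain]

lemma singBoundary_affChain (hK : Convex ℝ K) (x : OrdChain k K (n + 1)) :
    singBoundary (affChain hK x) = affChain hK (ordBoundary x) := by
  refine finsupp_hom_ext (f := singBoundary ∘ₗ affChain hK)
    (g := affChain hK ∘ₗ ordBoundary) ?_ x
  intro w
  simp only [LinearMap.comp_apply, affChain_single, singBoundary_single, ordBoundary_single,
    map_sum, map_smul, affSimplex_comp_faceMap]

lemma IsAffineOn.singMap_affChain {hK : Convex ℝ K} {hL : Convex ℝ L} {f : C(K, L)}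
    (hf : IsAffineOn hK hL f) (x : OrdChain k K n) :
    singMap f (affChain hK x) = affChain hL (ordMap f x) := by
  refine finsupp_hom_ext (f := singMap f ∘ₗ affChain hK)
    (g := affChain hL ∘ₗ ordMap f) ?_ x
  intro w
  simp only [LinearMap.comp_apply, affChain_single, singMap_single, ordMap_single]
  rw [hf]

end Realization

/-- The alternating sum of the faces of the standard simplex. -/
lemma sum_ordMap_faceMap (n : ℕ) :
    ∑ i : Fin (n + 1), (-1 : k) ^ (i : ℕ) • ordMap (faceMap i) (Finsupp.single (stdVertices n) 1) =
      ordBoundary (Finsupp.single (stdVertices (n + 1)) (1 : k)) := by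
  simp only [ordBoundary_single, ordMap_single, faceMap_comp_stdVertices]

/-- The `m`-fold barycentric subdivision of ordered chains in the standard simplex. -/
noncomputable def stdSubdiv (m N n : ℕ) :
    OrdChain k (stdSimplex ℝ (Fin N)) n →ₗ[k] OrdChain k (stdSimplex ℝ (Fin N)) n :=
  ordSubdivIter (affBarycenter (convex_stdSimplex ℝ (Fin N))) m n

lemma ordMap_faceMap_stdSubdiv (m : ℕ) {N : ℕ} (i : Fin (N + 1))
    (x : OrdChain k (stdSimplex ℝ (Fin N)) n) :
    ordMap (faceMap i) (stdSubdiv m N n x) = stdSubdiv m (N + 1) n (ordMap (faceMap i) x) :=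
  ordSubdivIter_map (fun n w => (isAffineOn_faceMap i).map_barycenter n w) m x

/-- The `m`-fold barycentric subdivision of singular chains. -/
noncomputable def singSubdiv (m n : ℕ) : SingChain k Z n →ₗ[k] SingChain k Z n :=
  Finsupp.linearCombination k fun τ : C(stdSimplex ℝ (Fin n), Z) =>
    singMap τ (affChain (convex_stdSimplex ℝ (Fin n))
      (stdSubdiv m n n (Finsupp.single (stdVertices n) 1)))

lemma singSubdiv_single (m : ℕ) (τ : C(stdSimplex ℝ (Fin n), Z)) :
    singSubdiv m n (Finsupp.single τ (1 : k)) =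
      singMap τ (affChain (convex_stdSimplex ℝ (Fin n))
        (stdSubdiv m n n (Finsupp.single (stdVertices n) 1))) := by
  rw [singSubdiv, Finsupp.linearCombination_single, one_smul]

/-- By naturality only the universal simplex matters. Its boundary is the signed sum of its images
under face maps, and these commute with subdivision because they preserve barycentres. -/
lemma singBoundary_singSubdiv (m : ℕ) (x : SingChain k Z (n + 1)) :
    singBoundary (singSubdiv m (n + 1) x) = singSubdiv m n (singBoundary x) := by
  refine finsupp_hom_ext (f := singBoundary ∘ₗ singSubdiv m (n + 1))
    (g := singSubdiv m n ∘ₗ singBoundary) (fun τ => ?_) x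
  rw [LinearMap.comp_apply, singSubdiv_single, singBoundary_singMap, singBoundary_affChain,
    stdSubdiv, isOrdChainMap_subdivIter, ← sum_ordMap_faceMap, LinearMap.comp_apply,
    singBoundary_single]
  simp only [map_sum, map_smul, singSubdiv_single]
  refine Finset.sum_congr rfl fun i _ => ?_
  rw [← stdSubdiv, ← ordMap_faceMap_stdSubdiv, ← (isAffineOn_faceMap i).singMap_affChain,
    singMap_singMap]

/-- A compatible family of homotopies, one for each singular simplex of `Z`. -/
structure SimplexHomotopy (Z Z' : Type*) [TopologicalSpace Z] [TopologicalSpace Z'] where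
  toMap : ∀ n, C(stdSimplex ℝ (Fin n), Z) → C(Cylinder n, Z')
  comp_face : ∀ n (τ : C(stdSimplex ℝ (Fin (n + 1)), Z)) (i : Fin (n + 1)),
    toMap n (τ.comp (faceMap i)) = (toMap (n + 1) τ).comp (cylinderFace i)

/-- The chain in the cylinder from the bottom to the subdivided top. -/
noncomputable def cylinderChain (m N n : ℕ) :
    OrdChain k (stdSimplex ℝ (Fin N)) n →ₗ[k] OrdChain k (Cylinder N) (n + 1) :=
  ordHomotopy (fun _ => ordMap (cylinderIncl 0 N))
    (fun n => ordMap (cylinderIncl 1 N) ∘ₗ stdSubdiv m N n)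
    (fun _ w => cylinderIncl 0 N (w 0)) n

lemma ordMap_cylinderFace_cylinderChain (m : ℕ) {N : ℕ} (i : Fin (N + 1))
    (x : OrdChain k (stdSimplex ℝ (Fin N)) n) :
    ordMap (cylinderFace i) (cylinderChain m N n x) =
      cylinderChain m (N + 1) n (ordMap (faceMap i) x) := by
  refine ordHomotopy_map (fun n x => ?_) (fun n x => ?_) (fun n w => rfl) x
  · rw [ordMap_ordMap, ordMap_ordMap]
    rfl
  · rw [LinearMap.comp_apply, LinearMap.comp_apply, ← ordMap_faceMap_stdSubdiv, ordMap_ordMap,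
      ordMap_ordMap]
    rfl

lemma ordBoundary_cylinderChain (m N : ℕ) (x : OrdChain k (stdSimplex ℝ (Fin N)) (n + 1)) :
    ordBoundary (cylinderChain m N (n + 1) x) + cylinderChain m N n (ordBoundary x) =
      ordMap (cylinderIncl 1 N) (stdSubdiv m N (n + 1) x) - ordMap (cylinderIncl 0 N) x := by
  refine ordBoundary_homotopy (fun n x => ordMap_boundary _ _) (fun n x => ?_) ?_ _ x
  · rw [LinearMap.comp_apply, ordMap_boundary, LinearMap.comp_apply, stdSubdiv,
      isOrdChainMap_subdivIter]
    rfl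
  · simp only [stdSubdiv, ordSubdivIter_deg_zero, LinearMap.comp_id]
    refine LinearMap.ext fun x => finsupp_hom_ext (fun w => ?_) x
    rw [ordMap_single, ordMap_single]
    congr 1
    exact Subsingleton.elim _ _

namespace SimplexHomotopy

variable (H : SimplexHomotopy Z Z')

/-- The chain map given by the maps at height `s` of a family of homotopies. -/
noncomputable def level (s : Set.Icc (0 : ℝ) 1) (n : ℕ) :
    SingChain k Z n →ₗ[k] SingChain k Z' n :=
  Finsupp.lmapDomain k k fun τ => (H.toMap n τ).comp (cylinderIncl s n)

/-- The prism operator of a family of homotopies, with `m`-fold subdivision at the end. -/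
noncomputable def prism (m n : ℕ) : SingChain k Z n →ₗ[k] SingChain k Z' (n + 1) :=
  Finsupp.linearCombination k fun τ : C(stdSimplex ℝ (Fin n), Z) =>
    singMap (H.toMap n τ) (affChain (convex_cylinder n)
      (cylinderChain m n n (Finsupp.single (stdVertices n) 1)))

lemma level_single (s : Set.Icc (0 : ℝ) 1) (τ : C(stdSimplex ℝ (Fin n), Z)) (a : k) :
    H.level s n (Finsupp.single τ a) =
      Finsupp.single ((H.toMap n τ).comp (cylinderIncl s n)) a := by
  simp [level]

lemma prism_single (m : ℕ) (τ : C(stdSimplex ℝ (Fin n), Z)) :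
    H.prism m n (Finsupp.single τ (1 : k)) =
      singMap (H.toMap n τ) (affChain (convex_cylinder n)
        (cylinderChain m n n (Finsupp.single (stdVertices n) 1))) := by
  rw [prism, Finsupp.linearCombination_single, one_smul]

/-- The identity holds for the universal chain in the cylinder and is transported along the
homotopies; `comp_face` identifies the sides of the cylinder with the prism over the boundary.
Homotopy and subdivision are handled by one operator. -/
lemma singBoundary_prism (m : ℕ) (x : SingChain k Z (n + 1)) :
    singBoundary (H.prism m (n + 1) x) + H.prism m n (singBoundary x) =
      singSubdiv m (n + 1) (H.level 1 (n + 1) x) - H.level 0 (n + 1) x := by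
  refine finsupp_hom_ext (f := singBoundary ∘ₗ H.prism m (n + 1) + H.prism m n ∘ₗ singBoundary)
    (g := singSubdiv m (n + 1) ∘ₗ H.level 1 (n + 1) - H.level 0 (n + 1)) (fun τ => ?_) x
  have h1 : H.prism m n (singBoundary (Finsupp.single τ (1 : k))) =
      singMap (H.toMap (n + 1) τ) (affChain (convex_cylinder (n + 1))
        (cylinderChain m (n + 1) n (ordBoundary (Finsupp.single (stdVertices (n + 1)) 1)))) := by
    rw [← sum_ordMap_faceMap, singBoundary_single]
    simp only [map_sum, map_smul, prism_single]
    refine Finset.sum_congr rfl fun i _ => ?_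
    rw [← ordMap_cylinderFace_cylinderChain, ← (isAffineOn_cylinderFace i).singMap_affChain,
      singMap_singMap, H.comp_face]
  rw [LinearMap.add_apply, LinearMap.comp_apply, LinearMap.comp_apply, h1, prism_single,
    singBoundary_singMap, singBoundary_affChain, ← map_add, ← map_add, ordBoundary_cylinderChain,
    LinearMap.sub_apply, LinearMap.comp_apply, level_single, level_single, singSubdiv_single,
    map_sub, map_sub, ← (isAffineOn_cylinderIncl _ _).singMap_affChain, singMap_singMap,
    ← (isAffineOn_cylinderIncl _ _).singMap_affChain, singMap_singMap, affChain_single,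
    affSimplex_stdVertices, singMap_single, ContinuousMap.comp_id]

end SimplexHomotopy

/-- The singular chains in a subset. -/
abbrev singOn (k : Type u) [Field k] {Z : Type*} [TopologicalSpace Z] (A : Set Z) (n : ℕ) :
    Submodule k (SingChain k Z n) := Finsupp.supported k k {τ | ∀ t, τ t ∈ A}

lemma singMap_mem {f : C(Z, Z')} {A : Set Z'} (h : ∀ z, f z ∈ A) (x : SingChain k Z n) :
    singMap f x ∈ singOn k A n :=
  map_mem_of_supported (s := Set.univ) (fun τ _ => by
    rw [singMap_single]; exact Finsupp.single_mem_supported k 1 fun t => h _)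
    (Finsupp.mem_supported _ _ |>.2 (Set.subset_univ _))

lemma singMap_mem_of_mapsTo {f : C(Z, Z')} {A : Set Z} {B : Set Z'} (h : Set.MapsTo f A B)
    {x : SingChain k Z n} (hx : x ∈ singOn k A n) : singMap f x ∈ singOn k B n :=
  map_mem_of_supported (fun τ hτ => by
    rw [singMap_single]; exact Finsupp.single_mem_supported k 1 fun t => h (hτ t)) hx

lemma singSubdiv_mem {A : Set Z} (m : ℕ) {x : SingChain k Z n} (hx : x ∈ singOn k A n) :
    singSubdiv m n x ∈ singOn k A n :=
  map_mem_of_supported (fun τ hτ => by rw [singSubdiv_single]; exact singMap_mem hτ _) hx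

lemma SimplexHomotopy.prism_mem (H : SimplexHomotopy Z Z') (m : ℕ) {A : Set Z} {B : Set Z'}
    (h : ∀ τ : C(stdSimplex ℝ (Fin n), Z), (∀ t, τ t ∈ A) → ∀ t, H.toMap n τ t ∈ B)
    {x : SingChain k Z n} (hx : x ∈ singOn k A n) : H.prism m n x ∈ singOn k B (n + 1) :=
  map_mem_of_supported (fun τ hτ => by rw [prism_single]; exact singMap_mem (h τ hτ) _) hx

end SingularChains

/-! ### Barycentric subdivision makes simplices small -/

section Mesh

open Filter Topology

variable {k : Type u} [Field k] {F : Type*} [NormedAddCommGroup F] [NormedSpace ℝ F] {K : Set F}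

lemma dist_affSimplex_le (hK : Convex ℝ K) {n : ℕ} {w : Fin n → K} {y : K} {ρ : ℝ}
    (h : ∀ i, dist (w i) y ≤ ρ) (t : stdSimplex ℝ (Fin n)) :
    dist (affSimplex hK w t) y ≤ ρ := by
  have := (convex_closedBall (y : F) ρ).sum_mem (t := Finset.univ) (w := t.1)
    (z := fun i => (w i : F)) (fun i _ => t.2.1 i) t.2.2 fun i _ => h i
  exact this

/-- The difference is the average of `n + 1` differences from `w i`, one of which is zero. -/
lemma dist_affBarycenter_le (hK : Convex ℝ K) {n : ℕ} {w : Fin (n + 1) → K} {D : ℝ}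
    (h : ∀ i j, dist (w i) (w j) ≤ D) (i : Fin (n + 1)) :
    dist (w i) (affBarycenter hK n w) ≤ n / (n + 1) * D := by
  have hn : (0 : ℝ) < n + 1 := by positivity
  have hb : (affBarycenter hK n w : F) = ∑ j, ((n : ℝ) + 1)⁻¹ • (w j : F) := by
    have : ∀ j : Fin (n + 1), (stdSimplex.barycenter (𝕜 := ℝ) (X := Fin (n + 1))).1 j =
        ((n : ℝ) + 1)⁻¹ := fun j => by simp [stdSimplex.barycenter]
    rw [affBarycenter, affSimplex_coe]
    simp only [this]
  have hw : (w i : F) = ∑ j : Fin (n + 1), ((n : ℝ) + 1)⁻¹ • (w i : F) := by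
    rw [Finset.sum_const, Finset.card_univ, Fintype.card_fin, ← Nat.cast_smul_eq_nsmul ℝ, smul_smul]
    push_cast
    rw [mul_inv_cancel₀ hn.ne', one_smul]
  rw [Subtype.dist_eq, dist_eq_norm, hb, hw, ← Finset.sum_sub_distrib,
    ← Finset.add_sum_erase _ _ (Finset.mem_univ i), sub_self, zero_add]
  refine (norm_sum_le _ _).trans ?_
  have hle : ∀ j ∈ Finset.univ.erase i,
      ‖((n : ℝ) + 1)⁻¹ • (w i : F) - ((n : ℝ) + 1)⁻¹ • (w j : F)‖ ≤ ((n : ℝ) + 1)⁻¹ * D := by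
    intro j _
    rw [← smul_sub, norm_smul, Real.norm_of_nonneg (by positivity), ← dist_eq_norm,
      ← Subtype.dist_eq]
    exact mul_le_mul_of_nonneg_left (h i j) (by positivity)
  refine (Finset.sum_le_sum hle).trans_eq ?_
  rw [Finset.sum_const, Finset.card_erase_of_mem (Finset.mem_univ i), Finset.card_univ,
    Fintype.card_fin, nsmul_eq_mul, Nat.add_sub_cancel, div_eq_mul_inv, mul_assoc]

/-- A simplex of the subdivision is the barycentre joined to a simplex from a subdivided face. The
latter has small spread by induction, and stays in a ball around the barycentre because balls are
closed under barycentres. The bound `M` keeps one contraction factor for all degrees. -/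
lemma ordSubdiv_spread (hK : Convex ℝ K) {n M : ℕ} (hn : n ≤ M + 1) {w : Fin n → K} {D : ℝ}
    (hD : 0 ≤ D) (h : ∀ i j, dist (w i) (w j) ≤ D) :
    ordSubdiv (affBarycenter hK) n (Finsupp.single w 1) ∈
      ordOn k fun w => ∀ i j, dist (w i) (w j) ≤ M / (M + 1) * D := by
  induction n with
  | zero => exact Finsupp.single_mem_supported k _ fun i => i.elim0
  | succ n ih =>
    have hr : (n : ℝ) / (n + 1) * D ≤ M / (M + 1) * D := by
      refine mul_le_mul_of_nonneg_right ?_ hD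
      have : (n : ℝ) ≤ M := by exact_mod_cast Nat.le_of_succ_le_succ hn
      rw [div_le_div_iff₀ (by positivity) (by positivity)]
      linarith
    have hb : ∀ i, w i ∈ Metric.closedBall (affBarycenter hK n w) (M / (M + 1) * D) := fun i =>
      (dist_affBarycenter_le hK h i).trans hr
    rw [ordSubdiv_succ_single]
    refine ordCone_mem (A := fun w' => (∀ i j, dist (w' i) (w' j) ≤ M / (M + 1) * D) ∧
      ∀ i, w' i ∈ Metric.closedBall (affBarycenter hK n w) (M / (M + 1) * D)) ?_ ?_
    · rintro w' ⟨h1, h2⟩ i j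
      have h0 : (0 : ℝ) ≤ M / (M + 1) * D := by positivity
      refine Fin.cases ?_ (fun i => ?_) i <;> refine Fin.cases ?_ (fun j => ?_) j
      · simpa using h0
      · simpa [dist_comm] using h2 j
      · simpa using h2 i
      · simpa using h1 i j
    · refine map_mem_of_supported (s := {w' | (∀ i j, dist (w' i) (w' j) ≤ D) ∧
        ∀ i, w' i ∈ Metric.closedBall (affBarycenter hK n w) (M / (M + 1) * D)}) ?_
        (ordBoundary_single_mem (fun i => ⟨fun _ _ => h _ _, fun _ => hb _⟩) 1)
      rintro w' ⟨h1, h2⟩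
      have h3 := ih (by omega) h1
      have h4 := ordSubdiv_mem (k := k) (b := affBarycenter hK)
        (s := Metric.closedBall (affBarycenter hK n w) (M / (M + 1) * D))
        (fun n w hw => dist_affSimplex_le hK hw _) h2
      have h5 := Submodule.mem_inf.2 ⟨h3, h4⟩
      rwa [ordOn, ordOn, ← Finsupp.supported_inter] at h5

lemma ordSubdivIter_spread (hK : Convex ℝ K) {n M : ℕ} (hn : n ≤ M + 1) {w : Fin n → K} {D : ℝ}
    (hD : 0 ≤ D) (h : ∀ i j, dist (w i) (w j) ≤ D) (m : ℕ) :
    ordSubdivIter (affBarycenter hK) m n (Finsupp.single w 1) ∈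
      ordOn k fun w => ∀ i j, dist (w i) (w j) ≤ (M / (M + 1)) ^ m * D := by
  induction m with
  | zero =>
    rw [ordSubdivIter_zero]
    exact Finsupp.single_mem_supported k _ fun i j => by simpa using h i j
  | succ m ih =>
    rw [ordSubdivIter_succ]
    refine map_mem_of_supported (fun w' hw' => ?_) ih
    have := ordSubdiv_spread (k := k) hK hn (by positivity) hw'
    rwa [← mul_assoc, ← pow_succ'] at this

/-- Iterated barycentric subdivision makes the simplices of a singular chain arbitrarily small. -/
lemma eventually_singSubdiv_small {Z M : Type*} [TopologicalSpace Z] [PseudoMetricSpace M]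
    (g : C(Z, M)) {n : ℕ} (c : SingChain k Z n) {ε : ℝ} (hε : 0 < ε) :
    ∀ᶠ m in atTop, singSubdiv m n c ∈
      Finsupp.supported k k {τ : C(stdSimplex ℝ (Fin n), Z) |
        ∀ t t', dist (g (τ t)) (g (τ t')) < ε} := by
  induction c using Finsupp.induction_linear with
  | zero => simp
  | add x y hx hy =>
    filter_upwards [hx, hy] with m h1 h2
    rw [map_add]
    exact Submodule.add_mem _ h1 h2
  | single τ a =>
    -- By uniform continuity it suffices to subdivide the standard simplex to mesh δ.
    have hu : UniformContinuous fun t => g (τ t) :=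
      CompactSpace.uniformContinuous_of_continuous (g.continuous.comp τ.continuous)
    obtain ⟨δ, hδ, hδτ⟩ := Metric.uniformContinuous_iff.1 hu ε hε
    have hr : Tendsto (fun m : ℕ => ((n : ℝ) / (n + 1)) ^ m) atTop (𝓝 0) :=
      tendsto_pow_atTop_nhds_zero_of_lt_one (by positivity)
        ((div_lt_one (by positivity)).2 (lt_add_one _))
    filter_upwards [hr.eventually (gt_mem_nhds hδ)] with m hm
    have ha : Finsupp.single τ a = a • Finsupp.single τ 1 := by simp
    rw [ha, map_smul, singSubdiv_single]
    refine Submodule.smul_mem _ _ (map_mem_of_supported (s := {ρ | ∀ t t', dist (ρ t) (ρ t') < δ})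
      (fun ρ hρ => ?_) ?_)
    · rw [singMap_single]
      exact Finsupp.single_mem_supported k 1 fun t t' => hδτ (hρ t t')
    · refine map_mem_of_supported (fun w hw => ?_) (ordSubdivIter_spread
        (convex_stdSimplex ℝ (Fin n)) n.le_succ zero_le_one (fun i j => ?_) m)
      · rw [affChain_single]
        refine Finsupp.single_mem_supported k 1 fun t t' => ?_
        refine lt_of_le_of_lt ?_ hm
        refine dist_affSimplex_le _ (fun i => ?_) t
        rw [dist_comm]
        refine dist_affSimplex_le _ (fun j => ?_) t'
        simpa using hw j i
      · exact (Metric.dist_le_diam_of_mem (bounded_stdSimplex _) (stdVertices n i).2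
          (stdVertices n j).2).trans diam_stdSimplex_le

end Mesh

/-! ### Comparison of oriented and ordered simplicial chains -/

section OrientedAndOrdered

variable {k : Type u} [Field k] {V : Type v} [LinearOrder V] {n : ℕ}

/-- The oriented simplex of a tuple of vertices (zero if a vertex is repeated). -/
noncomputable def orientTuple (k : Type u) [Field k] : ∀ n, (Fin n → V) → (Finset V →₀ k)
  | 0, _ => Finsupp.single ∅ 1
  | n + 1, w => coneOver k (w 0) (orientTuple k n (Fin.tail w))

/-- The map from ordered to oriented chains. -/
noncomputable def orient (n : ℕ) : OrdChain k V n →ₗ[k] (Finset V →₀ k) :=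
  Finsupp.linearCombination k (orientTuple k n)

lemma orient_single (w : Fin n → V) :
    orient n (Finsupp.single w (1 : k)) = orientTuple k n w := by
  rw [orient, Finsupp.linearCombination_single, one_smul]

lemma orient_cone (v : V) (x : OrdChain k V n) :
    orient (n + 1) (ordCone v x) = coneOver k v (orient n x) := by
  refine finsupp_hom_ext (f := orient (n + 1) ∘ₗ ordCone v) (g := coneOver k v ∘ₗ orient n)
    (fun w => ?_) x
  rw [LinearMap.comp_apply, LinearMap.comp_apply, ordCone_single, orient_single, orient_single,
    orientTuple, Fin.cons_zero, Fin.tail_cons]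

lemma boundary_orient_zero (x : OrdChain k V 0) : boundary k (orient 0 x) = 0 := by
  refine finsupp_hom_ext (f := boundary k ∘ₗ orient 0) (g := 0) (fun w => ?_) x
  rw [LinearMap.comp_apply, orient_single, orientTuple, boundary_single, Finset.sum_empty,
    LinearMap.zero_apply]

/-- Both kinds of chains obey the same cone formula. Tuples with repetitions need no extra case,
since `coneOver` vanishes on simplices containing the apex. -/
lemma boundary_orient (x : OrdChain k V (n + 1)) :
    boundary k (orient (n + 1) x) = orient n (ordBoundary x) := by
  induction n with
  | zero =>
    refine finsupp_hom_ext (f := boundary k ∘ₗ orient 1) (g := orient 0 ∘ₗ ordBoundary)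
      (fun w => ?_) x
    rw [LinearMap.comp_apply, LinearMap.comp_apply, exists_eq_cons_single, orient_cone,
      boundary_coneOver, boundary_orient_zero, map_zero, sub_zero, ordBoundary_cone_zero]
  | succ n ih =>
    refine finsupp_hom_ext (f := boundary k ∘ₗ orient (n + 2)) (g := orient (n + 1) ∘ₗ ordBoundary)
      (fun w => ?_) x
    rw [LinearMap.comp_apply, LinearMap.comp_apply, exists_eq_cons_single, orient_cone,
      boundary_coneOver, ih, ordBoundary_cone, map_sub, orient_cone]

lemma of_orientTuple_ne_zero {w : Fin n → V} {s : Finset V} (h : orientTuple k n w s ≠ 0) :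
    (∀ v ∈ s, ∃ i, w i = v) ∧ s.card = n := by
  induction n generalizing s with
  | zero =>
    rw [orientTuple, Finsupp.single_apply] at h
    split_ifs at h with hs
    · subst hs
      simp
    · simp at h
  | succ n ih =>
    rw [orientTuple, coneOver_apply] at h
    split_ifs at h with hs
    · obtain ⟨h1, h2⟩ := ih (right_ne_zero_of_mul h)
      constructor
      · intro v hv
        rcases eq_or_ne v (w 0) with rfl | hv0
        · exact ⟨0, rfl⟩
        · obtain ⟨i, hi⟩ := h1 v (Finset.mem_erase.2 ⟨hv0, hv⟩)
          exact ⟨i.succ, hi⟩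
      · rw [Finset.card_erase_of_mem hs] at h2
        have := Finset.card_pos.2 ⟨_, hs⟩
        omega
    · simp at h

/-- The tuples of vertices that span a face. -/
abbrev SpansFace (Γ : SimplicialCpx V) {n : ℕ} (w : Fin n → V) : Prop :=
  Finset.univ.image w ∈ Γ.faces

lemma SpansFace.of_forall_mem {Γ : SimplicialCpx V} {w : Fin n → V} {s : Finset V}
    (hs : s ∈ Γ.faces) (h : ∀ i, w i ∈ s) : SpansFace Γ w :=
  Γ.down_closed hs (Finset.image_subset_iff.2 fun i _ => h i)

lemma orient_mem_chains {Γ : SimplicialCpx V} {x : OrdChain k V n}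
    (hx : x ∈ ordOn k (SpansFace Γ (n := n))) : orient n x ∈ chains k Γ n := by
  refine map_mem_of_supported (fun w hw => ?_) hx
  rw [orient_single, mem_chains]
  intro s hs
  obtain ⟨h1, h2⟩ := of_orientTuple_ne_zero hs
  refine ⟨Γ.down_closed hw fun v hv => ?_, h2⟩
  obtain ⟨i, rfl⟩ := h1 v hv
  exact Finset.mem_image_of_mem w (Finset.mem_univ i)

/-- The map from oriented to ordered chains that lists the vertices of a face in order. -/
noncomputable def sortChain (n : ℕ) : (Finset V →₀ k) →ₗ[k] OrdChain k V n :=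
  Finsupp.linearCombination k fun s : Finset V =>
    if h : s.card = n then Finsupp.single (s.orderEmbOfFin h) 1 else 0

lemma sortChain_single {s : Finset V} (h : s.card = n) (a : k) :
    sortChain n (Finsupp.single s a) = Finsupp.single (⇑(s.orderEmbOfFin h)) a := by
  rw [sortChain, Finsupp.linearCombination_single, dif_pos h, Finsupp.smul_single, smul_eq_mul,
    mul_one]

lemma sortChain_single_of_ne {s : Finset V} (h : s.card ≠ n) (a : k) :
    sortChain n (Finsupp.single s a) = 0 := by
  rw [sortChain, Finsupp.linearCombination_single, dif_neg h, smul_zero]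

lemma faceSign_orderEmbOfFin {s : Finset V} (h : s.card = n) (i : Fin n) :
    faceSign k (s.orderEmbOfFin h i) s = (-1) ^ (i : ℕ) := by
  have hs : s.filter (· < s.orderEmbOfFin h i) =
      (Finset.Iio i).map (s.orderEmbOfFin h).toEmbedding := by
    ext v
    simp only [Finset.mem_filter, Finset.mem_map, Finset.mem_Iio, RelEmbedding.coe_toEmbedding]
    constructor
    · rintro ⟨hv, hlt⟩
      obtain ⟨j, rfl⟩ : v ∈ Set.range (s.orderEmbOfFin h) := by
        rwa [Finset.range_orderEmbOfFin]
      exact ⟨j, (s.orderEmbOfFin h).lt_iff_lt.1 hlt, rfl⟩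
    · rintro ⟨j, hj, rfl⟩
      exact ⟨Finset.orderEmbOfFin_mem s h j, (s.orderEmbOfFin h).lt_iff_lt.2 hj⟩
  rw [faceSign, hs, Finset.card_map, Fin.card_Iio]

/-- In sorted order the sign of the `i`-th vertex counts its `i` predecessors
(`faceSign_orderEmbOfFin`). -/
lemma ordBoundary_sortChain (x : Finset V →₀ k) :
    ordBoundary (sortChain (n + 1) x) = sortChain n (boundary k x) := by
  refine finsupp_hom_ext (f := ordBoundary ∘ₗ sortChain (n + 1))
    (g := sortChain n ∘ₗ boundary k) (fun s => ?_) x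
  rw [LinearMap.comp_apply, LinearMap.comp_apply, boundary_single, map_sum]
  by_cases h : s.card = n + 1
  · have hs : Finset.univ.map (s.orderEmbOfFin h).toEmbedding = s := by
      rw [← Finset.coe_inj, Finset.coe_map, Finset.coe_univ, Set.image_univ]
      exact Finset.range_orderEmbOfFin s h
    rw [sortChain_single h, ordBoundary_single]
    conv_rhs => rw [← Finset.sum_congr hs fun _ _ => rfl, Finset.sum_map]
    refine Finset.sum_congr rfl fun i _ => ?_
    have hmem := Finset.orderEmbOfFin_mem s h i
    have hc : (s.erase (s.orderEmbOfFin h i)).card = n := by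
      rw [Finset.card_erase_of_mem hmem, h, Nat.add_sub_cancel]
    rw [RelEmbedding.coe_toEmbedding, contract_single, if_pos hmem, one_mul,
      faceSign_orderEmbOfFin, sortChain_single hc, Finsupp.smul_single, smul_eq_mul, mul_one]
    congr 1
    refine Finset.orderEmbOfFin_unique hc (fun j => Finset.mem_erase.2 ⟨?_, ?_⟩) ?_
    · exact fun hj => Fin.succAbove_ne i j ((s.orderEmbOfFin h).injective hj)
    · exact Finset.orderEmbOfFin_mem s h _
    · exact (s.orderEmbOfFin h).strictMono.comp (Fin.strictMono_succAbove i)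
  · rw [sortChain_single_of_ne h, map_zero]
    refine (Finset.sum_eq_zero fun v hv => ?_).symm
    rw [contract_single, if_pos hv, sortChain_single_of_ne]
    rw [Finset.card_erase_of_mem hv]
    have := Finset.card_pos.2 ⟨v, hv⟩
    omega

lemma sortChain_mem {Γ : SimplicialCpx V} {x : Finset V →₀ k} (hx : x ∈ chains k Γ n) :
    sortChain n x ∈ ordOn k (SpansFace Γ (n := n)) := by
  refine map_mem_of_supported (fun s hs => ?_) hx
  rw [sortChain_single hs.2]
  exact Finsupp.single_mem_supported k 1
    (SpansFace.of_forall_mem hs.1 (Finset.orderEmbOfFin_mem s hs.2))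

/-- The homotopy between the identity and the sorting of ordered chains. -/
noncomputable def sortHomotopy (n : ℕ) : OrdChain k V n →ₗ[k] OrdChain k V (n + 1) :=
  ordHomotopy (fun _ => LinearMap.id) (fun n => sortChain n ∘ₗ orient n) (fun _ w => w 0) n

lemma ordBoundary_sortHomotopy (x : OrdChain k V (n + 1)) :
    ordBoundary (sortHomotopy (n + 1) x) + sortHomotopy n (ordBoundary x) =
      sortChain (n + 1) (orient (n + 1) x) - x := by
  refine ordBoundary_homotopy (fun _ _ => rfl) (fun n x => ?_) ?_ _ x
  · rw [LinearMap.comp_apply, LinearMap.comp_apply, ordBoundary_sortChain, boundary_orient]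
  · refine LinearMap.ext fun x => finsupp_hom_ext (fun w => ?_) x
    rw [LinearMap.comp_apply, orient_single, orientTuple, sortChain_single Finset.card_empty,
      LinearMap.id_apply]
    congr 1
    exact Subsingleton.elim _ _

/-- No step of the construction introduces a new vertex; hence the homotopy preserves every
subcomplex, in particular the faces not containing σ. -/
lemma sortHomotopy_single_mem {w : Fin n → V} {s : Finset V} (hw : ∀ i, w i ∈ s) :
    sortHomotopy n (Finsupp.single w 1) ∈ ordOn k fun w' : Fin (n + 1) → V => ∀ i, w' i ∈ s := by
  induction n with
  | zero => exact Submodule.zero_mem _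
  | succ n ih =>
    rw [sortHomotopy, ordHomotopy_succ_single]
    refine ordCone_mem (A := fun w' => ∀ i, w' i ∈ s) (fun w' hw' i => ?_) ?_
    · refine Fin.cases ?_ (fun j => ?_) i
      · exact hw 0
      · exact hw' j
    · refine Submodule.sub_mem _ (Submodule.sub_mem _ ?_ ?_) ?_
      · rw [LinearMap.comp_apply, orient_single]
        refine map_mem_of_supported (s := {t : Finset V | t ⊆ s ∧ t.card = n + 1})
          (fun t ht => ?_) fun t ht => ?_
        · rw [sortChain_single ht.2]
          exact Finsupp.single_mem_supported k 1 fun i =>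
            ht.1 (Finset.orderEmbOfFin_mem t ht.2 i)
        · obtain ⟨h1, h2⟩ := of_orientTuple_ne_zero (Finsupp.mem_support_iff.1 ht)
          refine ⟨fun v hv => ?_, h2⟩
          obtain ⟨i, rfl⟩ := h1 v hv
          exact hw i
      · exact Finsupp.single_mem_supported k 1 hw
      · exact map_mem_of_supported (fun w' hw' => ih hw')
          (ordBoundary_single_mem (fun i j => hw _) 1)

lemma sortHomotopy_mem {Γ : SimplicialCpx V} {x : OrdChain k V n}
    (hx : x ∈ ordOn k (SpansFace Γ (n := n))) :
    sortHomotopy n x ∈ ordOn k (SpansFace Γ (n := n + 1)) := by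
  refine map_mem_of_supported (fun w hw => ?_) hx
  have h := sortHomotopy_single_mem (k := k) (w := w)
    fun i => Finset.mem_image_of_mem w (Finset.mem_univ i)
  refine Finsupp.supported_mono (fun w' hw' => ?_) h
  exact SpansFace.of_forall_mem hw hw'

end OrientedAndOrdered

/-! ### Geometric simplices and simplicial approximation of singular chains -/

section GeometricSimplices

variable {k : Type u} [Field k] {V : Type v} [LinearOrder V] {n : ℕ}

/-- The closed geometric simplex with vertex set `σ`. -/
def closedSimplex (σ : Finset V) : Set (V → ℝ) :=
  {x | (∀ v, 0 ≤ x v) ∧ (∀ v, v ∉ σ → x v = 0) ∧ ∑ v ∈ σ, x v = 1}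

lemma mem_realization {Γ : SimplicialCpx V} {x : V → ℝ} :
    x ∈ Γ.realization ↔ ∃ σ ∈ Γ.faces, x ∈ closedSimplex σ := by
  constructor
  · rintro ⟨h1, σ, hσ, h2⟩
    exact ⟨σ, hσ, h1, h2⟩
  · rintro ⟨σ, hσ, h1, h2⟩
    exact ⟨h1, σ, hσ, h2⟩

lemma convex_closedSimplex (σ : Finset V) : Convex ℝ (closedSimplex σ) := by
  rintro x ⟨hx1, hx2, hx3⟩ y ⟨hy1, hy2, hy3⟩ a b ha hb hab
  refine ⟨fun v => ?_, fun v hv => ?_, ?_⟩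
  · simp only [Pi.add_apply, Pi.smul_apply, smul_eq_mul]
    have := mul_nonneg ha (hx1 v)
    have := mul_nonneg hb (hy1 v)
    linarith
  · simp [hx2 v hv, hy2 v hv]
  · simp only [Pi.add_apply, Pi.smul_apply, smul_eq_mul, Finset.sum_add_distrib,
      ← Finset.mul_sum, hx3, hy3]
    linarith

lemma single_mem_closedSimplex {σ : Finset V} {v : V} (hv : v ∈ σ) :
    (Pi.single v 1 : V → ℝ) ∈ closedSimplex σ := by
  refine ⟨fun w => ?_, fun w hw => ?_, ?_⟩
  · rcases eq_or_ne w v with rfl | h <;> simp [*]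
  · rw [Pi.single_eq_of_ne]
    rintro rfl
    exact hw hv
  · simp [hv]

lemma closedSimplex_mono {σ τ : Finset V} (h : σ ⊆ τ) : closedSimplex σ ⊆ closedSimplex τ := by
  rintro x ⟨h1, h2, h3⟩
  refine ⟨h1, fun v hv => h2 v fun hv' => hv (h hv'), ?_⟩
  rw [← h3]
  exact (Finset.sum_subset h fun v _ hv => h2 v hv).symm

/-- The affine simplex with the given vertices. -/
noncomputable def linSimplex (w : Fin n → V) : C(stdSimplex ℝ (Fin n), V → ℝ) where
  toFun t := ∑ i, t.1 i • (Pi.single (w i) 1 : V → ℝ)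
  continuous_toFun := continuous_finsetSum _ fun i _ =>
    ((continuous_apply i).comp continuous_subtype_val).smul continuous_const

lemma linSimplex_mem {w : Fin n → V} {σ : Finset V} (h : ∀ i, w i ∈ σ)
    (t : stdSimplex ℝ (Fin n)) : linSimplex w t ∈ closedSimplex σ :=
  (convex_closedSimplex σ).sum_mem (fun i _ => t.2.1 i) t.2.2 fun i _ =>
    single_mem_closedSimplex (h i)

lemma linSimplex_comp_faceMap (w : Fin (n + 1) → V) (i : Fin (n + 1)) :
    (linSimplex w).comp (faceMap i) = linSimplex fun j => w (i.succAbove j) := by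
  ext1 t
  exact sum_stdSimplex_map i.succAbove t fun j => (Pi.single (w j) 1 : V → ℝ)

/-- Ordered chains of vertices as singular chains. -/
noncomputable def geomChain (n : ℕ) : OrdChain k V n →ₗ[k] SingChain k (V → ℝ) n :=
  Finsupp.lmapDomain k k linSimplex

lemma geomChain_single (w : Fin n → V) (a : k) :
    geomChain n (Finsupp.single w a) = Finsupp.single (linSimplex w) a := by
  simp [geomChain]

lemma singBoundary_geomChain (x : OrdChain k V (n + 1)) :
    singBoundary (geomChain (n + 1) x) = geomChain n (ordBoundary x) := by
  refine finsupp_hom_ext (f := singBoundary ∘ₗ geomChain (n + 1))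
    (g := geomChain n ∘ₗ ordBoundary) (fun w => ?_) x
  simp only [LinearMap.comp_apply, geomChain_single, singBoundary_single, ordBoundary_single,
    map_sum, map_smul, linSimplex_comp_faceMap]

lemma geomChain_mem {Γ : SimplicialCpx V} {x : OrdChain k V n}
    (hx : x ∈ ordOn k (SpansFace Γ (n := n))) : geomChain n x ∈ singOn k Γ.realization n := by
  refine map_mem_of_supported (fun w hw => ?_) hx
  rw [geomChain_single]
  exact Finsupp.single_mem_supported k 1 fun t => mem_realization.2 ⟨_, hw,
    linSimplex_mem (fun i => Finset.mem_image_of_mem w (Finset.mem_univ i)) t⟩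

/-- The ordered chain of the images of the vertices of singular simplices under `f`. -/
noncomputable def approxChain (f : (V → ℝ) → V) (n : ℕ) :
    SingChain k (V → ℝ) n →ₗ[k] OrdChain k V n :=
  Finsupp.lmapDomain k k fun τ i => f (τ (stdVertices n i))

lemma approxChain_single (f : (V → ℝ) → V) (τ : C(stdSimplex ℝ (Fin n), V → ℝ)) (a : k) :
    approxChain f n (Finsupp.single τ a) =
      Finsupp.single (fun i => f (τ (stdVertices n i))) a := by
  simp [approxChain]

lemma comp_faceMap_stdVertices {Z : Type*} [TopologicalSpace Z]
    (τ : C(stdSimplex ℝ (Fin (n + 1)), Z)) (i : Fin (n + 1)) (j : Fin n) :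
    τ.comp (faceMap i) (stdVertices n j) = τ (stdVertices (n + 1) (i.succAbove j)) :=
  congrArg τ (congrFun (faceMap_comp_stdVertices i) j)

/-- Only the values at the vertices of a singular simplex enter, so `f` may be arbitrary; no
continuity is needed. -/
lemma ordBoundary_approxChain (f : (V → ℝ) → V) (x : SingChain k (V → ℝ) (n + 1)) :
    ordBoundary (approxChain f (n + 1) x) = approxChain f n (singBoundary x) := by
  refine finsupp_hom_ext (f := ordBoundary ∘ₗ approxChain f (n + 1))
    (g := approxChain f n ∘ₗ singBoundary) (fun τ => ?_) x
  simp only [LinearMap.comp_apply, approxChain_single, singBoundary_single, ordBoundary_single,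
    map_sum, map_smul, comp_faceMap_stdVertices]

/-- The straight-line homotopy from singular simplices to their approximations. -/
noncomputable def approxHomotopy (f : (V → ℝ) → V) : SimplexHomotopy (V → ℝ) (V → ℝ) where
  toMap n τ :=
    { toFun := fun x => (1 - x.1.2) • τ ⟨x.1.1, x.2.1⟩ +
        x.1.2 • linSimplex (fun i => f (τ (stdVertices n i))) ⟨x.1.1, x.2.1⟩
      continuous_toFun := by fun_prop }
  comp_face n τ i := by
    ext1 x
    have h := DFunLike.congr_fun (linSimplex_comp_faceMap
      (fun i => f (τ (stdVertices (n + 1) i))) i) ⟨x.1.1, x.2.1⟩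
    change (1 - x.1.2) • τ (faceMap i ⟨x.1.1, x.2.1⟩) + x.1.2 • linSimplex
        (fun j => f (τ.comp (faceMap i) (stdVertices n j))) ⟨x.1.1, x.2.1⟩ =
      (1 - x.1.2) • τ (faceMap i ⟨x.1.1, x.2.1⟩) + x.1.2 • linSimplex
        (fun j => f (τ (stdVertices (n + 1) j))) (faceMap i ⟨x.1.1, x.2.1⟩)
    simp only [comp_faceMap_stdVertices]
    rw [← h]
    rfl

lemma approxHomotopy_level_zero (f : (V → ℝ) → V) (x : SingChain k (V → ℝ) n) :
    (approxHomotopy f).level 0 n x = x := by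
  refine finsupp_hom_ext (f := (approxHomotopy f).level 0 n) (g := LinearMap.id) (fun τ => ?_) x
  rw [SimplexHomotopy.level_single, LinearMap.id_apply]
  congr 1
  ext1 t
  change (1 - (0 : ℝ)) • τ t + (0 : ℝ) • _ = τ t
  rw [sub_zero, one_smul, zero_smul, add_zero]

lemma approxHomotopy_level_one (f : (V → ℝ) → V) (x : SingChain k (V → ℝ) n) :
    (approxHomotopy f).level 1 n x = geomChain n (approxChain f n x) := by
  refine finsupp_hom_ext (f := (approxHomotopy f).level 1 n)
    (g := geomChain n ∘ₗ approxChain f n) (fun τ => ?_) x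
  rw [SimplexHomotopy.level_single, LinearMap.comp_apply, approxChain_single, geomChain_single]
  congr 1
  ext1 t
  change (1 - (1 : ℝ)) • τ t + (1 : ℝ) • linSimplex _ t = _
  rw [sub_self, one_smul, zero_smul, zero_add]

lemma singSubdiv_zero {Z : Type*} [TopologicalSpace Z] (x : SingChain k Z n) :
    singSubdiv 0 n x = x := by
  refine finsupp_hom_ext (f := singSubdiv 0 n) (g := LinearMap.id) (fun τ => ?_) x
  rw [singSubdiv_single, stdSubdiv, ordSubdivIter_zero, affChain_single, affSimplex_stdVertices,
    singMap_single, ContinuousMap.comp_id, LinearMap.id_apply]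

end GeometricSimplices

/-! ### Pushing chains away from a point of the realization -/

section PushingOff

open Filter Topology

variable {k : Type u} [Field k] {V : Type v} [LinearOrder V] {n : ℕ}

/-- The homotopies of simplices given by a homotopy of maps. -/
noncomputable def SimplexHomotopy.ofMap {Z Z' : Type*} [TopologicalSpace Z] [TopologicalSpace Z']
    (h : C(Set.Icc (0 : ℝ) 1 × Z, Z')) : SimplexHomotopy Z Z' where
  toMap n τ :=
    { toFun := fun x => h (⟨x.1.2, x.2.2⟩, τ ⟨x.1.1, x.2.1⟩)
      continuous_toFun := by fun_prop }
  comp_face _ _ _ := rfl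

/-- The subcomplex of all faces that do not contain the nonempty set `σ`. -/
def costar (Γ : SimplicialCpx V) (σ : Finset V) (hσ : σ.Nonempty) : SimplicialCpx V where
  faces := Γ.faces.filter fun τ => ¬ σ ⊆ τ
  empty_mem := by
    simp only [Finset.mem_filter, Γ.empty_mem, true_and, Finset.subset_empty]
    exact hσ.ne_empty
  down_closed := by
    intro s t hs hts
    rw [Finset.mem_filter] at hs ⊢
    exact ⟨Γ.down_closed hs.1 hts, fun h => hs.2 (h.trans hts)⟩

lemma mem_costar {Γ : SimplicialCpx V} {σ τ : Finset V} {hσ : σ.Nonempty} :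
    τ ∈ (Γ.costar σ hσ).faces ↔ τ ∈ Γ.faces ∧ ¬ σ ⊆ τ := by
  simp [costar]

lemma mem_chains_costar {Γ : SimplicialCpx V} {σ : Finset V} {hσ : σ.Nonempty}
    {x : Finset V →₀ k} : x ∈ chains k (Γ.costar σ hσ) n ↔ x ∈ chains k Γ n ∧ x ∈ avoiding k σ := by
  simp only [mem_chains, mem_costar, mem_avoiding]
  constructor
  · refine fun h => ⟨fun s hs => ⟨(h s hs).1.1, (h s hs).2⟩, fun s hs => ?_⟩
    by_contra hne
    exact (h s hne).1.2 hs
  · exact fun h s hs => ⟨⟨(h.1 s hs).1, fun hσs => hs (h.2 s hσs)⟩, (h.1 s hs).2⟩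

/-- A face together with a point in its relative interior. -/
structure InteriorPoint (σ : Finset V) (p : V → ℝ) : Prop where
  nonempty : σ.Nonempty
  mem : p ∈ closedSimplex σ
  pos : ∀ v ∈ σ, 0 < p v

namespace InteriorPoint

variable {σ : Finset V} {p : V → ℝ} (hp : InteriorPoint σ p)

/-- The least ratio of the coordinates of `x` and `p`. -/
noncomputable def ratio (x : V → ℝ) : ℝ := σ.inf' hp.nonempty fun v => x v / p v

lemma continuous_ratio : Continuous hp.ratio :=
  Continuous.finset_inf'_apply hp.nonempty fun v _ => (continuous_apply v).div_const _

lemma ratio_mul_le (x : V → ℝ) {v : V} (hv : v ∈ σ) : hp.ratio x * p v ≤ x v :=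
  (le_div_iff₀ (hp.pos v hv)).1 (Finset.inf'_le _ hv)

lemma exists_ratio_eq (x : V → ℝ) : ∃ v ∈ σ, hp.ratio x * p v = x v := by
  obtain ⟨v, hv, h⟩ := Finset.exists_mem_eq_inf' hp.nonempty fun v => x v / p v
  refine ⟨v, hv, ?_⟩
  rw [ratio, h, div_mul_cancel₀ _ (hp.pos v hv).ne']

lemma ratio_nonneg {x : V → ℝ} (hx : ∀ v, 0 ≤ x v) : 0 ≤ hp.ratio x :=
  Finset.le_inf' _ _ fun v hv => div_nonneg (hx v) (hp.pos v hv).le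

lemma subset_of_ratio_pos {x : V → ℝ} {τ : Finset V} (hx : x ∈ closedSimplex τ)
    (h : 0 < hp.ratio x) : σ ⊆ τ := by
  intro v hv
  by_contra hvτ
  have := hp.ratio_mul_le x hv
  rw [hx.2.1 v hvτ] at this
  exact absurd (mul_pos h (hp.pos v hv)) (not_lt.2 this)

/-- A ratio of at least 1 means that `x` dominates `p` in every coordinate; both have coordinate sum
1, so they would be equal. -/
lemma ratio_lt_one {x : V → ℝ} {τ : Finset V} (hx : x ∈ closedSimplex τ) (h : x ≠ p) :
    hp.ratio x < 1 := by
  by_contra hr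
  rw [not_lt] at hr
  have hστ := hp.subset_of_ratio_pos hx (by linarith)
  have hpτ := closedSimplex_mono hστ hp.mem
  have hle : ∀ v ∈ τ, p v ≤ x v := by
    intro v _
    by_cases hv : v ∈ σ
    · refine le_trans ?_ (hp.ratio_mul_le x hv)
      nlinarith [hp.pos v hv]
    · rw [hp.mem.2.1 v hv]
      exact hx.1 v
  have heq := (Finset.sum_eq_sum_iff_of_le hle).1 (hpτ.2.2.trans hx.2.2.symm)
  refine h (funext fun v => ?_)
  by_cases hv : v ∈ τ
  · exact (heq v hv).symm
  · rw [hx.2.1 v hv, hpτ.2.1 v hv]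

/-- The ratio, bounded to `[0, 1 - δ]`. -/
noncomputable def cutoff (δ : ℝ) (x : V → ℝ) : ℝ := max 0 (min (1 - δ) (hp.ratio x))

lemma cutoff_le {δ : ℝ} (hδ : δ ≤ 1) (x : V → ℝ) : hp.cutoff δ x ≤ 1 - δ :=
  max_le (by linarith) (min_le_left _ _)

lemma cutoff_nonneg (δ : ℝ) (x : V → ℝ) : 0 ≤ hp.cutoff δ x := le_max_left _ _

lemma one_sub_mul_cutoff_pos {δ : ℝ} (hδ : δ ∈ Set.Ioc (0 : ℝ) 1) (s : Set.Icc (0 : ℝ) 1)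
    (x : V → ℝ) : 0 < 1 - s.1 * hp.cutoff δ x := by
  have h1 := hp.cutoff_le hδ.2 x
  have h2 := hp.cutoff_nonneg δ x
  have h3 : s.1 * hp.cutoff δ x ≤ hp.cutoff δ x := mul_le_of_le_one_left h2 s.2.2
  have := hδ.1
  linarith

/-- The homotopy that pushes points away from `p`, along the lines through `p`. -/
noncomputable def pushMap {δ : ℝ} (hδ : δ ∈ Set.Ioc (0 : ℝ) 1) :
    C(Set.Icc (0 : ℝ) 1 × (V → ℝ), V → ℝ) where
  toFun x := (1 - x.1.1 * hp.cutoff δ x.2)⁻¹ • (x.2 - (x.1.1 * hp.cutoff δ x.2) • p)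
  continuous_toFun := by
    have hc : Continuous (hp.cutoff δ) :=
      continuous_const.max (continuous_const.min hp.continuous_ratio)
    have h1 : Continuous fun x : Set.Icc (0 : ℝ) 1 × (V → ℝ) => x.1.1 * hp.cutoff δ x.2 := by
      fun_prop
    refine Continuous.smul (Continuous.inv₀ (continuous_const.sub h1) fun x => ?_) ?_
    · exact (hp.one_sub_mul_cutoff_pos hδ x.1 x.2).ne'
    · exact continuous_snd.sub (h1.smul continuous_const)

lemma pushMap_apply {δ : ℝ} (hδ : δ ∈ Set.Ioc (0 : ℝ) 1) (s : Set.Icc (0 : ℝ) 1) (x : V → ℝ) :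
    hp.pushMap hδ (s, x) = (1 - s.1 * hp.cutoff δ x)⁻¹ • (x - (s.1 * hp.cutoff δ x) • p) := rfl

/-- At most `hp.ratio x` times `p` is subtracted, so coordinates stay nonnegative, and the rescaling
restores their sum. If anything is subtracted, then σ ⊆ τ and `p` lies in the same closed simplex.
-/
lemma pushMap_mem {δ : ℝ} (hδ : δ ∈ Set.Ioc (0 : ℝ) 1) (s : Set.Icc (0 : ℝ) 1) {x : V → ℝ}
    {τ : Finset V} (hx : x ∈ closedSimplex τ) : hp.pushMap hδ (s, x) ∈ closedSimplex τ := by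
  have hpos := hp.one_sub_mul_cutoff_pos hδ s x
  have hc0 := hp.cutoff_nonneg δ x
  rw [pushMap_apply]
  rcases hc0.eq_or_lt with hc | hc
  · rw [← hc]
    simpa using hx
  have hr : 0 < hp.ratio x := by
    by_contra hr
    rw [cutoff, max_eq_left ((min_le_right _ _).trans (not_lt.1 hr))] at hc
    exact lt_irrefl _ hc
  have hcr : hp.cutoff δ x ≤ hp.ratio x := by
    rw [cutoff]
    exact max_le hr.le (min_le_right _ _)
  have hpτ := closedSimplex_mono (hp.subset_of_ratio_pos hx hr) hp.mem
  have hsc : s.1 * hp.cutoff δ x ≤ hp.ratio x :=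
    (mul_le_of_le_one_left hc0 s.2.2).trans hcr
  refine ⟨fun v => ?_, fun v hv => ?_, ?_⟩
  · simp only [Pi.smul_apply, Pi.sub_apply, smul_eq_mul]
    refine mul_nonneg (inv_pos.2 hpos).le (sub_nonneg.2 ?_)
    by_cases hv : v ∈ σ
    · exact (mul_le_mul_of_nonneg_right hsc (hp.pos v hv).le).trans (hp.ratio_mul_le x hv)
    · rw [hp.mem.2.1 v hv, mul_zero]
      exact hx.1 v
  · simp [hx.2.1 v hv, hpτ.2.1 v hv]
  · simp only [Pi.smul_apply, Pi.sub_apply, smul_eq_mul, ← Finset.mul_sum,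
      Finset.sum_sub_distrib, hx.2.2, hpτ.2.2, mul_one]
    exact inv_mul_cancel₀ hpos.ne'

lemma pushMap_ne {δ : ℝ} (hδ : δ ∈ Set.Ioc (0 : ℝ) 1) (s : Set.Icc (0 : ℝ) 1) {x : V → ℝ}
    (hx : x ≠ p) : hp.pushMap hδ (s, x) ≠ p := by
  have hpos := hp.one_sub_mul_cutoff_pos hδ s x
  intro h
  rw [pushMap_apply, inv_smul_eq_iff₀ hpos.ne', sub_smul, one_smul] at h
  exact hx (sub_left_inj.1 h)

lemma pushMap_zero {δ : ℝ} (hδ : δ ∈ Set.Ioc (0 : ℝ) 1) (x : V → ℝ) :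
    hp.pushMap hδ (0, x) = x := by
  rw [pushMap_apply]
  simp

/-- Where the cap `1 - δ` is not active, exactly the ratio times `p` is subtracted, which kills a
coordinate of σ at which the least ratio is attained. -/
lemma pushMap_one_mem_costar {δ : ℝ} (hδ : δ ∈ Set.Ioc (0 : ℝ) 1) {Γ : SimplicialCpx V}
    {x : V → ℝ} (hx : x ∈ Γ.realization) (hr : hp.ratio x ≤ 1 - δ) :
    hp.pushMap hδ (1, x) ∈ (Γ.costar σ hp.nonempty).realization := by
  obtain ⟨τ, hτ, hxτ⟩ := mem_realization.1 hx
  have hy := hp.pushMap_mem hδ 1 hxτ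
  have hc : hp.cutoff δ x = hp.ratio x := by
    rw [cutoff, min_eq_right hr, max_eq_right (hp.ratio_nonneg hxτ.1)]
  obtain ⟨v, hv, hvr⟩ := hp.exists_ratio_eq x
  have hyv : hp.pushMap hδ (1, x) v = 0 := by
    rw [pushMap_apply, hc]
    change _ * (x v - 1 * hp.ratio x * p v) = 0
    rw [one_mul, hvr, sub_self, mul_zero]
  refine mem_realization.2 ⟨τ.erase v, mem_costar.2 ⟨Γ.down_closed hτ (Finset.erase_subset v τ),
    fun h => Finset.notMem_erase v τ (h hv)⟩, hy.1, fun w hw => ?_, ?_⟩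
  · rcases eq_or_ne w v with rfl | hwv
    · exact hyv
    · exact hy.2.1 w fun hwτ => hw (Finset.mem_erase.2 ⟨hwv, hwτ⟩)
  · rw [Finset.sum_erase _ hyv, hy.2.2]

lemma notMem_costar {Γ : SimplicialCpx V} : p ∉ (Γ.costar σ hp.nonempty).realization := by
  rw [mem_realization]
  rintro ⟨τ, hτ, hpτ⟩
  refine (mem_costar.1 hτ).2 fun v hv => ?_
  by_contra hvτ
  exact (hp.pos v hv).ne' (hpτ.2.1 v hvτ)

lemma costar_subset {Γ : SimplicialCpx V} :
    (Γ.costar σ hp.nonempty).realization ⊆ Γ.realization \ {p} := by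
  intro x hx
  refine ⟨?_, fun h => hp.notMem_costar (h ▸ hx)⟩
  obtain ⟨τ, hτ, hxτ⟩ := mem_realization.1 hx
  exact mem_realization.2 ⟨τ, (mem_costar.1 hτ).1, hxτ⟩

/-- A chain that avoids `p` avoids a neighbourhood of `p`. -/
lemma exists_ratio_le {Γ : SimplicialCpx V} {c : SingChain k (V → ℝ) n}
    (hc : c ∈ singOn k (Γ.realization \ {p}) n) :
    ∃ δ ∈ Set.Ioc (0 : ℝ) 1, c ∈ singOn k {x ∈ Γ.realization | hp.ratio x ≤ 1 - δ} n := by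
  -- The ratio has a maximum on each compact simplex, and it is below 1 away from `p`; a chain has
  -- finitely many simplices, so one δ serves them all.
  have key : ∀ τ : C(stdSimplex ℝ (Fin n), V → ℝ), (∀ t, τ t ∈ Γ.realization \ {p}) →
      ∀ᶠ δ in 𝓝[>] (0 : ℝ), ∀ t, hp.ratio (τ t) ≤ 1 - δ := by
    intro τ hτ
    rcases isEmpty_or_nonempty (stdSimplex ℝ (Fin n)) with h | h
    · exact Filter.Eventually.of_forall fun δ t => h.elim t
    obtain ⟨t₀, -, ht₀⟩ := isCompact_univ.exists_isMaxOn Set.univ_nonempty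
      (hp.continuous_ratio.comp τ.continuous).continuousOn
    obtain ⟨ρ, -, hρ⟩ := mem_realization.1 (hτ t₀).1
    have hlt := hp.ratio_lt_one hρ (hτ t₀).2
    filter_upwards [Ioo_mem_nhdsGT (sub_pos.2 hlt)] with δ hδ t
    have h1 : hp.ratio (τ t) ≤ hp.ratio (τ t₀) := ht₀ (Set.mem_univ t)
    have h2 := hδ.2
    linarith
  have hall : ∀ᶠ δ in 𝓝[>] (0 : ℝ), ∀ τ ∈ c.support, ∀ t, hp.ratio (τ t) ≤ 1 - δ :=
    (Filter.eventually_all_finset _).2 fun τ hτ => key τ (hc hτ)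
  obtain ⟨δ, hδ1, hδ2⟩ := (hall.and (Ioc_mem_nhdsGT zero_lt_one)).exists
  exact ⟨δ, hδ2, fun τ hτ t => ⟨(hc hτ t).1, hδ1 τ hτ t⟩⟩

/-- The homotopy that pushes singular simplices away from `p`. -/
noncomputable def push {δ : ℝ} (hδ : δ ∈ Set.Ioc (0 : ℝ) 1) :
    SimplexHomotopy (V → ℝ) (V → ℝ) := SimplexHomotopy.ofMap (hp.pushMap hδ)

lemma push_level_zero {δ : ℝ} (hδ : δ ∈ Set.Ioc (0 : ℝ) 1) (x : SingChain k (V → ℝ) n) :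
    (hp.push hδ).level 0 n x = x := by
  refine finsupp_hom_ext (f := (hp.push hδ).level 0 n) (g := LinearMap.id) (fun τ => ?_) x
  rw [SimplexHomotopy.level_single, LinearMap.id_apply]
  congr 1
  ext1 t
  exact hp.pushMap_zero hδ (τ t)

end InteriorPoint

lemma SimplexHomotopy.singBoundary_level {Z Z' : Type*} [TopologicalSpace Z]
    [TopologicalSpace Z'] (H : SimplexHomotopy Z Z') (s : Set.Icc (0 : ℝ) 1)
    (x : SingChain k Z (n + 1)) :
    singBoundary (H.level s (n + 1) x) = H.level s n (singBoundary x) := by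
  refine finsupp_hom_ext (f := singBoundary ∘ₗ H.level s (n + 1))
    (g := H.level s n ∘ₗ singBoundary) (fun τ => ?_) x
  simp only [LinearMap.comp_apply, level_single, singBoundary_single, map_sum, map_smul,
    H.comp_face]
  rfl

lemma SimplexHomotopy.level_mem {Z Z' : Type*} [TopologicalSpace Z]
    [TopologicalSpace Z'] (H : SimplexHomotopy Z Z') (s : Set.Icc (0 : ℝ) 1) {A : Set Z}
    {B : Set Z'} (h : ∀ τ : C(stdSimplex ℝ (Fin n), Z), (∀ t, τ t ∈ A) → ∀ t,
      H.toMap n τ (cylinderIncl s n t) ∈ B)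
    {x : SingChain k Z n} (hx : x ∈ singOn k A n) : H.level s n x ∈ singOn k B n :=
  map_mem_of_supported (fun τ hτ => by
    rw [level_single]; exact Finsupp.single_mem_supported k 1 (h τ hτ)) hx

end PushingOff

/-! ### Carriers of small singular simplices -/

section SmallSimplices

open Filter Topology

variable {k : Type u} [Field k] {V : Type v} [LinearOrder V] {n : ℕ}

/-- A lower bound for the largest barycentric coordinate of the points of `|Γ|`. -/
noncomputable def coordBound (Γ : SimplicialCpx V) : ℝ := ((Γ.faces.sup id).card + 1 : ℝ)⁻¹

lemma coordBound_pos (Γ : SimplicialCpx V) : 0 < Γ.coordBound := by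
  unfold coordBound
  positivity

/-- The coordinates at the vertices of Γ sum to 1, so they cannot all lie below the bound. The extra
1 in its denominator keeps it positive even without vertices. -/
lemma exists_coordBound_le {Γ : SimplicialCpx V} {x : V → ℝ} (hx : x ∈ Γ.realization) :
    ∃ v ∈ Γ.faces.sup id, Γ.coordBound ≤ x v := by
  obtain ⟨τ, hτ, hxτ⟩ := mem_realization.1 hx
  have h := (closedSimplex_mono (Finset.le_sup (f := id) hτ) hxτ).2.2
  by_contra! hlt
  have h1 : ∑ v ∈ Γ.faces.sup id, x v ≤ ∑ v ∈ Γ.faces.sup id, Γ.coordBound :=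
    Finset.sum_le_sum fun v hv => (hlt v hv).le
  rw [h, Finset.sum_const, nsmul_eq_mul, coordBound, ← div_eq_mul_inv, le_div_iff₀ (by positivity)]
    at h1
  linarith

/-- A vertex at which a point of `|Γ|` has a large coordinate. -/
noncomputable def nearVertex (Γ : SimplicialCpx V) [Nonempty V] (x : V → ℝ) : V :=
  Classical.epsilon fun v => v ∈ Γ.faces.sup id ∧ Γ.coordBound ≤ x v

lemma nearVertex_spec {Γ : SimplicialCpx V} [Nonempty V] {x : V → ℝ} (hx : x ∈ Γ.realization) :
    Γ.nearVertex x ∈ Γ.faces.sup id ∧ Γ.coordBound ≤ x (Γ.nearVertex x) :=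
  Classical.epsilon_spec (exists_coordBound_le hx)

/-- The coordinates at the vertices of `Γ`. -/
def vertexCoords (Γ : SimplicialCpx V) : C(V → ℝ, ↥(Γ.faces.sup id) → ℝ) where
  toFun x v := x v
  continuous_toFun := by fun_prop

/-- The chains of singular simplices along which the coordinates vary little. -/
abbrev smallOn (k : Type u) [Field k] (Γ : SimplicialCpx V) (n : ℕ) :
    Submodule k (SingChain k (V → ℝ) n) :=
  Finsupp.supported k k {τ | ∀ t t', dist (Γ.vertexCoords (τ t)) (Γ.vertexCoords (τ t')) <
    Γ.coordBound}

lemma singBoundary_mem_smallOn {Γ : SimplicialCpx V} {x : SingChain k (V → ℝ) (n + 1)}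
    (hx : x ∈ smallOn k Γ (n + 1)) : singBoundary x ∈ smallOn k Γ n :=
  map_mem_of_supported (fun τ hτ => by
    rw [singBoundary_single]
    exact Submodule.sum_mem _ fun i _ => Submodule.smul_mem _ _
      (Finsupp.single_mem_supported k 1 fun t t' => hτ _ _)) hx

variable [Nonempty V]

/-- The coordinate chosen at a vertex of τ is at least `coordBound` there and varies by less along
τ, so it is nonzero at every point of τ. Any face carrying `τ t` therefore contains all the chosen
vertices; the bound of Γ works for every subcomplex Λ. -/
lemma exists_carrier {Γ Λ : SimplicialCpx V} (hΛ : Λ.faces ⊆ Γ.faces)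
    {τ : C(stdSimplex ℝ (Fin n), V → ℝ)} (hτ : ∀ t, τ t ∈ Λ.realization)
    (hs : ∀ t t', dist (Γ.vertexCoords (τ t)) (Γ.vertexCoords (τ t')) < Γ.coordBound)
    (t : stdSimplex ℝ (Fin n)) :
    ∃ ρ ∈ Λ.faces, τ t ∈ closedSimplex ρ ∧ ∀ i, Γ.nearVertex (τ (stdVertices n i)) ∈ ρ := by
  obtain ⟨ρ, hρ, htρ⟩ := mem_realization.1 (hτ t)
  refine ⟨ρ, hρ, htρ, fun i => ?_⟩
  have hΓ : τ (stdVertices n i) ∈ Γ.realization := by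
    obtain ⟨ρ', hρ', h⟩ := mem_realization.1 (hτ (stdVertices n i))
    exact mem_realization.2 ⟨ρ', hΛ hρ', h⟩
  obtain ⟨h1, h2⟩ := nearVertex_spec hΓ
  by_contra hi
  have h3 := htρ.2.1 _ hi
  have h4 := lt_of_le_of_lt (dist_le_pi_dist (Γ.vertexCoords (τ (stdVertices n i)))
    (Γ.vertexCoords (τ t)) ⟨_, h1⟩) (hs _ _)
  change |τ (stdVertices n i) (Γ.nearVertex (τ (stdVertices n i))) -
    τ t (Γ.nearVertex (τ (stdVertices n i)))| < _ at h4
  rw [h3, sub_zero] at h4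
  exact absurd (h2.trans (le_abs_self _)) (not_le.2 h4)

lemma approxChain_mem {Γ Λ : SimplicialCpx V} (hΛ : Λ.faces ⊆ Γ.faces)
    {x : SingChain k (V → ℝ) n} (h1 : x ∈ singOn k Λ.realization n) (h2 : x ∈ smallOn k Γ n) :
    approxChain Γ.nearVertex n x ∈ ordOn k (SpansFace Λ (n := n)) := by
  have h := Submodule.mem_inf.2 ⟨h1, h2⟩
  rw [singOn, smallOn, ← Finsupp.supported_inter] at h
  refine map_mem_of_supported (fun τ hτ => ?_) h
  rw [approxChain_single]
  refine Finsupp.single_mem_supported k 1 ?_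
  cases n with
  | zero =>
    -- The empty simplex has no point that could determine a face.
    refine SpansFace.of_forall_mem Λ.empty_mem fun i => i.elim0
  | succ n =>
    obtain ⟨ρ, hρ, -, h⟩ := exists_carrier hΛ hτ.1 hτ.2 (stdVertices (n + 1) 0)
    exact SpansFace.of_forall_mem hρ h

/-- A point of a small simplex and its approximation lie in one closed simplex of Λ
(`exists_carrier`), which contains the segment between them. -/
lemma approxHomotopy_prism_mem {Γ Λ : SimplicialCpx V} (hΛ : Λ.faces ⊆ Γ.faces)
    {x : SingChain k (V → ℝ) n} (h1 : x ∈ singOn k Λ.realization n) (h2 : x ∈ smallOn k Γ n) :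
    (approxHomotopy Γ.nearVertex).prism 0 n x ∈ singOn k Λ.realization (n + 1) := by
  have h := Submodule.mem_inf.2 ⟨h1, h2⟩
  rw [singOn, smallOn, ← Finsupp.supported_inter] at h
  refine map_mem_of_supported (fun τ hτ => ?_) h
  rw [SimplexHomotopy.prism_single]
  refine singMap_mem (fun y => ?_) _
  obtain ⟨ρ, hρ, hy, hi⟩ := exists_carrier hΛ hτ.1 hτ.2 ⟨y.1.1, y.2.1⟩
  refine mem_realization.2 ⟨ρ, hρ, ?_⟩
  exact convex_closedSimplex ρ hy (linSimplex_mem hi _) (sub_nonneg.2 y.2.2.2) y.2.2.1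
    (sub_add_cancel _ _)

end SmallSimplices

/-! ### From simplicial to singular lifting -/

section Comparison

open Filter Topology

variable {k : Type u} [Field k] {V : Type v} [LinearOrder V] {n : ℕ}

/-- Singular relative cycles of the pair `(Y, Y \ {p})` lift to reduced cycles of `Y`. -/
def SingLifts (k : Type u) [Field k] (Y : Set (V → ℝ)) (p : V → ℝ) (n : ℕ) : Prop :=
  ∀ c ∈ singOn k Y (n + 1), singBoundary c ∈ singOn k (Y \ {p}) n →
    ∃ z ∈ singOn k Y (n + 1), singBoundary z = 0 ∧ ∃ a ∈ singOn k (Y \ {p}) (n + 1),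
      ∃ b ∈ singOn k Y (n + 2), c = z + a + singBoundary b

lemma costar_faces_subset (Γ : SimplicialCpx V) (σ : Finset V) (hσ : σ.Nonempty) :
    (Γ.costar σ hσ).faces ⊆ Γ.faces := fun _ h => (mem_costar.1 h).1

variable {σ : Finset V} {p : V → ℝ}

namespace InteriorPoint

lemma push_prism_mem (hp : InteriorPoint σ p) {δ : ℝ} (hδ : δ ∈ Set.Ioc (0 : ℝ) 1)
    (Γ : SimplicialCpx V) (m : ℕ) {x : SingChain k (V → ℝ) n}
    (hx : x ∈ singOn k Γ.realization n) :
    (hp.push hδ).prism m n x ∈ singOn k Γ.realization (n + 1) := by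
  refine SimplexHomotopy.prism_mem _ m (fun τ hτ y => ?_) hx
  obtain ⟨ρ, hρ, h⟩ := mem_realization.1 (hτ ⟨y.1.1, y.2.1⟩)
  exact mem_realization.2 ⟨ρ, hρ, hp.pushMap_mem hδ ⟨y.1.2, y.2.2⟩ h⟩

lemma push_prism_mem_diff (hp : InteriorPoint σ p) {δ : ℝ} (hδ : δ ∈ Set.Ioc (0 : ℝ) 1)
    (Γ : SimplicialCpx V) (m : ℕ) {x : SingChain k (V → ℝ) n}
    (hx : x ∈ singOn k (Γ.realization \ {p}) n) :
    (hp.push hδ).prism m n x ∈ singOn k (Γ.realization \ {p}) (n + 1) := by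
  refine SimplexHomotopy.prism_mem _ m (fun τ hτ y => ?_) hx
  obtain ⟨ρ, hρ, h⟩ := mem_realization.1 (hτ ⟨y.1.1, y.2.1⟩).1
  exact ⟨mem_realization.2 ⟨ρ, hρ, hp.pushMap_mem hδ ⟨y.1.2, y.2.2⟩ h⟩,
    hp.pushMap_ne hδ ⟨y.1.2, y.2.2⟩ (hτ ⟨y.1.1, y.2.1⟩).2⟩

lemma push_level_mem (hp : InteriorPoint σ p) {δ : ℝ} (hδ : δ ∈ Set.Ioc (0 : ℝ) 1)
    (s : Set.Icc (0 : ℝ) 1) (Γ : SimplicialCpx V) {x : SingChain k (V → ℝ) n}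
    (hx : x ∈ singOn k Γ.realization n) :
    (hp.push hδ).level s n x ∈ singOn k Γ.realization n := by
  refine SimplexHomotopy.level_mem _ s (fun τ hτ t => ?_) hx
  obtain ⟨ρ, hρ, h⟩ := mem_realization.1 (hτ t)
  exact mem_realization.2 ⟨ρ, hρ, hp.pushMap_mem hδ s h⟩

lemma push_level_one_mem_costar (hp : InteriorPoint σ p) {δ : ℝ} (hδ : δ ∈ Set.Ioc (0 : ℝ) 1)
    (Γ : SimplicialCpx V) {x : SingChain k (V → ℝ) n}
    (hx : x ∈ singOn k {x ∈ Γ.realization | hp.ratio x ≤ 1 - δ} n) :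
    (hp.push hδ).level 1 n x ∈ singOn k (Γ.costar σ hp.nonempty).realization n :=
  SimplexHomotopy.level_mem _ 1 (fun _ hτ t =>
    hp.pushMap_one_mem_costar hδ (hτ t).1 (hτ t).2) hx

/-- Liftability of simplicial cycles implies that of singular cycles. -/
theorem singLifts (hp : InteriorPoint σ p) {Γ : SimplicialCpx V}
    (h : LiftsCycles k Γ (n + 1) σ) : SingLifts k Γ.realization p n := by
  intro c hc hbc
  have hV : Nonempty V := ⟨hp.nonempty.choose⟩
  have hcos := costar_faces_subset Γ σ hp.nonempty
  obtain ⟨δ, hδ, hδc⟩ := hp.exists_ratio_le hbc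
  set H := hp.push hδ
  set A := approxHomotopy Γ.nearVertex
  -- Smallness is measured in the finitely many coordinates at vertices of Γ, since `V` may be
  -- infinite.
  obtain ⟨m, hm⟩ := (eventually_singSubdiv_small Γ.vertexCoords (H.level 1 (n + 1) c)
    Γ.coordBound_pos).exists
  set c₁ := singSubdiv m (n + 1) (H.level 1 (n + 1) c) with hc₁
  have hc₁mem : c₁ ∈ singOn k Γ.realization (n + 1) := singSubdiv_mem m (hp.push_level_mem hδ 1 Γ hc)
  have hbc₁ : singBoundary c₁ ∈ singOn k (Γ.costar σ hp.nonempty).realization n := by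
    rw [hc₁, singBoundary_singSubdiv, SimplexHomotopy.singBoundary_level]
    exact singSubdiv_mem m (hp.push_level_one_mem_costar hδ Γ hδc)
  have e₁ : singBoundary (H.prism m (n + 1) c) + H.prism m n (singBoundary c) = c₁ - c := by
    rw [H.singBoundary_prism, hp.push_level_zero]
  set y := approxChain Γ.nearVertex (n + 1) c₁ with hy
  have hymem : y ∈ ordOn k (SpansFace Γ (n := n + 1)) :=
    approxChain_mem (subset_refl _) hc₁mem hm
  have hby : ordBoundary y ∈ ordOn k (SpansFace (Γ.costar σ hp.nonempty) (n := n)) := by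
    rw [hy, ordBoundary_approxChain]
    exact approxChain_mem hcos hbc₁ (singBoundary_mem_smallOn hm)
  have e₂ : singBoundary (A.prism 0 (n + 1) c₁) + A.prism 0 n (singBoundary c₁) =
      geomChain (n + 1) y - c₁ := by
    rw [A.singBoundary_prism, approxHomotopy_level_zero, approxHomotopy_level_one, singSubdiv_zero]
  have e₃ := congrArg (geomChain (n + 1)) (ordBoundary_sortHomotopy y)
  rw [map_add, map_sub, ← singBoundary_geomChain] at e₃
  -- The oriented form of the approximation is a simplicial relative cycle, to which the hypothesis
  -- applies.
  obtain ⟨z, hz, hzσ⟩ := h _ (orient_mem_chains hymem) (by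
    rw [boundary_orient]
    exact (mem_chains_costar.1 (orient_mem_chains hby)).2)
  obtain ⟨hz1, hz2⟩ := mem_cycles.1 hz
  have hzc : orient (n + 1) y - z ∈ chains k (Γ.costar σ hp.nonempty) (n + 1) :=
    mem_chains_costar.2 ⟨Submodule.sub_mem _ (orient_mem_chains hymem) hz1, hzσ⟩
  -- Three homotopies lead from `c` to the realized simplicial chain: push with subdivision,
  -- approximation, and sorting. Their values on boundaries avoid `p` and form `a` together with the
  -- difference from the lift; their values on the chains themselves form `b`.
  refine ⟨geomChain (n + 1) (sortChain (n + 1) z), geomChain_mem (sortChain_mem hz1), ?_,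
    geomChain (n + 1) (sortChain (n + 1) (orient (n + 1) y - z)) -
      geomChain (n + 1) (sortHomotopy n (ordBoundary y)) - A.prism 0 n (singBoundary c₁) -
      H.prism m n (singBoundary c), ?_,
    -geomChain (n + 2) (sortHomotopy (n + 1) y) - A.prism 0 (n + 1) c₁ - H.prism m (n + 1) c,
    ?_, ?_⟩
  · rw [singBoundary_geomChain, ordBoundary_sortChain, hz2, map_zero, map_zero]
  · have hsub : singOn k (Γ.costar σ hp.nonempty).realization (n + 1) ≤
        singOn k (Γ.realization \ {p}) (n + 1) :=
      Finsupp.supported_mono fun τ hτ t => hp.costar_subset (hτ t)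
    refine Submodule.sub_mem _ (Submodule.sub_mem _ (Submodule.sub_mem _ ?_ ?_) ?_) ?_
    · exact hsub (geomChain_mem (sortChain_mem hzc))
    · exact hsub (geomChain_mem (sortHomotopy_mem hby))
    · exact hsub (approxHomotopy_prism_mem hcos hbc₁ (singBoundary_mem_smallOn hm))
    · exact hp.push_prism_mem_diff hδ Γ m hbc
  · refine Submodule.sub_mem _ (Submodule.sub_mem _ (Submodule.neg_mem _ ?_) ?_) ?_
    · exact geomChain_mem (sortHomotopy_mem hymem)
    · exact approxHomotopy_prism_mem (subset_refl _) hc₁mem hm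
    · exact hp.push_prism_mem hδ Γ m hc
  · simp only [map_sub, map_neg]
    have h1 : c = c₁ - (singBoundary (H.prism m (n + 1) c) + H.prism m n (singBoundary c)) := by
      rw [e₁]; abel
    have h2 : c₁ = geomChain (n + 1) y -
        (singBoundary (A.prism 0 (n + 1) c₁) + A.prism 0 n (singBoundary c₁)) := by
      rw [e₂]; abel
    have h3 : geomChain (n + 1) y = geomChain (n + 1) (sortChain (n + 1) (orient (n + 1) y)) -
        (singBoundary (geomChain (n + 2) (sortHomotopy (n + 1) y)) +
          geomChain (n + 1) (sortHomotopy n (ordBoundary y))) := by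
      rw [e₃]; abel
    rw [h3] at h2
    generalize H.prism m n (singBoundary c) = q1 at *
    generalize singBoundary (H.prism m (n + 1) c) = q2 at *
    generalize A.prism 0 n (singBoundary c₁) = q3 at *
    generalize singBoundary (A.prism 0 (n + 1) c₁) = q4 at *
    rw [h1, h2]
    abel

end InteriorPoint

end Comparison

/-! ### From singular to simplicial lifting -/

section Converse

open Filter Topology

variable {k : Type u} [Field k] {V : Type v} [LinearOrder V] {n : ℕ} {σ : Finset V} {p : V → ℝ}

/-- The cone over `v` kills `x`, so the cone formula expresses `x` as the cone over its boundary. -/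
lemma eq_zero_of_boundary_eq_zero {v : V} {x : Finset V →₀ k} (hv : ∀ s, x s ≠ 0 → v ∈ s)
    (hx : boundary k x = 0) : x = 0 := by
  have h := boundary_coneOver (k := k) v x
  have h0 : coneOver k v x = 0 := by
    ext s
    rw [coneOver_apply]
    split_ifs with hs
    · have : x (s.erase v) = 0 := by
        by_contra hne
        exact Finset.notMem_erase v s (hv _ hne)
      rw [this, mul_zero, Finsupp.zero_apply]
    · rfl
  rw [h0, hx, map_zero, map_zero, sub_zero] at h
  exact h.symm

namespace InteriorPoint

variable [Nonempty V]

/-- Push away from an interior point, subdivide, and approximate simplicially. -/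
noncomputable def approx (hp : InteriorPoint σ p) {δ : ℝ} (hδ : δ ∈ Set.Ioc (0 : ℝ) 1)
    (Γ : SimplicialCpx V) (m n : ℕ) : SingChain k (V → ℝ) n →ₗ[k] (Finset V →₀ k) :=
  orient n ∘ₗ approxChain Γ.nearVertex n ∘ₗ singSubdiv m n ∘ₗ (hp.push hδ).level 1 n

variable (hp : InteriorPoint σ p) {δ : ℝ} (hδ : δ ∈ Set.Ioc (0 : ℝ) 1) (Γ : SimplicialCpx V)
  (m : ℕ)

lemma boundary_approx (x : SingChain k (V → ℝ) (n + 1)) :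
    boundary k (hp.approx hδ Γ m (n + 1) x) = hp.approx hδ Γ m n (singBoundary x) := by
  simp only [approx, LinearMap.comp_apply, boundary_orient, ordBoundary_approxChain,
    singBoundary_singSubdiv, SimplexHomotopy.singBoundary_level]

variable {Γ m}

lemma approx_mem {Λ : SimplicialCpx V} (hΛ : Λ.faces ⊆ Γ.faces) {x : SingChain k (V → ℝ) n}
    (hx : (hp.push hδ).level 1 n x ∈ singOn k Λ.realization n)
    (hs : singSubdiv m n ((hp.push hδ).level 1 n x) ∈ smallOn k Γ n) :
    hp.approx hδ Γ m n x ∈ chains k Λ n :=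
  orient_mem_chains (approxChain_mem hΛ (singSubdiv_mem m hx) hs)

/-- Simplicial chains are fixed by the approximation. -/
lemma approx_single (hs : ∀ s ∈ Γ.faces, singSubdiv m s.card ((hp.push hδ).level 1 s.card
      (geomChain s.card (sortChain s.card (Finsupp.single s (1 : k))))) ∈ smallOn k Γ s.card)
    {s : Finset V} (hsΓ : s ∈ Γ.faces) (hn : s.card = n) :
    hp.approx hδ Γ m n (geomChain n (sortChain n (Finsupp.single s (1 : k)))) =
      Finsupp.single s 1 := by
  induction n generalizing s with
  | zero =>
    obtain rfl := Finset.card_eq_zero.1 hn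
    simp only [approx, LinearMap.comp_apply]
    rw [sortChain_single hn, geomChain_single, SimplexHomotopy.level_single, singSubdiv_single,
      stdSubdiv, ordSubdivIter_deg_zero, LinearMap.id_apply, affChain_single, singMap_single,
      approxChain_single, orient_single, orientTuple]
  | succ n ih =>
    obtain ⟨v, hv⟩ : s.Nonempty := Finset.card_pos.1 (by omega)
    -- Every operation stays in the full simplex on `s`, so the result is a multiple of `s`. Its
    -- boundary is known by induction, and this fixes the multiple.
    have hsub := Γ.induce_faces_subset (· ∈ s)
    have hsi : s ∈ (Γ.induce (· ∈ s)).faces := mem_induce.2 ⟨hsΓ, fun _ h => h⟩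
    have hy := hp.approx_mem hδ hsub (hp.push_level_mem hδ 1 (Γ.induce (· ∈ s))
      (geomChain_mem (sortChain_mem (n := s.card) (single_mem_chains hsi (1 : k))))) (hs s hsΓ)
    rw [hn] at hy
    rw [← sub_eq_zero]
    refine eq_zero_of_boundary_eq_zero (v := v) (fun t ht => ?_) ?_
    · rw [Finsupp.sub_apply] at ht
      by_contra hvt
      have hne : s ≠ t := fun h => hvt (h ▸ hv)
      rw [Finsupp.single_eq_of_ne hne.symm, sub_zero] at ht
      obtain ⟨h1, h2⟩ := mem_chains.1 hy t ht
      exact hne (Finset.eq_of_subset_of_card_le (mem_induce.1 h1).2 (by omega)).symm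
    · rw [map_sub, boundary_approx, singBoundary_geomChain, ordBoundary_sortChain, sub_eq_zero]
      have hb := boundary_mem_chains (k := k) (n := n) (hn ▸ single_mem_chains hsΓ (1 : k))
      revert hb
      generalize boundary k (Finsupp.single s (1 : k)) = y
      intro hb
      have := LinearMap.eqOn_span (s := (fun t => Finsupp.single t (1 : k)) ''
        {t : Finset V | t ∈ Γ.faces ∧ t.card = n})
        (f := hp.approx hδ Γ m n ∘ₗ geomChain n ∘ₗ sortChain n) (g := LinearMap.id)
        (by rintro _ ⟨t, ht, rfl⟩; exact ih ht.1 ht.2)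
      rw [← Finsupp.supported_eq_span_single] at this
      exact this hb

/-- Liftability of singular cycles implies that of simplicial cycles. -/
theorem liftsCycles (hp : InteriorPoint σ p) (hΓ : Γ.IsPureOfRank (n + 1))
    (h : SingLifts k Γ.realization p n) : LiftsCycles k Γ (n + 1) σ := by
  intro c hc hbc
  set x := geomChain (n + 1) (sortChain (n + 1) c) with hx
  have hcos := costar_faces_subset Γ σ hp.nonempty
  have hbx : singBoundary x ∈ singOn k (Γ.realization \ {p}) n := by
    rw [hx, singBoundary_geomChain, ordBoundary_sortChain]
    have hmem := geomChain_mem (sortChain_mem (mem_chains_costar (hσ := hp.nonempty)|>.2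
      ⟨boundary_mem_chains hc, hbc⟩))
    have hsub : singOn k (Γ.costar σ hp.nonempty).realization n ≤
        singOn k (Γ.realization \ {p}) n :=
      Finsupp.supported_mono fun τ hτ t => hp.costar_subset (hτ t)
    exact hsub hmem
  obtain ⟨z, hz, hbz, a, ha, b, hb, e⟩ := h x (geomChain_mem (sortChain_mem hc)) hbx
  obtain ⟨δ, hδ, hδa⟩ := hp.exists_ratio_le ha
  set H := hp.push hδ
  have small : ∀ {j : ℕ} (w : SingChain k (V → ℝ) j), ∀ᶠ m in atTop,
      singSubdiv m j (H.level 1 j w) ∈ smallOn k Γ j := fun w =>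
    eventually_singSubdiv_small Γ.vertexCoords (H.level 1 _ w) Γ.coordBound_pos
  -- One number of subdivisions must serve all the chains, so that a single chain map acts on the
  -- whole equation.
  obtain ⟨m, ⟨⟨hmz, hma⟩, hmb⟩, hms⟩ := (((small z).and (small a)).and (small b)).and
    ((Filter.eventually_all_finset Γ.faces).2 fun s _ =>
      small (geomChain s.card (sortChain s.card (Finsupp.single s (1 : k))))) |>.exists
  have hxc : hp.approx hδ Γ m (n + 1) x = c := by
    have := LinearMap.eqOn_span (s := (fun t => Finsupp.single t (1 : k)) ''
      {t : Finset V | t ∈ Γ.faces ∧ t.card = n + 1})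
      (f := hp.approx hδ Γ m (n + 1) ∘ₗ geomChain (n + 1) ∘ₗ sortChain (n + 1))
      (g := LinearMap.id)
      (by rintro _ ⟨t, ht, rfl⟩; exact hp.approx_single hδ hms ht.1 ht.2)
    rw [← Finsupp.supported_eq_span_single] at this
    exact this hc
  -- Γ has no faces with `n + 2` vertices, so the approximation of `b` vanishes.
  have hb0 : hp.approx hδ Γ m (n + 1) (singBoundary b) = 0 := by
    have hmem := hp.approx_mem hδ (subset_refl _) (hp.push_level_mem hδ 1 Γ hb) hmb
    rw [← boundary_approx, chains_eq_bot hΓ (Nat.lt_succ_self (n + 1)) hmem, map_zero]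
  refine ⟨hp.approx hδ Γ m (n + 1) z, mem_cycles.2
    ⟨hp.approx_mem hδ (subset_refl _) (hp.push_level_mem hδ 1 Γ hz) hmz, ?_⟩, ?_⟩
  · rw [boundary_approx, hbz, map_zero]
  · have hca : c - hp.approx hδ Γ m (n + 1) z = hp.approx hδ Γ m (n + 1) a := by
      rw [← hxc, e, map_add, map_add, hb0]
      abel
    rw [hca]
    exact (mem_chains_costar.1 (hp.approx_mem hδ hcos
      (hp.push_level_one_mem_costar hδ Γ hδa) hma)).2

end InteriorPoint

end Converse

/-! ### Homology of complexes of modules in terms of elements -/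

section HomologyOfModules

open HomologicalComplex

variable {R : Type u} [Ring R] {K L A P : ChainComplex (ModuleCat.{v} R) ℕ} {n : ℕ}

lemma f_d_apply (f : K ⟶ L) (i j : ℕ) (x : K.X i) :
    L.d i j (f.f i x) = f.f j (K.d i j x) :=
  congr($(f.comm i j) x)

lemma iCycles_injective : Function.Injective (K.iCycles n) :=
  (ModuleCat.mono_iff_injective _).1 inferInstance

lemma homologyπ_surjective : Function.Surjective (K.homologyπ n) :=
  (ModuleCat.epi_iff_surjective _).1 inferInstance

lemma iCycles_cyclesMap_apply (f : K ⟶ L) (x : K.cycles n) :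
    L.iCycles n (cyclesMap f n x) = f.f n (K.iCycles n x) :=
  congr($(cyclesMap_i f n) x)

lemma homologyMap_homologyπ_apply (f : K ⟶ L) (x : K.cycles n) :
    homologyMap f n (K.homologyπ n x) = L.homologyπ n (cyclesMap f n x) :=
  congr($(homologyπ_naturality f n) x)

lemma exists_cycle {j : ℕ} (hj : (ComplexShape.down ℕ).next n = j) {x : K.X n}
    (hx : K.d n j x = 0) : ∃ y : K.cycles n, K.iCycles n y = x :=
  ⟨K.cyclesMk x j hj hx, K.i_cyclesMk x j hj hx⟩

lemma d_iCycles_apply (j : ℕ) (y : K.cycles n) : K.d n j (K.iCycles n y) = 0 :=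
  congr($(K.iCycles_d n j) y)

/-- The homology is the cokernel of the map from chains to cycles, which gives exactness at the
cycles. -/
lemma homologyπ_eq_zero_iff (y : K.cycles n) :
    K.homologyπ n y = 0 ↔ ∃ b : K.X (n + 1), K.d (n + 1) n b = K.iCycles n y := by
  have hex := ShortComplex.exact_of_g_is_cokernel
    (ShortComplex.mk _ _ (K.toCycles_comp_homologyπ (n + 1) n))
    (K.homologyIsCokernel (n + 1) n (ChainComplex.prev ℕ n))
  rw [ShortComplex.moduleCat_exact_iff] at hex
  have hi : ∀ b : K.X (n + 1), K.iCycles n (K.toCycles (n + 1) n b) = K.d (n + 1) n b := fun b =>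
    congr($(K.toCycles_i (n + 1) n) b)
  constructor
  · intro h
    obtain ⟨b, hb⟩ := hex y h
    exact ⟨b, by rw [← hi]; exact congrArg _ hb⟩
  · rintro ⟨b, hb⟩
    rw [← hi] at hb
    rw [← iCycles_injective hb]
    exact congr($(K.toCycles_comp_homologyπ (n + 1) n) b)

lemma cokernel_π_surjective (i : A ⟶ K) :
    Function.Surjective ((Limits.cokernel.π i).f n) :=
  (ModuleCat.epi_iff_surjective _).1 inferInstance

lemma cokernel_π_eq_zero_iff (i : A ⟶ K) (x : K.X n) :
    (Limits.cokernel.π i).f n x = 0 ↔ ∃ a, i.f n a = x := by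
  have h := (exact_iff_degreewise_exact _).1 (ShortComplex.exact_cokernel i) n
  rw [ShortComplex.moduleCat_exact_iff] at h
  constructor
  · exact h x
  · rintro ⟨a, rfl⟩
    have := congr_hom (Limits.cokernel.condition i) n
    exact congr($this a)

/-- An elementwise description of the surjectivity of the map from reduced to relative homology. -/
lemma surjective_homologyMap_restrict_iff (i : A ⟶ K) (f : K ⟶ P) {j : ℕ}
    (hj : (ComplexShape.down ℕ).next n = j) :
    Function.Surjective ((homologyMap (Limits.cokernel.π i) n).hom.domRestrict
      (LinearMap.ker (homologyMap f n).hom)) ↔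
    ∀ c : K.X n, (∃ a, i.f j a = K.d n j c) → ∃ z : K.X n, K.d n j z = 0 ∧
      (∃ q, P.d (n + 1) n q = f.f n z) ∧ ∃ a b, c = z + i.f n a + K.d (n + 1) n b := by
  set π := Limits.cokernel.π i
  constructor
  · intro h c hc
    have hπc : (Limits.cokernel i).d n j (π.f n c) = 0 := by
      rw [f_d_apply, cokernel_π_eq_zero_iff]
      exact hc
    obtain ⟨y, hy⟩ := exists_cycle hj hπc
    obtain ⟨⟨x, hx⟩, hxy⟩ := h ((Limits.cokernel i).homologyπ n y)
    obtain ⟨z, rfl⟩ := homologyπ_surjective x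
    refine ⟨K.iCycles n z, d_iCycles_apply j z, ?_, ?_⟩
    · have hx' : homologyMap f n (K.homologyπ n z) = 0 := hx
      rw [homologyMap_homologyπ_apply, homologyπ_eq_zero_iff, iCycles_cyclesMap_apply] at hx'
      exact hx'
    · have hxy' : homologyMap π n (K.homologyπ n z) = (Limits.cokernel i).homologyπ n y := hxy
      rw [homologyMap_homologyπ_apply, eq_comm, ← sub_eq_zero, ← map_sub, homologyπ_eq_zero_iff,
        map_sub, iCycles_cyclesMap_apply, hy] at hxy'
      obtain ⟨b', hb'⟩ := hxy'
      obtain ⟨b, rfl⟩ := cokernel_π_surjective i b'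
      rw [f_d_apply, ← map_sub, eq_comm, ← sub_eq_zero, ← map_sub,
        cokernel_π_eq_zero_iff] at hb'
      obtain ⟨a, ha⟩ := hb'
      refine ⟨a, b, ?_⟩
      rw [ha]
      abel
  · intro h x
    obtain ⟨y, rfl⟩ := homologyπ_surjective x
    obtain ⟨c, hc⟩ := cokernel_π_surjective i ((Limits.cokernel i).iCycles n y)
    obtain ⟨z, hz, hq, a, b, e⟩ := h c (by
      rw [← cokernel_π_eq_zero_iff, ← f_d_apply, hc, d_iCycles_apply])
    obtain ⟨w, rfl⟩ := exists_cycle hj hz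
    refine ⟨⟨K.homologyπ n w, ?_⟩, ?_⟩
    · change homologyMap f n (K.homologyπ n w) = 0
      rw [homologyMap_homologyπ_apply, homologyπ_eq_zero_iff, iCycles_cyclesMap_apply]
      exact hq
    · change homologyMap π n (K.homologyπ n w) = (Limits.cokernel i).homologyπ n y
      rw [homologyMap_homologyπ_apply, eq_comm, ← sub_eq_zero, ← map_sub, homologyπ_eq_zero_iff,
        map_sub, iCycles_cyclesMap_apply, ← hc, e]
      refine ⟨π.f (n + 1) b, ?_⟩
      rw [f_d_apply, map_add, map_add, (cokernel_π_eq_zero_iff i (i.f n a)).2 ⟨a, rfl⟩]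
      abel

end HomologyOfModules

/-! ### The categorical singular complex in terms of formal combinations of simplices -/

section SingularComplex

open Simplicial

variable {k : Type u} [Field k] {X Y : TopCat.{v}} {n : ℕ}

/-- The simplices of the singular simplicial set as continuous maps. -/
noncomputable def simplexEquiv (X : TopCat.{v}) (n : ℕ) :
    (TopCat.toSSet.obj X) _⦋n⦌ ≃ C(stdSimplex ℝ (Fin (n + 1)), X) :=
  TopCat.toSSetObjEquiv X (.op ⦋n⦌)

lemma simplexEquiv_δ (i : Fin (n + 2)) (x : (TopCat.toSSet.obj X) _⦋n + 1⦌) :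
    simplexEquiv X n ((TopCat.toSSet.obj X).δ i x) =
      (simplexEquiv X (n + 1) x).comp (faceMap i) := rfl

lemma simplexEquiv_map (f : X ⟶ Y) (x : (TopCat.toSSet.obj X) _⦋n⦌) :
    simplexEquiv Y n ((TopCat.toSSet.map f).app _ x) = f.hom.comp (simplexEquiv X n x) := rfl

/-- The basis element of the singular chain complex given by a simplex. -/
noncomputable def simplexChain (k : Type u) [Field k] (τ : C(stdSimplex ℝ (Fin (n + 1)), X)) :
    ((singularChains.{u, v} k).obj X).X n :=
  (SSet.ιChainComplex (R := ModuleCat.of k (ULift.{v} k)) (TopCat.toSSet.obj X)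
    ((simplexEquiv X n).symm τ)).hom (ULift.up 1)

/-- Formal combinations of singular simplices as elements of the singular chain complex. -/
noncomputable def toSingular (k : Type u) [Field k] (X : TopCat.{v}) (n : ℕ) :
    SingChain k X (n + 1) →ₗ[k] ((singularChains.{u, v} k).obj X).X n :=
  Finsupp.linearCombination k (simplexChain k)

lemma toSingular_single (τ : C(stdSimplex ℝ (Fin (n + 1)), X)) :
    toSingular k X n (Finsupp.single τ 1) = simplexChain k τ := by
  rw [toSingular, Finsupp.linearCombination_single, one_smul]

/-- Evaluation of homomorphisms at an element. -/
def evalHom {M N : ModuleCat.{max u v} k} (x : M) : (M ⟶ N) →+ N :=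
  AddMonoidHom.mk' (fun φ => φ.hom x) fun _ _ => rfl

lemma d_simplexChain (τ : C(stdSimplex ℝ (Fin (n + 2)), X)) :
    ((singularChains.{u, v} k).obj X).d (n + 1) n (simplexChain k τ) =
      ∑ i : Fin (n + 2), (-1 : k) ^ (i : ℕ) • simplexChain k (τ.comp (faceMap i)) := by
  have h := congrArg (evalHom (ULift.up 1)) (SSet.ιChainComplex_d
    (R := ModuleCat.of k (ULift.{v} k)) (TopCat.toSSet.obj X) ((simplexEquiv X (n + 1)).symm τ))
  rw [map_sum] at h
  refine h.trans (Finset.sum_congr rfl fun i _ => ?_)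
  rw [map_zsmul]
  have hδ : (TopCat.toSSet.obj X).δ i ((simplexEquiv X (n + 1)).symm τ) =
      (simplexEquiv X n).symm (τ.comp (faceMap i)) := by
    rw [Equiv.eq_symm_apply, simplexEquiv_δ, Equiv.apply_symm_apply]
  rw [hδ, ← Int.cast_smul_eq_zsmul k]
  push_cast
  rfl

lemma map_simplexChain (f : X ⟶ Y) (τ : C(stdSimplex ℝ (Fin (n + 1)), X)) :
    ((singularChains.{u, v} k).map f).f n (simplexChain k τ) = simplexChain k (f.hom.comp τ) := by
  have h := congrArg (evalHom (ULift.up 1)) (SSet.ι_chainComplexMap_f _ _ (TopCat.toSSet.map f)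
    (ModuleCat.of k (ULift.{v} k)) ((simplexEquiv X n).symm τ))
  refine h.trans ?_
  have hf : (TopCat.toSSet.map f).app _ ((simplexEquiv X n).symm τ) =
      (simplexEquiv Y n).symm (f.hom.comp τ) := by
    rw [Equiv.eq_symm_apply, simplexEquiv_map, Equiv.apply_symm_apply]
  rw [hf]
  rfl

lemma d_toSingular (x : SingChain k X (n + 2)) :
    ((singularChains.{u, v} k).obj X).d (n + 1) n (toSingular k X (n + 1) x) =
      toSingular k X n (singBoundary x) := by
  refine finsupp_hom_ext (f := (((singularChains.{u, v} k).obj X).d (n + 1) n).hom ∘ₗ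
    toSingular k X (n + 1)) (g := toSingular k X n ∘ₗ singBoundary) (fun τ => ?_) x
  simp only [LinearMap.comp_apply, toSingular_single, singBoundary_single, map_sum, map_smul]
  exact d_simplexChain τ

lemma map_toSingular (f : X ⟶ Y) (x : SingChain k X (n + 1)) :
    ((singularChains.{u, v} k).map f).f n (toSingular k X n x) =
      toSingular k Y n (singMap f.hom x) := by
  refine finsupp_hom_ext (f := (((singularChains.{u, v} k).map f).f n).hom ∘ₗ
    toSingular k X n) (g := toSingular k Y n ∘ₗ singMap f.hom) (fun τ => ?_) x
  simp only [LinearMap.comp_apply, toSingular_single, singMap_single]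
  exact map_simplexChain f τ

/-- The chain module is a coproduct of copies of the field over the simplices; its universal
property gives the inverse ψ. -/
lemma toSingular_bijective : Function.Bijective (toSingular k X n) := by
  let ψ : ((singularChains.{u, v} k).obj X).X n ⟶ ModuleCat.of k (SingChain k X (n + 1)) :=
    Limits.Cofan.IsColimit.desc ((TopCat.toSSet.obj X).isColimitChainComplexXCofan
      (ModuleCat.of k (ULift.{v} k)) n) fun x =>
        ModuleCat.ofHom (Finsupp.lsingle (simplexEquiv X n x) ∘ₗ ULift.moduleEquiv.toLinearMap)
  have hψ : ∀ x, SSet.ιChainComplex (R := ModuleCat.of k (ULift.{v} k)) (TopCat.toSSet.obj X) x ≫ ψ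
      = ModuleCat.ofHom (Finsupp.lsingle (simplexEquiv X n x) ∘ₗ ULift.moduleEquiv.toLinearMap) :=
    fun x => Limits.Cofan.IsColimit.fac _ _ x
  have h1 : ∀ x, ψ (toSingular k X n x) = x := fun x => by
    refine finsupp_hom_ext (f := ψ.hom ∘ₗ toSingular k X n) (g := LinearMap.id) (fun τ => ?_) x
    rw [LinearMap.comp_apply, toSingular_single]
    have := congr($(hψ ((simplexEquiv X n).symm τ)) (ULift.up 1))
    refine this.trans ?_
    simp
  have h2 : ψ ≫ ModuleCat.ofHom (toSingular k X n) = 𝟙 _ := by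
    refine SSet.chainComplex_hom_ext fun x => ?_
    refine (Category.assoc _ _ _).symm.trans ?_
    refine (congrArg (· ≫ _) (hψ x)).trans ?_
    refine Eq.trans ?_ (Category.comp_id _).symm
    refine ModuleCat.hom_ext (LinearMap.ext fun r => ?_)
    change toSingular k X n (Finsupp.single (simplexEquiv X n x) r.down) = _
    rw [toSingular, Finsupp.linearCombination_single, simplexChain, Equiv.symm_apply_apply]
    refine (LinearMap.map_smul (SSet.ιChainComplex (R := ModuleCat.of k (ULift.{v} k))
      (TopCat.toSSet.obj X) x).hom _ _).symm.trans ?_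
    exact congrArg _ (ULift.ext _ _ (mul_one r.down))
  refine ⟨Function.LeftInverse.injective h1, fun y => ⟨ψ y, ?_⟩⟩
  exact congr($h2 y)

end SingularComplex

/-! ### Singular chains of a subspace -/

section Embedding

variable {k : Type u} [Field k] {Z Z' : Type*} [TopologicalSpace Z] [TopologicalSpace Z'] {n : ℕ}

lemma singSimplex_comp_injective {f : C(Z, Z')} (hf : Function.Injective f) :
    Function.Injective fun τ : C(stdSimplex ℝ (Fin n), Z) => f.comp τ := fun _ _ h =>
  ContinuousMap.ext fun t => hf (DFunLike.congr_fun h t)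

lemma singMap_injective {f : C(Z, Z')} (hf : Function.Injective f) :
    Function.Injective (singMap (k := k) (n := n) f) :=
  Finsupp.mapDomain_injective (singSimplex_comp_injective hf)

lemma singMap_mem_iff {f : C(Z, Z')} (hf : Function.Injective f) {B : Set Z'}
    {x : SingChain k Z n} : singMap f x ∈ singOn k B n ↔ x ∈ singOn k (f ⁻¹' B) n := by
  classical
  refine ⟨fun h τ hτ => ?_, fun h => singMap_mem_of_mapsTo (Set.mapsTo_preimage f B) h⟩
  have hsub := (Finsupp.mem_supported k _).1 h
  rw [singMap, Finsupp.lmapDomain_apply,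
    Finsupp.mapDomain_support_of_injective (singSimplex_comp_injective hf)] at hsub
  exact hsub (Finset.mem_coe.2 (Finset.mem_image_of_mem _ hτ))

/-- The inclusion of a subset. -/
def valMap (A : Set Z) : C(A, Z) := ⟨Subtype.val, continuous_subtype_val⟩

lemma mem_singOn_iff_exists {A : Set Z} {y : SingChain k Z n} :
    y ∈ singOn k A n ↔ ∃ x : SingChain k A n, singMap (valMap A) x = y := by
  constructor
  · intro hy
    refine map_mem_of_supported (f := LinearMap.id)
      (N := LinearMap.range (singMap (k := k) (n := n) (valMap A))) (fun τ hτ => ?_) hy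
    refine ⟨Finsupp.single ⟨fun t => ⟨τ t, hτ t⟩, by fun_prop⟩ 1, ?_⟩
    rw [singMap_single]
    rfl
  · rintro ⟨x, rfl⟩
    exact singMap_mem (fun z => z.2) x

/-- Singular cycles of the pair `(Z, A)` lift to reduced cycles of `Z`. -/
def PairLifts (k : Type u) [Field k] (A : Set Z) (n : ℕ) : Prop :=
  ∀ c : SingChain k Z (n + 1), singBoundary c ∈ singOn k A n →
    ∃ z : SingChain k Z (n + 1), singBoundary z = 0 ∧ ∃ a ∈ singOn k A (n + 1),
      ∃ b : SingChain k Z (n + 2), c = z + a + singBoundary b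

end Embedding

/-! ### The canonical map on homology in terms of chains -/

section Translation

variable {k : Type u} [Field k] {n : ℕ}

/-- Straight-line constructions take place in `V → ℝ`, whereas Buchsbaum* refers to the realization
as a space; chains of the subspace embed in those of the ambient space. -/
lemma singLifts_iff_pairLifts {V : Type v} [LinearOrder V] {Y : Set (V → ℝ)} {p : Y} :
    SingLifts k Y p n ↔ PairLifts k ({p}ᶜ : Set Y) n := by
  have hinj : Function.Injective (valMap Y) := Subtype.val_injective
  have hmem : ∀ {j : ℕ} {x : SingChain k Y j}, singMap (valMap Y) x ∈ singOn k (Y \ {p.1}) j ↔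
      x ∈ singOn k ({p}ᶜ : Set Y) j := by
    intro j x
    rw [singMap_mem_iff hinj]
    have : valMap Y ⁻¹' (Y \ {p.1}) = {p}ᶜ := by
      ext y
      have hy : valMap Y y = y.1 := rfl
      simp [hy, Subtype.ext_iff]
    rw [this]
  constructor
  · intro h c hc
    obtain ⟨z, hz, hbz, a, ha, b, hb, e⟩ := h (singMap (valMap Y) c)
      (mem_singOn_iff_exists.2 ⟨c, rfl⟩) (by rw [singBoundary_singMap]; exact hmem.2 hc)
    obtain ⟨z, rfl⟩ := mem_singOn_iff_exists.1 hz
    obtain ⟨a, rfl⟩ := mem_singOn_iff_exists.1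
      (Finsupp.supported_mono (t := {τ | ∀ t, τ t ∈ Y}) (fun τ hτ t => (hτ t).1) ha)
    obtain ⟨b, rfl⟩ := mem_singOn_iff_exists.1 hb
    rw [singBoundary_singMap] at hbz e
    rw [← map_add, ← map_add] at e
    exact ⟨z, singMap_injective hinj (hbz.trans (map_zero _).symm), a, hmem.1 ha, b,
      singMap_injective hinj e⟩
  · intro h c hc hbc
    obtain ⟨c, rfl⟩ := mem_singOn_iff_exists.1 hc
    rw [singBoundary_singMap, hmem] at hbc
    obtain ⟨z, hz, a, ha, b, e⟩ := h c hbc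
    refine ⟨singMap (valMap Y) z, mem_singOn_iff_exists.2 ⟨z, rfl⟩, ?_,
      singMap (valMap Y) a, hmem.2 ha, singMap (valMap Y) b, mem_singOn_iff_exists.2 ⟨b, rfl⟩, ?_⟩
    · rw [singBoundary_singMap, hz, map_zero]
    · rw [singBoundary_singMap, e, map_add, map_add]

variable {X : TopCat.{v}}

lemma exists_inclusion_eq_iff {A : Set X} {x : SingChain k X (n + 1)} :
    (∃ a, ((singularChains.{u, v} k).map (subspaceInclusion X A)).f n a = toSingular k X n x) ↔
      x ∈ singOn k A (n + 1) := by
  rw [mem_singOn_iff_exists]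
  constructor
  · rintro ⟨a, ha⟩
    obtain ⟨a, rfl⟩ := toSingular_bijective.2 a
    rw [map_toSingular] at ha
    exact ⟨a, toSingular_bijective.1 ha⟩
  · rintro ⟨a, rfl⟩
    exact ⟨toSingular k _ n a, map_toSingular _ _⟩

/-- The map to the one-point space. -/
def toPoint (X : TopCat.{v}) : X ⟶ TopCat.of PUnit.{v + 1} :=
  TopCat.ofHom (ContinuousMap.const X PUnit.unit)

instance : Subsingleton C(stdSimplex ℝ (Fin n), PUnit.{v + 1}) :=
  ⟨fun _ _ => ContinuousMap.ext fun _ => rfl⟩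

instance : IsEmpty (stdSimplex ℝ (Fin 0)) :=
  ⟨fun t => zero_ne_one ((Fin.sum_univ_zero t.1).symm.trans t.2.2)⟩

instance {Z : Type*} [TopologicalSpace Z] : Subsingleton C(stdSimplex ℝ (Fin 0), Z) :=
  ⟨fun _ _ => ContinuousMap.ext fun t => (IsEmpty.false t).elim⟩

lemma singBoundary_zero_single {Z : Type*} [TopologicalSpace Z]
    (τ : C(stdSimplex ℝ (Fin 1), Z)) (a : k) :
    singBoundary (Finsupp.single τ a) = Finsupp.single (τ.comp (faceMap 0)) a := by
  rw [singBoundary_single, Fin.sum_univ_one]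
  simp

/-- For a point the differential into degree 0 is zero and the augmentation is injective. So the
kernel condition that defines reduced homology says in degree 0 that the augmentation vanishes. -/
lemma exists_d_point_iff {z : SingChain k X 1} :
    (∃ q, ((singularChains.{u, v} k).obj (TopCat.of PUnit.{v + 1})).d 1 0 q =
      ((singularChains.{u, v} k).map (toPoint X)).f 0 (toSingular k X 0 z)) ↔
      singBoundary z = 0 := by
  have h1 : ∀ q : SingChain k PUnit.{v + 1} 2, singBoundary q = 0 := fun q => by
    refine finsupp_hom_ext (f := singBoundary) (g := 0) (fun τ => ?_) q
    rw [singBoundary_single, Fin.sum_univ_two, Subsingleton.elim (τ.comp (faceMap 1))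
      (τ.comp (faceMap 0))]
    simp
  have h2 : Function.Injective (singBoundary : SingChain k PUnit.{v + 1} 1 →ₗ[k] _) := by
    have : (singBoundary : SingChain k PUnit.{v + 1} 1 →ₗ[k] _) =
        Finsupp.lmapDomain k k fun τ => τ.comp (faceMap 0) :=
      LinearMap.ext fun x => finsupp_hom_ext (fun τ => by
        rw [singBoundary_zero_single, Finsupp.lmapDomain_apply, Finsupp.mapDomain_single]) x
    rw [this]
    exact Finsupp.mapDomain_injective (Function.injective_of_subsingleton _)
  have h3 : Function.Injective (singMap (k := k) (n := 0) (toPoint X).hom) :=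
    Finsupp.mapDomain_injective (Function.injective_of_subsingleton _)
  constructor
  · rintro ⟨q, hq⟩
    obtain ⟨q, rfl⟩ := toSingular_bijective.2 q
    rw [d_toSingular, map_toSingular] at hq
    have hq' := toSingular_bijective.1 hq
    refine h3 ?_
    rw [← singBoundary_singMap, ← hq']
    rw [h1, map_zero, map_zero]
  · intro hz
    refine ⟨0, ?_⟩
    rw [map_zero, map_toSingular]
    have : singMap (toPoint X).hom z = 0 := h2 (by
      rw [singBoundary_singMap, hz, map_zero, map_zero])
    rw [this, map_zero]

/-- In positive degrees a point has no homology, so there the kernel condition of reduced homology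
is automatic. -/
lemma exists_d_point {y : ((singularChains.{u, v} k).obj (TopCat.of PUnit.{v + 1})).X (n + 1)}
    (hy : ((singularChains.{u, v} k).obj (TopCat.of PUnit.{v + 1})).d (n + 1) n y = 0) :
    ∃ q, ((singularChains.{u, v} k).obj (TopCat.of PUnit.{v + 1})).d (n + 2) (n + 1) q = y := by
  have h := AlgebraicTopology.singularChainComplexFunctor_exactAt_of_totallyDisconnectedSpace
    (ModuleCat.{max u v} k) (n + 1) (ModuleCat.of k (ULift.{v} k)) (TopCat.of PUnit.{v + 1})
    (Nat.succ_ne_zero n)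
  rw [HomologicalComplex.exactAt_iff' _ (n + 2) (n + 1) n (ChainComplex.prev ℕ (n + 1))
    (ChainComplex.next_nat_succ n), ShortComplex.moduleCat_exact_iff] at h
  exact h y hy

/-- Surjectivity of the canonical map in terms of chains. -/
theorem surjective_canonicalMap_iff (A : Set X) :
    Function.Surjective (canonicalMap.{u, v} k n X A) ↔ PairLifts k A n := by
  have main : ∀ {j : ℕ}, (ComplexShape.down ℕ).next n = j →
      (∀ c : SingChain k X (n + 1),
        (∃ a, ((singularChains.{u, v} k).map (subspaceInclusion X A)).f j a =
          ((singularChains.{u, v} k).obj X).d n j (toSingular k X n c)) ↔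
        singBoundary c ∈ singOn k A n) →
      (∀ z : SingChain k X (n + 1),
        (((singularChains.{u, v} k).obj X).d n j (toSingular k X n z) = 0 ∧
          ∃ q, ((singularChains.{u, v} k).obj (TopCat.of PUnit.{v + 1})).d (n + 1) n q =
            ((singularChains.{u, v} k).map (toPoint X)).f n (toSingular k X n z)) ↔
        singBoundary z = 0) →
      (Function.Surjective (canonicalMap.{u, v} k n X A) ↔ PairLifts k A n) := by
    intro j hj hC hZ
    refine (surjective_homologyMap_restrict_iff _ _ hj).trans ⟨fun h c hc => ?_, fun h c hc => ?_⟩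
    · obtain ⟨z, hz, hq, a, b, e⟩ := h (toSingular k X n c) ((hC c).2 hc)
      obtain ⟨z, rfl⟩ := toSingular_bijective.2 z
      obtain ⟨b, rfl⟩ := toSingular_bijective.2 b
      obtain ⟨a, rfl⟩ := toSingular_bijective.2 a
      refine ⟨z, (hZ z).1 ⟨hz, hq⟩, _, mem_singOn_iff_exists.2 ⟨a, rfl⟩, b,
        toSingular_bijective.1 ?_⟩
      rw [e, map_toSingular, d_toSingular, map_add, map_add]
      rfl
    · obtain ⟨c, rfl⟩ := toSingular_bijective.2 c
      obtain ⟨z, hz, a, ha, b, rfl⟩ := h c ((hC c).1 hc)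
      obtain ⟨a', ha'⟩ := exists_inclusion_eq_iff.2 ha
      refine ⟨toSingular k X n z, ((hZ z).2 hz).1, ((hZ z).2 hz).2, a',
        toSingular k X (n + 1) b, ?_⟩
      rw [ha', d_toSingular, map_add, map_add]
  cases n with
  | zero =>
    -- In degree 0 the relative cycle condition is void on both sides: the differential is zero, and
    -- the empty simplex has no points, so it lies in every subset.
    have hd : ∀ x, ((singularChains.{u, v} k).obj X).d 0 0 x = 0 := fun x => by
      rw [((singularChains.{u, v} k).obj X).shape 0 0 (by simp)]
      rfl
    refine main ChainComplex.next_nat_zero (fun c => ?_) fun z => ?_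
    · rw [hd]
      refine iff_of_true ⟨0, map_zero _⟩ fun τ _ t => (IsEmpty.false t).elim
    · rw [hd, exists_d_point_iff]
      simp
  | succ n =>
    refine main (ChainComplex.next_nat_succ n) (fun c => ?_) fun z => ?_
    · rw [d_toSingular, exists_inclusion_eq_iff]
    · rw [d_toSingular]
      constructor
      · rintro ⟨h, -⟩
        exact toSingular_bijective.1 (h.trans (map_zero _).symm)
      · intro h
        rw [h, map_zero]
        refine ⟨rfl, exists_d_point ?_⟩
        rw [f_d_apply, d_toSingular, h, map_zero, map_zero]

end Translation

/-! ### Simplicial form of the Buchsbaum* condition -/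

section Star

variable {k : Type u} [Field k] {V : Type v} [LinearOrder V] {Γ : SimplicialCpx V}

lemma exists_interiorPoint {σ : Finset V} (hσ : σ.Nonempty) : ∃ p, InteriorPoint σ p := by
  have hc : (0 : ℝ) < σ.card := Nat.cast_pos.2 hσ.card_pos
  refine ⟨fun v => if v ∈ σ then (σ.card : ℝ)⁻¹ else 0, hσ, ⟨fun v => ?_, fun v hv => ?_, ?_⟩,
    fun v hv => ?_⟩
  · dsimp only
    split_ifs <;> positivity
  · simp [hv]
  · rw [Finset.sum_congr rfl fun v hv => if_pos hv, Finset.sum_const, nsmul_eq_mul,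
      mul_inv_cancel₀ hc.ne']
  · simp only [if_pos hv]
    positivity

/-- The face is the set of vertices at which `p` has a positive coordinate. -/
lemma exists_face_of_mem_realization {p : V → ℝ} (hp : p ∈ Γ.realization) :
    ∃ σ ∈ Γ.faces, InteriorPoint σ p := by
  obtain ⟨τ, hτ, h1, h2, h3⟩ := mem_realization.1 hp
  have hpos : ∀ v ∈ τ, v ∉ τ.filter (0 < p ·) → p v = 0 := fun v hv hv' =>
    le_antisymm (not_lt.1 fun h => hv' (Finset.mem_filter.2 ⟨hv, h⟩)) (h1 v)
  have hsum : ∑ v ∈ τ.filter (0 < p ·), p v = 1 :=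
    (Finset.sum_subset (Finset.filter_subset _ _) hpos).trans h3
  refine ⟨τ.filter (0 < p ·), Γ.down_closed hτ (Finset.filter_subset _ _), ?_,
    ⟨h1, fun v hv => ?_, hsum⟩, fun v hv => (Finset.mem_filter.1 hv).2⟩
  · rw [Finset.nonempty_iff_ne_empty]
    intro h
    rw [h, Finset.sum_empty] at hsum
    exact zero_ne_one hsum
  · by_cases hvτ : v ∈ τ
    · exact hpos v hvτ hv
    · exact h2 v hvτ

lemma InteriorPoint.mem_realization {σ : Finset V} {p : V → ℝ} (hp : InteriorPoint σ p)
    (hσ : σ ∈ Γ.faces) : p ∈ Γ.realization :=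
  SimplicialCpx.mem_realization.2 ⟨σ, hσ, hp.mem⟩

/-- A simplicial description of Buchsbaum* complexes. -/
theorem isBuchsbaumStar_iff : IsBuchsbaumStar k Γ ↔ IsBuchsbaum k Γ ∧
    ∀ σ ∈ Γ.faces, σ.Nonempty → LiftsCycles k Γ Γ.rank σ := by
  -- A nonempty face makes the rank positive, so the degree `Γ.rank - 1` is not truncated.
  have hrank : ∀ {σ}, σ ∈ Γ.faces → σ.Nonempty → Γ.rank - 1 + 1 = Γ.rank := fun {σ} h1 h2 =>
    Nat.sub_add_cancel (h2.card_pos.trans_le (Finset.le_sup (f := Finset.card) h1))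
  refine and_congr_right fun hB => ⟨fun h σ hσ hne => ?_, fun h p => ?_⟩
  · obtain ⟨p, hp⟩ := exists_interiorPoint hne
    have hV : Nonempty V := ⟨hne.choose⟩
    have hs := singLifts_iff_pairLifts.2
      ((surjective_canonicalMap_iff _).1 (h ⟨p, hp.mem_realization hσ⟩))
    rw [← hrank hσ hne]
    refine hp.liftsCycles ?_ hs
    rw [hrank hσ hne]
    exact isPure_iff.1 hB.1
  · obtain ⟨σ, hσ, hp⟩ := exists_face_of_mem_realization p.2
    refine (surjective_canonicalMap_iff _).2 (singLifts_iff_pairLifts.1 (hp.singLifts ?_))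
    rw [hrank hσ hp.nonempty]
    exact h σ hσ hp.nonempty

end Star

/-! ### Balanced complexes and the theorem -/

section Balanced

variable {k : Type u} [Field k] {V : Type v} [LinearOrder V] {Δ : SimplicialCpx V} {d : ℕ}
  {κ : V → ℕ}

lemma IsBalancedColoring.rank_eq (hκ : Δ.IsBalancedColoring d κ) : Δ.rank = d := by
  have := hκ.dim_eq
  rw [dim] at this
  omega

lemma IsBalancedColoring.isColoredBy (hκ : Δ.IsBalancedColoring d κ) :
    Δ.IsColoredBy κ (Finset.Icc 1 d) where
  color_mem s hs v hv := hκ.color_mem v (Δ.down_closed hs (Finset.singleton_subset_iff.2 hv))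
  injOn s hs v hv w hw h := by
    by_contra hne
    refine hκ.color_ne v w hne (Δ.down_closed hs ?_) h
    exact Finset.insert_subset hv (Finset.singleton_subset_iff.2 hw)

theorem IsBalancedColoring.isBuchsbaumStar_rankSelected (hκ : Δ.IsBalancedColoring d κ)
    (hΔ : IsDoublyBuchsbaumOfRank k Δ d) {S : Finset ℕ} (hS : S ⊂ Finset.Icc 1 d) :
    IsBuchsbaumStar k (Δ.rankSelected κ S) := by
  have hcard : (Finset.Icc 1 d).card = d := by simp
  obtain ⟨h1, h2⟩ := hκ.isColoredBy.liftsCycles_rankSelected (hcard.symm ▸ hΔ) hS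
  refine isBuchsbaumStar_iff.2 ⟨(isBuchsbaum_iff h1.1.rank_eq).2 h1, ?_⟩
  rw [h1.1.rank_eq]
  exact h2

end Balanced

end SimplicialCpx

theorem theorem3p1 (k : Type u) [Field k] {V : Type v} [LinearOrder V]
    (Δ : SimplicialCpx V) (d : ℕ) (κ : V → ℕ) (hκ : Δ.IsBalancedColoring d κ) :
    (SimplicialCpx.IsDoublyBuchsbaum k Δ →
      ∀ S : Finset ℕ, S ⊂ Finset.Icc 1 d →
        SimplicialCpx.IsBuchsbaumStar k (Δ.rankSelected κ S)) ∧
    (SimplicialCpx.IsBuchsbaumStar k Δ →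
      ∀ S : Finset ℕ, S ⊆ Finset.Icc 1 d →
        SimplicialCpx.IsBuchsbaumStar k (Δ.rankSelected κ S)) := by
  refine ⟨fun h S hS => ?_, fun h S hS => ?_⟩
  · exact hκ.isBuchsbaumStar_rankSelected
      ((SimplicialCpx.isDoublyBuchsbaum_iff hκ.rank_eq).1 h) hS
  · rcases hS.eq_or_ssubset with rfl | hS
    · rwa [hκ.isColoredBy.rankSelected_eq]
    -- A Buchsbaum* complex is doubly Buchsbaum, so proper subsets are covered by part 1.
    · obtain ⟨h1, h2⟩ := SimplicialCpx.isBuchsbaumStar_iff.1 h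
      rw [hκ.rank_eq] at h2
      exact hκ.isBuchsbaumStar_rankSelected
        (((SimplicialCpx.isBuchsbaum_iff hκ.rank_eq).1 h1).isDoublyBuchsbaum_of_liftsCycles h2) hS
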